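/- Let $k\ge 2$ be an integer and $\delta\in[0,1]$ a real constant. An instance on $n$ Boolean variables is a finite set of clauses, a clause being a finite set of literals, and in a $k$-instance every clause has at most $k$ literals. A clause is NAE-satisfied by an assignment if it contains at least one true and at least one false literal; $s(\alpha)$ denotes the number of NAE-satisfied clauses of the instance under $\alpha$, and $\alpha$ is a $\delta$-approximation if $s(\alpha)\ge\delta\max_{\beta}s(\beta)$. MAX-NAE-$k$-SAT has a randomized $T(n)$-time $\delta$-approximation if there is a randomized algorithm that, on every $k$-instance on $n$ variables, always halts within $T(n)$ steps and outputs a $\delta$-approximation with high probability (here: with probability at least $1-2^{-n}$). For $k\ge 3$ consider the following equation system in the real variables $\gamma',\xi',\theta',\eta$, where $2<\eta\le k$: $$\xi'=\frac{2^{k-1}(\eta+k-4)-2\eta+4}{2^k(k-2)},\qquad \gamma'=2^{\frac{\theta'}{1-\delta+\theta'}}=2-\frac{2\xi'-2\xi'\delta}{k-\xi'\delta k},\qquad \frac{2}{\theta'-2}=\frac1{\eta-2}+\frac1{k-2}\cdot\frac{2^{k-2}-1}{2^{k-2}}.$$ For $k=2$ let the system consist of $\xi'=\tfrac12$ and $\gamma'=2-\frac{2\xi'-2\xi'\delta}{k-\xi'\delta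 k}$ only. Then the system has a solution, the value of $\gamma'$ is the same in all its solutions, $\gamma'<2$ if $\delta<1$, and MAX-NAE-$k$-SAT has a randomized $2^{o(n)}\cdot\gamma'^{\,n}$-time $\delta$-approximation. The algorithm is a program of a random access machine which, if $\delta$ is irrational, is given the constant $\delta$ through comparisons $a\le\delta b$ of natural numbers $a,b$; if $\delta$ is rational, it is an ordinary program without such comparisons. -/

import Mathlib

open Filter Asymptotics

namespace MaxNAE

/-! ### Instances of MAX-NAE-`k`-SAT -/

/-- A literal over the variables `v_0, …, v_{n-1}`: `(v, true)` is the variable `v`,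
`(v, false)` is its negation. -/
abbrev Literal (n : ℕ) : Type := Fin n × Bool

/-- A clause is a finite set of literals. -/
abbrev Clause (n : ℕ) : Type := Finset (Literal n)

/-- An instance on `n` variables is a finite set of clauses. -/
abbrev Instance (n : ℕ) : Type := Finset (Clause n)

/-- The truth value of a literal under an assignment. -/
def Literal.value {n : ℕ} (α : Fin n → Bool) (l : Literal n) : Bool :=
  if l.2 then α l.1 else !(α l.1)

/-- `s(α)`: the number of clauses of `F` that are NAE-satisfied by `α`, i.e. contain at least
one true and at least one false literal. -/
def numSat {n : ℕ} (F : Instance n) (α : Fin n → Bool) : ℕ :=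
  (F.filter fun C =>
    (∃ l ∈ C, l.value α = true) ∧ (∃ l ∈ C, l.value α = false)).card

/-- The value of an optimal assignment. -/
def opt {n : ℕ} (F : Instance n) : ℕ :=
  Finset.univ.sup (numSat F)

/-- Every clause has at most `k` literals. -/
def IsKInstance (k : ℕ) {n : ℕ} (F : Instance n) : Prop :=
  ∀ C ∈ F, C.card ≤ k

/-- `α` is a `δ`-approximation assignment of `F`. -/
def IsApprox (δ : ℝ) {n : ℕ} (F : Instance n) (α : Fin n → Bool) : Prop :=
  δ * (opt F : ℝ) ≤ (numSat F α : ℝ)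

/-! ### Randomized random access machines

A program works on natural-number registers and on arrays of natural numbers with indirect
addressing. The only arithmetic is counting up and down by one, so that in `t` steps the
largest number grows by at most `t` (apart from the fixed constants of the program); each
instruction and each test takes one unit of time. -/

/-- The memory: register `i` holds `reg i`, entry `p` of array `a` is `arr a p`. -/
structure Memory where
  reg : ℕ → ℕ
  arr : ℕ → ℕ → ℕ

/-- Overwrite register `i`. -/
def Memory.setReg (s : Memory) (i v : ℕ) : Memory :=
  { s with reg := Function.update s.reg i v }

/-- Overwrite entry `p` of array `a`. -/
def Memory.setArr (s : Memory) (a p v : ℕ) : Memory :=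
  { s with arr := Function.update s.arr a (Function.update (s.arr a) p v) }

/-- The elementary instructions. -/
inductive Instr where
  /-- register `i` := the constant `c` -/
  | const (i c : ℕ)
  /-- register `i` := register `j` -/
  | copy (i j : ℕ)
  /-- register `i` := register `i` + 1 -/
  | inc (i : ℕ)
  /-- register `i` := register `i` - 1, or 0 if it was 0 -/
  | dec (i : ℕ)
  /-- register `i` := entry of array `a` at the index held by register `j` -/
  | read (i a j : ℕ)
  /-- entry of array `a` at the index held by register `i` := register `j` -/
  | write (a i j : ℕ)
  /-- register `i` := uniformly random element of `{0, …, r - 1}`, where register `j` holds `r`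
  (and `0` if `r = 0`) -/
  | rand (i j : ℕ)

/-- The effect of an instruction. All random choices are independent. -/
noncomputable def Instr.exec : Instr → Memory → PMF Memory
  | .const i c, s => PMF.pure (s.setReg i c)
  | .copy i j, s => PMF.pure (s.setReg i (s.reg j))
  | .inc i, s => PMF.pure (s.setReg i (s.reg i + 1))
  | .dec i, s => PMF.pure (s.setReg i (s.reg i - 1))
  | .read i a j, s => PMF.pure (s.setReg i (s.arr a (s.reg j)))
  | .write a i j, s => PMF.pure (s.setArr a (s.reg i) (s.reg j))
  | .rand i j, s =>
      (PMF.uniformOfFinset (Finset.range (max 1 (s.reg j)))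
        (Finset.nonempty_range_iff.mpr (by omega))).map (s.setReg i)

/-- The tests. -/
inductive Test where
  /-- is register `i` smaller than register `j`? -/
  | lt (i j : ℕ)
  /-- is register `i` at most `δ` times register `j`? -/
  | ratio (i j : ℕ)

/-- The meaning of a test; `δ` is the real constant that `Test.ratio` refers to. -/
def Test.holds (δ : ℝ) : Test → Memory → Prop
  | .lt i j, s => s.reg i < s.reg j
  | .ratio i j, s => (s.reg i : ℝ) ≤ δ * (s.reg j : ℝ)

/-- Programs. -/
inductive Program where
  | instr (o : Instr)
  | seq (P Q : Program)
  /-- if the test holds then `P` else `Q` -/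
  | cond (b : Test) (P Q : Program)
  /-- while the test holds do `P` -/
  | loop (b : Test) (P : Program)

/-- No test compares with `δ`: the program is an ordinary finite program without access to any
real constant. -/
def Program.RatioFree : Program → Prop
  | .instr _ => True
  | .seq P Q => P.RatioFree ∧ Q.RatioFree
  | .cond b P Q => (∃ i j, b = .lt i j) ∧ P.RatioFree ∧ Q.RatioFree
  | .loop b P => (∃ i j, b = .lt i j) ∧ P.RatioFree

/-- The outcome of a computation with a time limit: `none` if the limit was exceeded, otherwise
the final memory and the number of time units that are left. -/
abbrev Outcome : Type := Option (Memory × ℕ)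

/-- Continue a computation that has not exceeded the time limit. -/
noncomputable def andThen (p : PMF Outcome) (f : Memory → ℕ → PMF Outcome) : PMF Outcome :=
  p.bind fun o =>
    match o with
    | none => PMF.pure none
    | some (s, t) => f s t

open Classical in
/-- Iterate `body` while `b` holds, for at most `r` evaluations of the test. -/
noncomputable def iterate (b : Memory → Prop) (body : Memory → ℕ → PMF Outcome) :
    ℕ → Memory → ℕ → PMF Outcome
  | 0, _, _ => PMF.pure none
  | _ + 1, _, 0 => PMF.pure none
  | r + 1, s, t + 1 =>
      if b s then andThen (body s t) (iterate b body r) else PMF.pure (some (s, t))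

open Classical in
/-- `P.run δ s t` is the distribution of the outcome of `P` started in memory `s` with the time
limit `t`. In a loop each evaluation of the test uses up time, so `t` evaluations exhaust it. -/
noncomputable def Program.run (δ : ℝ) : Program → Memory → ℕ → PMF Outcome
  | .instr _, _, 0 => PMF.pure none
  | .instr o, s, t + 1 => (o.exec s).map fun s' => some (s', t)
  | .seq P Q, s, t => andThen (P.run δ s t) (Q.run δ)
  | .cond _ _ _, _, 0 => PMF.pure none
  | .cond b P Q, s, t + 1 => if b.holds δ s then P.run δ s t else Q.run δ s t
  | .loop b P, s, t => iterate (b.holds δ) (P.run δ) t s t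

/-! ### Input, output and approximation algorithms -/

/-- `L` lists the clauses of `F` without repetition, each as a list of its literals without
repetition. -/
structure Lists {n : ℕ} (L : List (List (Literal n))) (F : Instance n) : Prop where
  literals_nodup : ∀ c ∈ L, c.Nodup
  clauses_nodup : (L.map List.toFinset).Nodup
  toFinset_eq : (L.map List.toFinset).toFinset = F

/-- The initial memory: register 0 holds the number `n` of variables, register 1 the number of
clauses. The literals of all clauses are written one after another, their variables into array 1
and their signs (1 positive, 0 negative) into array 2; entry `j` of array 0 is the position where
the `j`-th clause starts. Everything else is 0. -/
def input {n : ℕ} (L : List (List (Literal n))) : Memory where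
  reg i := if i = 0 then n else if i = 1 then L.length else 0
  arr a p :=
    if a = 0 then ((L.take p).map List.length).sum
    else if a = 1 then (L.flatten[p]?).elim 0 fun l => (l.1 : ℕ)
    else if a = 2 then (L.flatten[p]?).elim 0 fun l => l.2.toNat
    else 0

/-- The assignment that a computation returns, in array 3. -/
def output (n : ℕ) (s : Memory) : Fin n → Bool :=
  fun v => decide (s.arr 3 v = 1)

/-- The program `P` is a `T(n)`-time randomized `δ`-approximation algorithm for MAX-NAE-`k`-SAT:
on every `k`-instance on `n` variables it always halts within `T n` time units, and the assignment
that it returns fails to be a `δ`-approximation with probability at most `2 ^ (-n)`. -/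
def Approximates (P : Program) (k : ℕ) (δ : ℝ) (T : ℕ → ℝ) : Prop :=
  ∀ (n : ℕ) (F : Instance n), IsKInstance k F →
    ∀ L : List (List (Literal n)), Lists L F →
      P.run δ (input L) ⌊T n⌋₊ none = 0 ∧
      (P.run δ (input L) ⌊T n⌋₊).toOuterMeasure
        {o | ∃ s t, o = some (s, t) ∧ ¬ IsApprox δ F (output n s)} ≤ (1 / 2 : ENNReal) ^ n

/-- MAX-NAE-`k`-SAT has a `2 ^ o(n) * T(n)`-time randomized `δ`-approximation. For rational `δ` the
algorithm is an ordinary program; for irrational `δ` it is given `δ` through the comparisons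
`a ≤ δ * b` of natural numbers `a`, `b`. -/
def HasApproximation (k : ℕ) (δ : ℝ) (T : ℕ → ℝ) : Prop :=
  ∃ P : Program, (P.RatioFree ∨ Irrational δ) ∧
    ∃ f : ℕ → ℝ, f =o[atTop] (fun n : ℕ => (n : ℝ)) ∧
      Approximates P k δ fun n => (2 : ℝ) ^ f n * T n

/-! ### The equation system -/

/-- The equation system for `γ, ξ, θ, η`; here `η` is an average clause length, so it lies between
`2` and `k`, and it is not `2` as it occurs in the denominator `η - 2`. For `k = 2` the
relation between `θ` and `η` degenerates, and the equations for `ξ` and `γ` alone determine `γ`. -/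
def System (k : ℕ) (δ γ ξ θ η : ℝ) : Prop :=
  (ξ = if k = 2 then 1 / 2 else
    (2 ^ (k - 1) * (η + (k : ℝ) - 4) - 2 * η + 4) / (2 ^ k * ((k : ℝ) - 2))) ∧
  γ = 2 - (2 * ξ - 2 * ξ * δ) / ((k : ℝ) - ξ * δ * (k : ℝ)) ∧
  (3 ≤ k →
    2 < η ∧ η ≤ (k : ℝ) ∧
    γ = (2 : ℝ) ^ (θ / (1 - δ + θ)) ∧
    2 / (θ - 2) =
      1 / (η - 2) + 1 / ((k : ℝ) - 2) * ((2 ^ (k - 2) - 1) / 2 ^ (k - 2)))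

end MaxNAE

/-! The algorithm repeats independent trials and returns the best assignment seen. A trial starts
from a uniformly random assignment and then, for linearly many rounds, flips a random literal of a
random unsatisfied clause with at least two literals (Schöning's walk). The same program runs on
every instance; only the analysis distinguishes cases. Let `m` be the number of clauses with at
least two literals and `β` an optimal assignment. A random assignment NAE-satisfies a clause of
length `i` with probability at least `1 - 2 / 2 ^ i`; this is concave in `i`, hence above its chord
on `[2, k]`, so average length `η` yields at least `xi k η * m` satisfied clauses in expectation.
Fix `η` from the system, and let `δ < 1`.

(1) Average length at most `η`: the clauses satisfied by `β` have average length at most `θ = theta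
k η`. Some `κ n` variables, `κ = (1 - δ) / θ`, occur in at most a `1 - δ` fraction of them, and
changing `β` there arbitrarily leaves a `δ`-approximation. The random start is one with probability
about `2 ^ (-(1 - κ) n)` (`failAvg_le_of_short`).

(2) Average length above `η`, and the optimum less than `ξ₁ m` for a certain `ξ₁` slightly above
`ξ`: a random assignment is a `δ`-approximation with constant probability (`failAvg_le_of_opt_lt`).

(3) Optimum at least `ξ₁ m`: while the current assignment is no `δ`-approximation, `β` satisfies a
fixed fraction of the unsatisfied clauses (`walk_condition`), so a flip moves towards `β` with at
least a fixed probability. The potential `x ^ hammingDist α β` then grows in expectation, which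
yields a base below `walkBase` (`fail_le_walk`, `exists_walk`).

All three bases are strictly below `γ`, so some `2 ^ (u / w)` with natural `u`, `w` lies in between,
and the number of trials can be computed by counting, without access to `δ`. For `k ≥ 3` the system
is one equation in `η` between an increasing and a decreasing function, whence existence
(`exists_system`) and uniqueness (`system_unique`).

The program is verified by weighing every outcome: `⊤` for a timeout or a broken invariant,
otherwise a bound for the failure probability (`Spec`). A finite expectation thus proves termination
and success at once (`approximates_of_spec`). -/

namespace MaxNAE

/-! ### A program logic for expectations and running times. -/

/-! ### Expectations of extended nonnegative functions -/

/-- The expectation of `f` under `p`. -/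
noncomputable def ev {α : Type*} (p : PMF α) (f : α → ENNReal) : ENNReal := ∑' x, p x * f x

lemma ev_pure {α : Type*} (x : α) (f : α → ENNReal) : ev (PMF.pure x) f = f x := by
  classical
  unfold ev
  rw [tsum_eq_single x]
  · simp
  · intro y hy
    simp [PMF.pure_apply, hy]

lemma ev_bind {α β : Type*} (p : PMF α) (g : α → PMF β) (f : β → ENNReal) :
    ev (p.bind g) f = ev p fun x => ev (g x) f := by
  unfold ev
  simp only [PMF.bind_apply, ← ENNReal.tsum_mul_right, ← ENNReal.tsum_mul_left]
  rw [ENNReal.tsum_comm]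
  simp only [mul_assoc]

lemma ev_map {α β : Type*} (p : PMF α) (g : α → β) (f : β → ENNReal) :
    ev (p.map g) f = ev p fun x => f (g x) := by
  rw [← PMF.bind_pure_comp, ev_bind]
  simp only [Function.comp_def, ev_pure]

lemma ev_mono {α : Type*} (p : PMF α) {f g : α → ENNReal}
    (h : ∀ x ∈ p.support, f x ≤ g x) : ev p f ≤ ev p g := by
  unfold ev
  refine ENNReal.tsum_le_tsum fun x => ?_
  by_cases hx : p x = 0
  · simp [hx]
  · exact mul_le_mul_right (h x ((PMF.mem_support_iff _ _).2 hx)) _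

lemma ev_const {α : Type*} (p : PMF α) (a : ENNReal) : ev p (fun _ => a) = a := by
  unfold ev
  rw [ENNReal.tsum_mul_right, p.tsum_coe, one_mul]

lemma ev_uniformOfFinset {α : Type*} (s : Finset α) (hs : s.Nonempty) (f : α → ENNReal) :
    ev (PMF.uniformOfFinset s hs) f = (∑ x ∈ s, f x) / s.card := by
  unfold ev
  rw [tsum_eq_sum (s := s)]
  · rw [div_eq_mul_inv, mul_comm, Finset.mul_sum]
    refine Finset.sum_congr rfl fun x hx => ?_
    rw [PMF.uniformOfFinset_apply_of_mem hs hx]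
  · intro x hx
    rw [PMF.uniformOfFinset_apply_of_notMem hs hx, zero_mul]

lemma eq_zero_of_ev_eq_zero {α : Type*} {p : PMF α} {f : α → ENNReal} (h : ev p f = 0)
    {x : α} (hx : x ∈ p.support) : f x = 0 := by
  unfold ev at h
  rw [ENNReal.tsum_eq_zero] at h
  exact (mul_eq_zero.1 (h x)).resolve_left ((PMF.mem_support_iff _ _).1 hx)

/-! ### Specifications of programs -/

/-- `φ` of the final memory, if at least `t` time units are left, and `⊤` otherwise. -/
noncomputable def after (φ : Memory → ENNReal) (t : ℕ) : Outcome → ENNReal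
  | none => ⊤
  | some (s, t') => if t ≤ t' then φ s else ⊤

/-- Started in `s`, the program halts within `c` time units, and the expectation of `φ` of the
final memory is at most `a`. -/
def Spec (P : Program) (δ : ℝ) (s : Memory) (c : ℕ) (φ : Memory → ENNReal) (a : ENNReal) : Prop :=
  ∀ t, ev (P.run δ s (t + c)) (after φ t) ≤ a

lemma after_mono {φ ψ : Memory → ENNReal} (h : ∀ s, φ s ≤ ψ s) {t t' : ℕ} (ht : t ≤ t')
    (o : Outcome) : after φ t o ≤ after ψ t' o := by
  rcases o with _ | ⟨s, r⟩
  · exact le_rfl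
  · simp only [after]
    by_cases h1 : t' ≤ r
    · rw [if_pos h1, if_pos (ht.trans h1)]
      exact h s
    · rw [if_neg h1]
      exact le_top

lemma Spec.mono {P : Program} {δ : ℝ} {s : Memory} {c c' : ℕ} {φ ψ : Memory → ENNReal}
    {a b : ENNReal} (h : Spec P δ s c φ a) (hc : c ≤ c') (hφ : ∀ s, ψ s ≤ φ s) (ha : a ≤ b) :
    Spec P δ s c' ψ b := by
  intro t
  obtain ⟨d, rfl⟩ := Nat.exists_eq_add_of_le hc
  have := h (t + d)
  rw [show t + (c + d) = t + d + c by ring]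
  exact (ev_mono _ fun o _ => after_mono hφ (Nat.le_add_right t d) o).trans (this.trans ha)

lemma ev_andThen (p : PMF Outcome) (f : Memory → ℕ → PMF Outcome) (g : Outcome → ENNReal) :
    ev (andThen p f) g = ev p fun o => match o with
      | none => g none
      | some (s, t) => ev (f s t) g := by
  unfold andThen
  rw [ev_bind]
  congr 1
  funext o
  rcases o with _ | ⟨s, t⟩
  · exact ev_pure _ _
  · rfl

lemma ev_andThen_le {p : PMF Outcome} {f : Memory → ℕ → PMF Outcome} {φ ψ : Memory → ENNReal}
    {t c : ℕ} {a : ENNReal} (hp : ev p (after ψ (t + c)) ≤ a)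
    (hf : ∀ s r, ev (f s (t + c + r)) (after φ t) ≤ ψ s) :
    ev (andThen p f) (after φ t) ≤ a := by
  rw [ev_andThen]
  refine (ev_mono _ fun o _ => ?_).trans hp
  rcases o with _ | ⟨s, r⟩
  · exact le_rfl
  · simp only [after]
    split_ifs with h
    · obtain ⟨d, rfl⟩ := Nat.exists_eq_add_of_le h
      exact hf s d
    · exact le_top

/-- A specification holds for every amount of spare time, so the time of `Q` counts as spare while
`P` runs. The middle function `ψ` is both the expectation bound for `Q` and, where it is finite, the
precondition of `Q`. -/
lemma Spec.seq {P Q : Program} {δ : ℝ} {s : Memory} {c₁ c₂ c : ℕ} {φ ψ : Memory → ENNReal}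
    {a : ENNReal} (hP : Spec P δ s c₁ ψ a) (hQ : ∀ s', ψ s' ≠ ⊤ → Spec Q δ s' c₂ φ (ψ s'))
    (hc : c₁ + c₂ ≤ c) : Spec (.seq P Q) δ s c φ a := by
  refine Spec.mono (c := c₁ + c₂) ?_ hc (fun _ => le_rfl) le_rfl
  intro t
  rw [Program.run]
  refine ev_andThen_le (c := c₂) (ψ := ψ) ?_ ?_
  · rw [show t + (c₁ + c₂) = t + c₂ + c₁ by ring]
    exact hP (t + c₂)
  · intro s' r
    by_cases h : ψ s' = ⊤
    · rw [h]; exact le_top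
    · rw [show t + c₂ + r = t + r + c₂ by ring]
      exact (ev_mono _ fun o _ => after_mono (fun _ => le_rfl) (Nat.le_add_right t r) o).trans
        (hQ s' h (t + r))

lemma Spec.cond {b : Test} {P Q : Program} {δ : ℝ} {s : Memory} {c c' : ℕ} {φ : Memory → ENNReal}
    {a : ENNReal} (hP : b.holds δ s → Spec P δ s c φ a) (hQ : ¬ b.holds δ s → Spec Q δ s c φ a)
    (hc : c + 1 ≤ c') : Spec (.cond b P Q) δ s c' φ a := by
  refine Spec.mono (c := c + 1) ?_ hc (fun _ => le_rfl) le_rfl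
  intro t
  rw [← add_assoc, Program.run]
  split_ifs with h
  · exact hP h t
  · exact hQ h t

/-- The effect of an instruction other than `rand`. -/
def Instr.next : Instr → Memory → Memory
  | .const i c, s => s.setReg i c
  | .copy i j, s => s.setReg i (s.reg j)
  | .inc i, s => s.setReg i (s.reg i + 1)
  | .dec i, s => s.setReg i (s.reg i - 1)
  | .read i a j, s => s.setReg i (s.arr a (s.reg j))
  | .write a i j, s => s.setArr a (s.reg i) (s.reg j)
  | .rand _ _, s => s

/-- Instructions other than `rand`. -/
def Instr.isDet : Instr → Bool
  | .rand _ _ => false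
  | _ => true

lemma spec_instr {o : Instr} (ho : o.isDet) (δ : ℝ) (s : Memory) (φ : Memory → ENNReal) :
    Spec (.instr o) δ s 1 φ (φ (o.next s)) := by
  intro t
  rw [Program.run]
  cases o <;> simp_all [Instr.exec, PMF.pure_map, ev_pure, after, Instr.next, Instr.isDet]

/-- A potential argument: `Ψ j s` bounds the final expectation when at most `j` rounds are left, and
a round must not increase it on average. The value `⊤` encodes a violated invariant. For `j = 0` the
first hypothesis says that `Ψ 0` is `⊤` wherever the test still holds, so a finite potential forces
the loop to end in time. -/
lemma spec_iterate {b : Memory → Prop} {body : Memory → ℕ → PMF Outcome} {c : ℕ}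
    {φ : Memory → ENNReal} (Ψ : ℕ → Memory → ENNReal)
    (hbody : ∀ j s, Ψ j s ≠ ⊤ → b s →
      ∃ i, j = i + 1 ∧ ∀ t, ev (body s (t + c)) (after (Ψ i) t) ≤ Ψ j s)
    (hend : ∀ j s, Ψ j s ≠ ⊤ → ¬ b s → φ s ≤ Ψ j s) (j : ℕ) :
    ∀ s t r d, j * (c + 1) + 1 ≤ r →
      ev (iterate b body r s (t + d + (j * (c + 1) + 1))) (after φ t) ≤ Ψ j s := by
  induction j with
  | zero =>
    intro s t r d hr
    by_cases h : Ψ 0 s = ⊤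
    · rw [h]; exact le_top
    obtain ⟨r, rfl⟩ : ∃ r', r = r' + 1 := ⟨r - 1, by omega⟩
    rw [← add_assoc, iterate]
    split_ifs with hb
    · obtain ⟨i, hi, -⟩ := hbody 0 s h hb
      omega
    · rw [ev_pure]
      simp only [after]
      rw [if_pos (by omega)]
      exact hend 0 s h hb
  | succ j ih =>
    intro s t r d hr
    by_cases h : Ψ (j + 1) s = ⊤
    · rw [h]; exact le_top
    obtain ⟨r, rfl⟩ : ∃ r', r = r' + 1 := ⟨r - 1, by omega⟩
    rw [← add_assoc, iterate]
    split_ifs with hb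
    · obtain ⟨i, hi, hbd⟩ := hbody (j + 1) s h hb
      obtain rfl : i = j := by omega
      refine ev_andThen_le (c := d + (i * (c + 1) + 1)) (ψ := Ψ i) ?_ ?_
      · have := hbd (t + (d + (i * (c + 1) + 1)))
        rw [show t + d + (i + 1) * (c + 1) = t + (d + (i * (c + 1) + 1)) + c by ring]
        exact this
      · intro s' e
        have := ih s' t r (d + e) (by nlinarith)
        rw [show t + (d + (i * (c + 1) + 1)) + e = t + (d + e) + (i * (c + 1) + 1) by ring]
        exact this
    · rw [ev_pure]
      simp only [after]
      rw [if_pos (by omega)]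
      exact hend _ s h hb

lemma Spec.loop {b : Test} {P : Program} {δ : ℝ} {c c' : ℕ} {φ : Memory → ENNReal}
    (Ψ : ℕ → Memory → ENNReal) (j : ℕ) (s : Memory)
    (hbody : ∀ j s, Ψ j s ≠ ⊤ → b.holds δ s → ∃ i, j = i + 1 ∧ Spec P δ s c (Ψ i) (Ψ j s))
    (hend : ∀ j s, Ψ j s ≠ ⊤ → ¬ b.holds δ s → φ s ≤ Ψ j s)
    (hc : j * (c + 1) + 1 ≤ c') : Spec (.loop b P) δ s c' φ (Ψ j s) := by
  refine Spec.mono (c := j * (c + 1) + 1) ?_ hc (fun _ => le_rfl) le_rfl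
  intro t
  rw [Program.run]
  exact spec_iterate Ψ hbody hend j s t _ 0 (by omega)

/-! ### What a program leaves unchanged -/

/-- The instruction does not change register `i`. -/
def Instr.keeps (i : ℕ) : Instr → Bool
  | .const j _ => i != j
  | .copy j _ => i != j
  | .inc j => i != j
  | .dec j => i != j
  | .read j _ _ => i != j
  | .write _ _ _ => true
  | .rand j _ => i != j

/-- The instruction does not change array `a`. -/
def Instr.keepsArr (a : ℕ) : Instr → Bool
  | .write a' _ _ => a != a'
  | _ => true

/-- The program does not change register `i`. -/
def Program.keeps (i : ℕ) : Program → Bool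
  | .instr o => o.keeps i
  | .seq P Q => P.keeps i && Q.keeps i
  | .cond _ P Q => P.keeps i && Q.keeps i
  | .loop _ P => P.keeps i

/-- The program does not change array `a`. -/
def Program.keepsArr (a : ℕ) : Program → Bool
  | .instr o => o.keepsArr a
  | .seq P Q => P.keepsArr a && Q.keepsArr a
  | .cond _ P Q => P.keepsArr a && Q.keepsArr a
  | .loop _ P => P.keepsArr a

/-- `s'` agrees with `s` wherever `P` changes nothing. -/
def Frame (P : Program) (s s' : Memory) : Prop :=
  (∀ i, P.keeps i = true → s'.reg i = s.reg i) ∧ ∀ a, P.keepsArr a = true → s'.arr a = s.arr a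

lemma Frame.refl (P : Program) (s : Memory) : Frame P s s := ⟨fun _ _ => rfl, fun _ _ => rfl⟩

lemma Frame.trans {P : Program} {s s' s'' : Memory} (h : Frame P s s') (h' : Frame P s' s'') :
    Frame P s s'' :=
  ⟨fun i hi => (h'.1 i hi).trans (h.1 i hi), fun a ha => (h'.2 a ha).trans (h.2 a ha)⟩

lemma frame_instr (o : Instr) (s s' : Memory) (h : s' ∈ (o.exec s).support) :
    Frame (.instr o) s s' := by
  cases o <;>
  simp only [Instr.exec, PMF.support_pure, Set.mem_singleton_iff, PMF.support_map,
    PMF.support_uniformOfFinset, Set.mem_image] at h <;>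
  first
  | (subst h
     constructor <;> intro i hi <;>
     simp_all [Program.keeps, Program.keepsArr, Instr.keeps, Instr.keepsArr, Memory.setReg, Memory.setArr])
  | (obtain ⟨v, -, rfl⟩ := h
     constructor <;> intro i hi <;>
     simp_all [Program.keeps, Program.keepsArr, Instr.keeps, Instr.keepsArr, Memory.setReg])

lemma mem_support_andThen {p : PMF Outcome} {f : Memory → ℕ → PMF Outcome} {s' : Memory} {t' : ℕ}
    (h : some (s', t') ∈ (andThen p f).support) :
    ∃ s t, some (s, t) ∈ p.support ∧ some (s', t') ∈ (f s t).support := by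
  unfold andThen at h
  rw [PMF.mem_support_bind_iff] at h
  obtain ⟨_ | ⟨s, t⟩, ho, h⟩ := h
  · simp at h
  · exact ⟨s, t, ho, h⟩

/-- What a concrete program keeps is found by evaluating its text, so later frame conditions are
proved by `rfl` and invariants need to mention only what changes. -/
lemma frame_run (δ : ℝ) (P : Program) : ∀ (s s' : Memory) (t t' : ℕ),
    some (s', t') ∈ (P.run δ s t).support → Frame P s s' := by
  induction P with
  | instr o =>
    intro s s' t t' h
    rcases t with _ | t
    · simp [Program.run] at h
    · simp only [Program.run, PMF.support_map, Set.mem_image] at h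
      obtain ⟨s₁, h1, h2⟩ := h
      obtain rfl : s₁ = s' := by simp_all
      exact frame_instr o s s₁ h1
  | seq P Q hP hQ =>
    intro s s' t t' h
    rw [Program.run] at h
    obtain ⟨s₁, t₁, h1, h2⟩ := mem_support_andThen h
    have f1 := hP _ _ _ _ h1
    have f2 := hQ _ _ _ _ h2
    constructor <;> intro i hi <;> simp only [Program.keeps, Program.keepsArr, Bool.and_eq_true] at hi
    · exact (f2.1 i hi.2).trans (f1.1 i hi.1)
    · exact (f2.2 i hi.2).trans (f1.2 i hi.1)
  | cond b P Q hP hQ =>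
    intro s s' t t' h
    rcases t with _ | t
    · simp [Program.run] at h
    · rw [Program.run] at h
      split_ifs at h
      · have f := hP _ _ _ _ h
        constructor <;> intro i hi <;>
          simp only [Program.keeps, Program.keepsArr, Bool.and_eq_true] at hi
        · exact f.1 i hi.1
        · exact f.2 i hi.1
      · have f := hQ _ _ _ _ h
        constructor <;> intro i hi <;>
          simp only [Program.keeps, Program.keepsArr, Bool.and_eq_true] at hi
        · exact f.1 i hi.2
        · exact f.2 i hi.2
  | loop b P hP =>
    intro s s' t t' h
    rw [Program.run] at h
    have key : ∀ r s t, some (s', t') ∈ (iterate (b.holds δ) (P.run δ) r s t).support →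
        Frame P s s' := by
      intro r
      induction r with
      | zero => intro s t h; simp [iterate] at h
      | succ r ih =>
        intro s t h
        rcases t with _ | t
        · simp [iterate] at h
        · rw [iterate] at h
          split_ifs at h
          · obtain ⟨s₁, t₁, h1, h2⟩ := mem_support_andThen h
            exact (hP _ _ _ _ h1).trans (ih _ _ h2)
          · simp only [PMF.support_pure, Set.mem_singleton_iff, Option.some.injEq,
              Prod.mk.injEq] at h
            rw [h.1]
            exact Frame.refl P s
    exact key t s t h

-- Outcomes outside the support have weight zero, so `φ` may be raised to `⊤` on memories that the
-- program cannot produce.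
open Classical in
lemma Spec.frame {P : Program} {δ : ℝ} {s : Memory} {c : ℕ} {φ : Memory → ENNReal} {a : ENNReal}
    (h : Spec P δ s c φ a) : Spec P δ s c (fun s' => if Frame P s s' then φ s' else ⊤) a := by
  intro t
  refine (ev_mono _ fun o ho => ?_).trans (h t)
  rcases o with _ | ⟨s', t'⟩
  · exact le_rfl
  · simp only [after]
    rw [if_pos (frame_run δ P _ _ _ _ ho)]

/-! ### Hoare triples -/

open Classical in
/-- `0` where `R` holds and `⊤` elsewhere. -/
noncomputable def guard (R : Memory → Prop) (s : Memory) : ENNReal := if R s then 0 else ⊤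

lemma guard_ne_top {R : Memory → Prop} {s : Memory} : guard R s ≠ ⊤ ↔ R s := by
  unfold guard
  split_ifs with h <;> simp [h]

lemma guard_of {R : Memory → Prop} {s : Memory} (h : R s) : guard R s = 0 := if_pos h

/-- Started in `s`, the program halts within `c` time units in a memory that satisfies `R`,
whatever the random choices are. -/
def Hoare (P : Program) (δ : ℝ) (s : Memory) (c : ℕ) (R : Memory → Prop) : Prop :=
  Spec P δ s c (guard R) 0

lemma Hoare.mono {P : Program} {δ : ℝ} {s : Memory} {c c' : ℕ} {R R' : Memory → Prop}
    (h : Hoare P δ s c R) (hc : c ≤ c') (hR : ∀ s', R s' → R' s') : Hoare P δ s c' R' := by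
  refine Spec.mono h hc (fun s' => ?_) le_rfl
  unfold guard
  split_ifs with h1 h2 h2 <;> simp_all

/-- A Hoare triple together with what is known from the text of the program. -/
lemma Hoare.frame {P : Program} {δ : ℝ} {s : Memory} {c : ℕ} {R : Memory → Prop}
    (h : Hoare P δ s c R) : Hoare P δ s c (fun s' => R s' ∧ Frame P s s') := by
  refine Spec.mono (Spec.frame h) le_rfl (fun s' => ?_) le_rfl
  unfold guard
  split_ifs <;> simp_all

lemma Hoare.seq {P Q : Program} {δ : ℝ} {s : Memory} {c₁ c₂ c : ℕ} {R R' : Memory → Prop}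
    (hP : Hoare P δ s c₁ R) (hQ : ∀ s', R s' → Frame P s s' → Hoare Q δ s' c₂ R')
    (hc : c₁ + c₂ ≤ c) : Hoare (.seq P Q) δ s c R' := by
  refine Spec.seq hP.frame (fun s' h => ?_) hc
  rw [guard_ne_top] at h
  rw [guard_of h]
  exact hQ s' h.1 h.2

lemma Hoare.cond {b : Test} {P Q : Program} {δ : ℝ} {s : Memory} {c c' : ℕ}
    {R : Memory → Prop} (hP : b.holds δ s → Hoare P δ s c R)
    (hQ : ¬ b.holds δ s → Hoare Q δ s c R) (hc : c + 1 ≤ c') : Hoare (.cond b P Q) δ s c' R :=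
  Spec.cond hP hQ hc

/-- The loop rule; `I j` is the invariant when at most `j` rounds are left. -/
lemma Hoare.loop {b : Test} {P : Program} {δ : ℝ} {s₀ : Memory} {c c' : ℕ}
    {R : Memory → Prop} (I : ℕ → Memory → Prop) (N : ℕ) (h₀ : I N s₀)
    (hbody : ∀ j s, Frame P s₀ s → I j s → b.holds δ s → ∃ i, j = i + 1 ∧ Hoare P δ s c (I i))
    (hend : ∀ j s, Frame P s₀ s → I j s → ¬ b.holds δ s → R s)
    (hc : N * (c + 1) + 1 ≤ c') : Hoare (.loop b P) δ s₀ c' R := by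
  have h := Spec.loop (b := b) (P := P) (δ := δ) (c := c) (c' := c') (φ := guard R)
    (fun j => guard fun s => I j s ∧ Frame P s₀ s) N s₀ ?_ ?_ hc
  · simp only [guard_of (R := fun s => I N s ∧ Frame P s₀ s) ⟨h₀, Frame.refl P s₀⟩] at h
    exact h
  · intro j s h hb
    rw [guard_ne_top] at h
    obtain ⟨i, hi, hP⟩ := hbody j s h.2 h.1 hb
    refine ⟨i, hi, ?_⟩
    rw [guard_of h]
    exact hP.frame.mono le_rfl fun s' h' => ⟨h'.1, h.2.trans h'.2⟩
  · intro j s h hb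
    rw [guard_ne_top] at h
    rw [guard_of (hend j s h.2 h.1 hb)]
    exact zero_le

lemma hoare_instr {o : Instr} (ho : o.isDet) {δ : ℝ} {s : Memory} {c : ℕ} {R : Memory → Prop}
    (h : R (o.next s)) (hc : 1 ≤ c) : Hoare (.instr o) δ s c R :=
  (spec_instr ho δ s (guard R)).mono hc (fun _ => le_rfl) (guard_of h).le

/-- A Hoare triple in front of a specification. -/
lemma Hoare.seq_spec {P Q : Program} {δ : ℝ} {s : Memory} {c₁ c₂ c : ℕ} {R : Memory → Prop}
    {φ : Memory → ENNReal} {a : ENNReal} (hP : Hoare P δ s c₁ R)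
    (hQ : ∀ s', R s' → Frame P s s' → Spec Q δ s' c₂ φ a)
    (hc : c₁ + c₂ ≤ c) : Spec (.seq P Q) δ s c φ a := by
  refine Spec.mono (c := c₁ + c₂) ?_ hc (fun _ => le_rfl) le_rfl
  intro t
  -- Writing `a` as the expectation of a constant allows a comparison outcome by outcome on the
  -- support of `P`.
  rw [Program.run, ev_andThen, ← ev_const (P.run δ s (t + (c₁ + c₂))) a]
  refine ev_mono _ fun o ho => ?_
  have h0 := hP.frame (t + c₂)
  rw [show t + c₂ + c₁ = t + (c₁ + c₂) by ring, nonpos_iff_eq_zero] at h0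
  -- Expectation zero means that every possible outcome has value zero: it is in time and satisfies
  -- `R`.
  have h1 := eq_zero_of_ev_eq_zero h0 ho
  rcases o with _ | ⟨s', r⟩
  · simp [after] at h1
  · simp only [after] at h1
    split_ifs at h1 with hr
    swap
    · exact absurd h1 ENNReal.top_ne_zero
    · have h2 : guard (fun s' => R s' ∧ Frame P s s') s' ≠ ⊤ := by rw [h1]; simp
      rw [guard_ne_top] at h2
      obtain ⟨d, rfl⟩ := Nat.exists_eq_add_of_le hr
      simp only
      rw [show t + c₂ + d = t + d + c₂ by ring]
      exact (ev_mono _ fun o _ => after_mono (fun _ => le_rfl) (Nat.le_add_right t d) o).trans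
        (hQ s' h2.1 h2.2 (t + d))

/-- A Hoare triple as a specification. -/
lemma Hoare.spec {P : Program} {δ : ℝ} {s : Memory} {c : ℕ} {R : Memory → Prop}
    {φ : Memory → ENNReal} {a : ENNReal} (hP : Hoare P δ s c R)
    (h : ∀ s', R s' → Frame P s s' → φ s' ≤ a) : Spec P δ s c φ a := by
  intro t
  rw [← ev_const (P.run δ s (t + c)) a]
  refine ev_mono _ fun o ho => ?_
  have h0 := hP.frame t
  rw [nonpos_iff_eq_zero] at h0
  have h1 := eq_zero_of_ev_eq_zero h0 ho
  rcases o with _ | ⟨s', r⟩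
  · simp [after] at h1
  · simp only [after] at h1 ⊢
    split_ifs at h1 ⊢ with hr
    swap
    · exact absurd h1 ENNReal.top_ne_zero
    have h2 : guard (fun s' => R s' ∧ Frame P s s') s' ≠ ⊤ := by rw [h1]; simp
    rw [guard_ne_top] at h2
    exact h s' h2.1 h2.2

/-! ### Straight-line programs and repetition -/

/-- Execute the instructions one after another. -/
def straight : List Instr → Program
  -- Register 31 has no other use; copying it to itself is a no-op that costs one time unit.
  | [] => .instr (.copy 31 31)
  | o :: l => .seq (.instr o) (straight l)

lemma hoare_straight {δ : ℝ} {R : Memory → Prop} (l : List Instr) (hl : l.all Instr.isDet = true)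
    {s : Memory} {c : ℕ} (h : R (l.foldl (fun s o => o.next s) s)) (hc : l.length + 1 ≤ c) :
    Hoare (straight l) δ s c R := by
  induction l generalizing s c with
  | nil =>
    refine hoare_instr rfl ?_ (by simpa using hc)
    have : Instr.next (.copy 31 31) s = s := by
      cases s
      simp [Instr.next, Memory.setReg]
    rw [this]
    exact h
  | cons o l ih =>
    simp only [List.all_cons, Bool.and_eq_true] at hl
    simp only [List.length_cons] at hc
    have h1 : Hoare (.instr o) δ s 1 (fun s' => s' = o.next s) := hoare_instr hl.1 rfl le_rfl
    refine h1.seq (c₂ := l.length + 1) ?_ (by omega)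
    rintro s' rfl -
    exact ih hl.2 h le_rfl

/-- Execute `P` exactly `c` times. -/
def rep (P : Program) : ℕ → Program
  | 0 => straight []
  | c + 1 => .seq P (rep P c)

lemma hoare_rep {δ : ℝ} {P : Program} {c : ℕ} (I : ℕ → Memory → Prop)
    (hP : ∀ i s, I i s → Hoare P δ s c (I (i + 1))) (r : ℕ) :
    ∀ (i : ℕ) (s : Memory), I i s → Hoare (rep P r) δ s (r * c + 1) (I (i + r)) := by
  induction r with
  | zero => intro i s h; exact hoare_straight [] rfl h (by simp)
  | succ r ih =>
    intro i s h
    refine (hP i s h).seq (c₂ := r * c + 1) (fun s' h' _ => ?_) (by ring_nf; omega)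
    have := ih (i + 1) s' h'
    rwa [show i + 1 + r = i + (r + 1) by ring] at this

lemma keeps_rep (P : Program) (i r : ℕ) (h : P.keeps i = true) (hi : i ≠ 31) :
    (rep P r).keeps i = true := by
  induction r with
  | zero => simp [rep, straight, Program.keeps, Instr.keeps, hi]
  | succ r ih => simp [rep, Program.keeps, h, ih]

lemma keepsArr_rep (P : Program) (a r : ℕ) (h : P.keepsArr a = true) :
    (rep P r).keepsArr a = true := by
  induction r with
  | zero => simp [rep, straight, Program.keepsArr, Instr.keepsArr]
  | succ r ih => simp [rep, Program.keepsArr, h, ih]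

end MaxNAE

/-! ### The input format, and the evaluation of an assignment by the machine. -/

namespace MaxNAE

/-! ### Clauses as finite sets and as lists -/

variable {n : ℕ}

/-- The clause `C` is NAE-satisfied by `α`. -/
def NAE (α : Fin n → Bool) (C : Clause n) : Prop :=
  (∃ l ∈ C, l.value α = true) ∧ (∃ l ∈ C, l.value α = false)

instance (α : Fin n → Bool) : DecidablePred (NAE α) := fun C => by unfold NAE; infer_instance

lemma numSat_eq (F : Instance n) (α : Fin n → Bool) : numSat F α = (F.filter (NAE α)).card := rfl

/-- The clauses with at least two literals that are not NAE-satisfied by `α`. -/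
def unsat (F : Instance n) (α : Fin n → Bool) : Finset (Clause n) :=
  F.filter fun C => 2 ≤ C.card ∧ ¬ NAE α C

/-- The set of literals of the clause with index `i`. -/
def clauseAt (L : List (List (Literal n))) (i : ℕ) : Clause n := (L.getD i []).toFinset

/-- The indices below `j` of the clauses in `unsat`. -/
def unsatList (L : List (List (Literal n))) (α : Fin n → Bool) (j : ℕ) : List ℕ :=
  (List.range j).filter fun i => 2 ≤ (clauseAt L i).card ∧ ¬ NAE α (clauseAt L i)

lemma unsatList_succ (L : List (List (Literal n))) (α : Fin n → Bool) (j : ℕ) :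
    unsatList L α (j + 1) = unsatList L α j ++
      if 2 ≤ (clauseAt L j).card ∧ ¬ NAE α (clauseAt L j) then [j] else [] := by
  unfold unsatList
  rw [List.range_succ, List.filter_append]
  congr 1
  by_cases h : 2 ≤ (clauseAt L j).card ∧ ¬ NAE α (clauseAt L j) <;> simp [h]

/-- The number of NAE-satisfied clauses with index below `j`. -/
def satCount (L : List (List (Literal n))) (α : Fin n → Bool) (j : ℕ) : ℕ :=
  ((Finset.range j).filter fun i => NAE α (clauseAt L i)).card

lemma satCount_succ (L : List (List (Literal n))) (α : Fin n → Bool) (j : ℕ) :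
    satCount L α (j + 1) = satCount L α j + if NAE α (clauseAt L j) then 1 else 0 := by
  unfold satCount
  rw [Finset.range_add_one, Finset.filter_insert]
  split_ifs with h
  · rw [Finset.card_insert_of_notMem (by simp)]
  · rfl

section Lists

variable {L : List (List (Literal n))} {F : Instance n}

lemma clauseAt_of_lt {i : ℕ} (hi : i < L.length) : clauseAt L i = L[i].toFinset := by
  unfold clauseAt
  rw [List.getD_eq_getElem _ _ hi]

/-- With `Lists.image_eq` this makes `clauseAt L` a bijection from the indices onto `F`. Counts over
indices, which the machine performs, thereby become cardinalities of sets of clauses. -/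
lemma Lists.injOn (hL : Lists L F) :
    Set.InjOn (clauseAt L) (Finset.range L.length : Set ℕ) := by
  intro i hi j hj h
  simp only [Finset.coe_range, Set.mem_Iio] at hi hj
  rw [clauseAt_of_lt hi, clauseAt_of_lt hj] at h
  have := (List.Nodup.getElem_inj_iff hL.clauses_nodup (i := i) (j := j)
    (hi := by simpa using hi) (hj := by simpa using hj)).1 (by simpa using h)
  exact this

lemma Lists.image_eq (hL : Lists L F) : (Finset.range L.length).image (clauseAt L) = F := by
  rw [← hL.toFinset_eq]
  ext C
  simp only [Finset.mem_image, Finset.mem_range, List.mem_toFinset, List.mem_map]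
  constructor
  · rintro ⟨i, hi, rfl⟩
    exact ⟨L[i], List.getElem_mem hi, (clauseAt_of_lt hi).symm⟩
  · rintro ⟨c, hc, rfl⟩
    obtain ⟨i, hi, rfl⟩ := List.getElem_of_mem hc
    exact ⟨i, hi, clauseAt_of_lt hi⟩

lemma Lists.mem (hL : Lists L F) {i : ℕ} (hi : i < L.length) : clauseAt L i ∈ F := by
  rw [← hL.image_eq]
  exact Finset.mem_image_of_mem _ (Finset.mem_range.2 hi)

lemma Lists.card_clauseAt (hL : Lists L F) {i : ℕ} (hi : i < L.length) :
    (clauseAt L i).card = L[i].length := by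
  rw [clauseAt_of_lt hi]
  exact List.toFinset_card_of_nodup (hL.literals_nodup _ (List.getElem_mem hi))

lemma Lists.length_eq (hL : Lists L F) : L.length = F.card := by
  rw [← hL.image_eq, Finset.card_image_of_injOn hL.injOn, Finset.card_range]

lemma Lists.satCount_eq (hL : Lists L F) (α : Fin n → Bool) :
    satCount L α L.length = numSat F α := by
  rw [numSat_eq, ← hL.image_eq, Finset.filter_image, Finset.card_image_of_injOn]
  · rfl
  · exact hL.injOn.mono (Finset.coe_subset.2 (Finset.filter_subset _ _))

lemma mem_unsatList {α : Fin n → Bool} {i j : ℕ} :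
    i ∈ unsatList L α j ↔ i < j ∧ 2 ≤ (clauseAt L i).card ∧ ¬ NAE α (clauseAt L i) := by
  simp [unsatList]

lemma unsatList_nodup (L : List (List (Literal n))) (α : Fin n → Bool) (j : ℕ) :
    (unsatList L α j).Nodup := List.nodup_range.filter _

lemma Lists.image_unsatList (hL : Lists L F) (α : Fin n → Bool) :
    (unsatList L α L.length).toFinset.image (clauseAt L) = unsat F α := by
  unfold unsat
  rw [← hL.image_eq, Finset.filter_image]
  congr 1
  ext i
  simp [mem_unsatList]

lemma Lists.injOn_unsatList (hL : Lists L F) (α : Fin n → Bool) :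
    Set.InjOn (clauseAt L) ((unsatList L α L.length).toFinset : Set ℕ) := by
  refine hL.injOn.mono fun i hi => ?_
  simp only [List.coe_toFinset, Set.mem_ofPred_eq, mem_unsatList] at hi
  simpa using hi.1

lemma Lists.length_unsatList (hL : Lists L F) (α : Fin n → Bool) :
    (unsatList L α L.length).length = (unsat F α).card := by
  rw [← hL.image_unsatList, Finset.card_image_of_injOn (hL.injOn_unsatList α),
    List.toFinset_card_of_nodup (unsatList_nodup _ _ _)]

lemma sum_range_getD {β : Type*} [DecidableEq β] {M : Type*} [AddCommMonoid M] (l : List β)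
    (hl : l.Nodup) (d : β) (f : β → M) :
    ∑ r ∈ Finset.range l.length, f (l.getD r d) = ∑ x ∈ l.toFinset, f x := by
  rw [List.sum_toFinset _ hl, ← Fin.sum_univ_eq_sum_range (fun r => f (l.getD r d)) l.length,
    ← List.sum_ofFn]
  congr 1
  refine List.ext_getElem (by simp) fun i h1 h2 => ?_
  simp

/-- A uniformly random position in the machine's list is a uniformly random clause of `unsat F α`.
-/
lemma Lists.sum_unsat (hL : Lists L F) (α : Fin n → Bool) (f : Clause n → ENNReal) :
    ∑ r ∈ Finset.range (unsatList L α L.length).length,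
      f (clauseAt L ((unsatList L α L.length).getD r 0)) = ∑ C ∈ unsat F α, f C := by
  rw [sum_range_getD _ (unsatList_nodup _ _ _) 0 (fun i => f (clauseAt L i)),
    ← hL.image_unsatList, Finset.sum_image (hL.injOn_unsatList α)]

lemma start_succ {j : ℕ} (hj : j < L.length) :
    (input L).arr 0 (j + 1) = (input L).arr 0 j + L[j].length := by
  simp [input, List.take_add_one, List.getElem?_eq_getElem hj]

lemma flatten_get (L : List (List (Literal n))) : ∀ {j q : ℕ} (hj : j < L.length)
    (hq : q < L[j].length), L.flatten[((L.take j).map List.length).sum + q]? = some L[j][q] := by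
  induction L with
  | nil => intro j q hj; simp at hj
  | cons c L ih =>
    intro j q hj hq
    rcases j with _ | j
    · simp only [List.getElem_cons_zero] at hq
      simp [List.flatten_cons, List.getElem?_append_left hq]
    · simp only [List.getElem_cons_succ] at hq
      rw [List.flatten_cons, List.getElem?_append_right (by simp [add_assoc])]
      have := ih (by simpa using hj) hq
      simpa [add_assoc, Nat.add_sub_cancel_left] using this

lemma input_var {j q : ℕ} (hj : j < L.length) (hq : q < L[j].length) :
    (input L).arr 1 ((input L).arr 0 j + q) = (L[j][q].1 : ℕ) := by
  have := flatten_get L hj hq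
  simp [input] at this ⊢
  simp [this]

lemma input_sign {j q : ℕ} (hj : j < L.length) (hq : q < L[j].length) :
    (input L).arr 2 ((input L).arr 0 j + q) = L[j][q].2.toNat := by
  have := flatten_get L hj hq
  simp [input] at this ⊢
  simp [this]

end Lists

/-! ### The memory during the computation -/

@[simp] lemma setReg_reg (s : Memory) (i v j : ℕ) :
    (s.setReg i v).reg j = if j = i then v else s.reg j := by
  simp [Memory.setReg, Function.update_apply]

@[simp] lemma setReg_arr (s : Memory) (i v : ℕ) : (s.setReg i v).arr = s.arr := rfl

@[simp] lemma setArr_reg (s : Memory) (a p v : ℕ) : (s.setArr a p v).reg = s.reg := rfl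

@[simp] lemma setArr_arr (s : Memory) (a p v b : ℕ) :
    (s.setArr a p v).arr b = if b = a then Function.update (s.arr a) p v else s.arr b := by
  simp [Memory.setArr, Function.update_apply]

attribute [simp] Instr.next Test.holds

/-- The input is still there. -/
structure HasInput (L : List (List (Literal n))) (s : Memory) : Prop where
  reg_zero : s.reg 0 = n
  reg_one : s.reg 1 = L.length
  reg_two : s.reg 2 = 0
  arr_zero : s.arr 0 = (input L).arr 0
  arr_one : s.arr 1 = (input L).arr 1
  arr_two : s.arr 2 = (input L).arr 2

/-- The program does not touch the input. -/
def Program.safe (P : Program) : Bool :=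
  P.keeps 0 && P.keeps 1 && P.keeps 2 && P.keepsArr 0 && P.keepsArr 1 && P.keepsArr 2

lemma HasInput.frame {L : List (List (Literal n))} {s s' : Memory} {P : Program}
    (h : HasInput L s) (hF : Frame P s s') (hP : P.safe = true) : HasInput L s' := by
  simp only [Program.safe, Bool.and_eq_true] at hP
  obtain ⟨⟨⟨⟨⟨h0, h1⟩, h2⟩, a0⟩, a1⟩, a2⟩ := hP
  exact ⟨(hF.1 0 h0).trans h.1, (hF.1 1 h1).trans h.2, (hF.1 2 h2).trans h.3,
    (hF.2 0 a0).trans h.4, (hF.2 1 a1).trans h.5, (hF.2 2 a2).trans h.6⟩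

/-- Array 4 holds the assignment `α`. -/
def Holds (α : Fin n → Bool) (s : Memory) : Prop := ∀ v : Fin n, s.arr 4 v = (α v).toNat

lemma Holds.frame {α : Fin n → Bool} {s s' : Memory} {P : Program} (h : Holds α s)
    (hF : Frame P s s') (hP : P.keepsArr 4 = true) : Holds α s' := by
  intro v
  rw [hF.2 4 hP]
  exact h v

/-! ### Evaluating the current assignment -/

/-- Evaluate the literal at the position held by register 9. -/
def evalLiteral : Program :=
  .seq (straight [.read 13 1 9, .read 14 2 9, .read 15 4 13, .inc 9])
    -- A literal is true iff its sign equals the value of its variable. Equality is tested by two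
    -- strict comparisons: if either holds, the literal is false (flag 12), otherwise it is true
    -- (flag 11).
    (.cond (.lt 14 15) (straight [.const 12 1])
      (.cond (.lt 15 14) (straight [.const 12 1]) (straight [.const 11 1])))

/-- Append the current clause to the list in array 5, if it has at least two literals. -/
def appendClause : Program :=
  -- Register 16 holds the start of the clause plus one and register 10 its end, so the test asks
  -- for at least two literals. Register 8 already points to the next clause, hence the `dec`.
  .cond (.lt 16 10) (straight [.copy 17 8, .dec 17, .write 5 7 17, .inc 7]) (straight [])

/-- Evaluate the clause with the index held by register 8. -/
def evalClause : Program :=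
  .seq (straight [.read 9 0 8, .copy 16 9, .inc 16, .inc 8, .read 10 0 8, .const 11 0,
    .const 12 0])
    (.seq (.loop (.lt 9 10) evalLiteral)
      (.cond (.lt 2 11) (.cond (.lt 2 12) (straight [.inc 6]) appendClause) appendClause))

/-- Count the NAE-satisfied clauses in register 6 and list the other clauses with at least two
literals in array 5 and register 7. -/
def evalAll : Program :=
  .seq (straight [.const 6 0, .const 7 0, .const 8 0]) (.loop (.lt 8 1) evalClause)

variable {L : List (List (Literal n))} {F : Instance n} {α : Fin n → Bool} {δ : ℝ}

lemma hoare_evalLiteral {s : Memory} {j q : ℕ} (hs : HasInput L s) (hα : Holds α s)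
    (hj : j < L.length) (hq : q < L[j].length) (h9 : s.reg 9 = (input L).arr 0 j + q) :
    Hoare evalLiteral δ s 10 fun s' => s'.reg 9 = s.reg 9 + 1 ∧
      s'.reg 11 = (if L[j][q].value α = true then 1 else s.reg 11) ∧
      s'.reg 12 = (if L[j][q].value α = false then 1 else s.reg 12) := by
  have hv := input_var hj hq
  have hs' := input_sign hj hq
  rw [← hs.arr_one, ← h9] at hv
  rw [← hs.arr_two, ← h9] at hs'
  refine Hoare.seq (c₁ := 5) (c₂ := 5) (hoare_straight (R := fun s' => s'.reg 9 = s.reg 9 + 1 ∧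
    s'.reg 11 = s.reg 11 ∧ s'.reg 12 = s.reg 12 ∧ s'.reg 14 = L[j][q].2.toNat ∧
    s'.reg 15 = (α L[j][q].1).toNat) _ rfl ?_ (by simp)) ?_ (by norm_num)
  · simp [hv, hs', hα L[j][q].1]
  · rintro s' ⟨e9, e11, e12, e14, e15⟩ -
    refine Hoare.cond (c := 4) (fun h => ?_) (fun h => ?_) le_rfl
    · refine hoare_straight _ rfl ?_ (by simp)
      simp only [Test.holds, e14, e15] at h
      cases h1 : L[j][q].2 <;> cases h2 : α L[j][q].1 <;>
        simp_all [Literal.value]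
    · refine Hoare.cond (c := 3) (fun h' => ?_) (fun h' => ?_) le_rfl <;>
      · refine hoare_straight _ rfl ?_ (by simp)
        simp only [Test.holds, e14, e15] at h h'
        cases h1 : L[j][q].2 <;> cases h2 : α L[j][q].1 <;>
          simp_all [Literal.value]

lemma exists_mem_take_succ {β : Type*} {p : β → Prop} {l : List β} {q : ℕ} (hq : q < l.length) :
    (∃ x ∈ l.take (q + 1), p x) ↔ (∃ x ∈ l.take q, p x) ∨ p l[q] := by
  rw [← List.take_concat_get' l q hq]
  simp only [List.mem_append, List.mem_singleton]
  constructor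
  · rintro ⟨x, hx | rfl, h⟩
    exacts [Or.inl ⟨x, hx, h⟩, Or.inr h]
  · rintro (⟨x, hx, h⟩ | h)
    exacts [⟨x, Or.inl hx, h⟩, ⟨_, Or.inr rfl, h⟩]

lemma hoare_evalLiterals {s : Memory} {j : ℕ} (hs : HasInput L s) (hα : Holds α s)
    (hj : j < L.length) (h9 : s.reg 9 = (input L).arr 0 j)
    (h10 : s.reg 10 = (input L).arr 0 (j + 1)) (h11 : s.reg 11 = 0) (h12 : s.reg 12 = 0) :
    Hoare (.loop (.lt 9 10) evalLiteral) δ s (L[j].length * 11 + 1) fun s' =>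
      (0 < s'.reg 11 ↔ ∃ l ∈ L[j], Literal.value α l = true) ∧
      (0 < s'.reg 12 ↔ ∃ l ∈ L[j], Literal.value α l = false) := by
  refine Hoare.loop (c := 10) (N := L[j].length) (fun i s' => ∃ q, q + i = L[j].length ∧
    s'.reg 9 = (input L).arr 0 j + q ∧
    (0 < s'.reg 11 ↔ ∃ l ∈ L[j].take q, Literal.value α l = true) ∧
    (0 < s'.reg 12 ↔ ∃ l ∈ L[j].take q, Literal.value α l = false)) ?_ ?_ ?_ (by ring_nf; rfl)
  · exact ⟨0, by simp, by simpa using h9, by simp [h11], by simp [h12]⟩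
  · rintro i s' hF ⟨q, hq, e9, e11, e12⟩ hb
    have e10 : s'.reg 10 = (input L).arr 0 (j + 1) := (hF.1 10 rfl).trans h10
    simp only [Test.holds, e9, e10, start_succ hj] at hb
    have hq' : q < L[j].length := by omega
    obtain ⟨i, rfl⟩ : ∃ i', i = i' + 1 := ⟨i - 1, by omega⟩
    refine ⟨i, rfl, (hoare_evalLiteral (hs.frame hF rfl) (hα.frame hF rfl) hj hq' e9).mono le_rfl ?_⟩
    rintro s'' ⟨f9, f11, f12⟩
    refine ⟨q + 1, by omega, by rw [f9, e9]; ring, ?_, ?_⟩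
    · rw [f11, exists_mem_take_succ hq', ← e11]
      split_ifs with h <;> simp [h]
    · rw [f12, exists_mem_take_succ hq', ← e12]
      split_ifs with h <;> simp [h]
  · rintro i s' hF ⟨q, hq, e9, e11, e12⟩ hb
    have e10 : s'.reg 10 = (input L).arr 0 (j + 1) := (hF.1 10 rfl).trans h10
    simp only [Test.holds, e9, e10, start_succ hj] at hb
    obtain rfl : q = L[j].length := by omega
    rw [List.take_length] at e11 e12
    exact ⟨e11, e12⟩

lemma hoare_appendClause {s : Memory} {p : ℕ} (h16 : s.reg 16 = p + 1) (c : ℕ)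
    (h10 : s.reg 10 = p + c) :
    Hoare appendClause δ s 6 fun s' => s'.reg 8 = s.reg 8 ∧ s'.reg 6 = s.reg 6 ∧
      if 2 ≤ c then s'.reg 7 = s.reg 7 + 1 ∧
        s'.arr 5 = Function.update (s.arr 5) (s.reg 7) (s.reg 8 - 1)
      else s'.reg 7 = s.reg 7 ∧ s'.arr 5 = s.arr 5 := by
  refine Hoare.cond (c := 5) (fun h => ?_) (fun h => ?_) le_rfl
  · refine hoare_straight _ rfl ?_ (by simp)
    simp only [Test.holds, h16, h10] at h
    simp [show 2 ≤ c by omega]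
  · refine hoare_straight _ rfl ?_ (by simp)
    simp only [Test.holds, h16, h10] at h
    simp [show ¬ 2 ≤ c by omega]

lemma hoare_evalClause (hL : Lists L F) {s : Memory} {j k : ℕ} (hs : HasInput L s) (hα : Holds α s)
    (hj : j < L.length) (hk : (clauseAt L j).card ≤ k) (h8 : s.reg 8 = j) :
    Hoare evalClause δ s (k * 11 + 17) fun s' => s'.reg 8 = j + 1 ∧
      s'.reg 6 = s.reg 6 + (if NAE α (clauseAt L j) then 1 else 0) ∧
      if 2 ≤ (clauseAt L j).card ∧ ¬ NAE α (clauseAt L j) then s'.reg 7 = s.reg 7 + 1 ∧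
        s'.arr 5 = Function.update (s.arr 5) (s.reg 7) j
      else s'.reg 7 = s.reg 7 ∧ s'.arr 5 = s.arr 5 := by
  have hcard := hL.card_clauseAt hj
  have hnae : NAE α (clauseAt L j) ↔ (∃ l ∈ L[j], Literal.value α l = true) ∧
      (∃ l ∈ L[j], Literal.value α l = false) := by
    rw [clauseAt_of_lt hj]; simp [NAE]
  refine Hoare.seq (c₁ := 8) (c₂ := k * 11 + 9) (hoare_straight (R := fun s' =>
    s'.reg 9 = (input L).arr 0 j ∧ s'.reg 10 = (input L).arr 0 (j + 1) ∧ s'.reg 11 = 0 ∧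
    s'.reg 12 = 0 ∧ s'.reg 16 = (input L).arr 0 j + 1 ∧ s'.reg 8 = j + 1 ∧ s'.reg 6 = s.reg 6 ∧
    s'.reg 7 = s.reg 7 ∧ s'.arr 5 = s.arr 5) _ rfl ?_ (by simp)) ?_ (by omega)
  · simp [h8, hs.arr_zero]
  rintro s₁ ⟨e9, e10, e11, e12, e16, e8, e6, e7, a5⟩ hF
  have hs₁ := hs.frame hF rfl
  refine Hoare.seq (hoare_evalLiterals hs₁ (hα.frame hF rfl) hj e9 e10 e11 e12)
    (c₂ := 8) ?_ (by rw [← hcard]; nlinarith)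
  rintro s₂ ⟨f11, f12⟩ hF₂
  have hs₂ := hs₁.frame hF₂ rfl
  have f8 := (hF₂.1 8 rfl).trans e8
  have f16 := (hF₂.1 16 rfl).trans e16
  have f6 := (hF₂.1 6 rfl).trans e6
  have f7 := (hF₂.1 7 rfl).trans e7
  have f5 := (hF₂.2 5 rfl).trans a5
  have f10 := (hF₂.1 10 rfl).trans e10
  rw [start_succ hj, ← hcard] at f10
  have happ : ¬ NAE α (clauseAt L j) → Hoare appendClause δ s₂ 6 fun s' => s'.reg 8 = j + 1 ∧
      s'.reg 6 = s.reg 6 + (if NAE α (clauseAt L j) then 1 else 0) ∧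
      if 2 ≤ (clauseAt L j).card ∧ ¬ NAE α (clauseAt L j) then s'.reg 7 = s.reg 7 + 1 ∧
        s'.arr 5 = Function.update (s.arr 5) (s.reg 7) j
      else s'.reg 7 = s.reg 7 ∧ s'.arr 5 = s.arr 5 := by
    intro hn
    refine (hoare_appendClause f16 _ f10).mono le_rfl ?_
    rintro s' ⟨g8, g6, g⟩
    refine ⟨g8.trans f8, by simp [hn, g6, f6], ?_⟩
    simpa only [hn, not_false_eq_true, and_true, f7, f5, f8, Nat.add_sub_cancel] using g
  refine Hoare.cond (c := 7) (fun h => ?_) (fun h => ?_) le_rfl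
  · refine Hoare.cond (c := 6) (fun h' => ?_) (fun h' => ?_) le_rfl
    · simp only [Test.holds, hs₂.reg_two, f11, f12] at h h'
      have hn := hnae.2 ⟨h, h'⟩
      exact hoare_straight _ rfl (by simp [hn, f8, f6, f7, f5]) (by simp)
    · simp only [Test.holds, hs₂.reg_two, f11, f12] at h h'
      exact happ fun hn => h' (hnae.1 hn).2
  · simp only [Test.holds, hs₂.reg_two, f11] at h
    exact (happ fun hn => h (hnae.1 hn).1).mono (by norm_num) fun _ h => h

lemma hoare_evalAll (hL : Lists L F) {s : Memory} {k : ℕ} (hs : HasInput L s) (hα : Holds α s)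
    (hk : IsKInstance k F) :
    Hoare evalAll δ s (L.length * (k * 11 + 18) + 5) fun s' => s'.reg 6 = numSat F α ∧
      s'.reg 7 = (unsatList L α L.length).length ∧
      ∀ i < (unsatList L α L.length).length, s'.arr 5 i = (unsatList L α L.length).getD i 0 := by
  refine Hoare.seq (c₁ := 4) (c₂ := L.length * (k * 11 + 18) + 1) (hoare_straight (R := fun s' =>
    s'.reg 6 = 0 ∧ s'.reg 7 = 0 ∧ s'.reg 8 = 0) _ rfl (by simp) (by simp)) ?_ (by omega)
  rintro s₁ ⟨e6, e7, e8⟩ hF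
  refine Hoare.loop (c := k * 11 + 17) (N := L.length) (fun i s' => ∃ j, j + i = L.length ∧
    s'.reg 8 = j ∧ s'.reg 6 = satCount L α j ∧ s'.reg 7 = (unsatList L α j).length ∧
    ∀ i < (unsatList L α j).length, s'.arr 5 i = (unsatList L α j).getD i 0) ?_ ?_ ?_ le_rfl
  · exact ⟨0, by simp, e8, by simp [satCount, e6], by simp [unsatList, e7], by simp [unsatList]⟩
  · rintro i s₂ hF₂ ⟨j, hj, f8, f6, f7, f5⟩ hb
    have hs₂ := (hs.frame hF rfl).frame hF₂ rfl
    simp only [Test.holds, f8, hs₂.reg_one] at hb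
    obtain ⟨i, rfl⟩ : ∃ i', i = i' + 1 := ⟨i - 1, by omega⟩
    refine ⟨i, rfl, (hoare_evalClause hL hs₂ ((hα.frame hF rfl).frame hF₂ rfl) hb
      (hk _ (hL.mem hb)) f8).mono le_rfl ?_⟩
    rintro s₃ ⟨g8, g6, g⟩
    refine ⟨j + 1, by omega, g8, by rw [g6, f6, satCount_succ], ?_⟩
    rw [unsatList_succ]
    split_ifs at g ⊢ with h
    · refine ⟨by simp [g.1, f7], fun i hi => ?_⟩
      rw [g.2, f7, Function.update_apply]
      simp only [List.length_append, List.length_singleton] at hi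
      split_ifs with h'
      · simp [h']
      · have : i < (unsatList L α j).length := by omega
        rw [f5 i this, List.getD_append _ _ _ _ this]
    · rw [List.append_nil, g.1, g.2]
      exact ⟨f7, f5⟩
  · rintro i s₂ hF₂ ⟨j, hj, f8, f6, f7, f5⟩ hb
    have hs₂ := (hs.frame hF rfl).frame hF₂ rfl
    simp only [Test.holds, f8, hs₂.reg_one] at hb
    obtain rfl : j = L.length := by omega
    exact ⟨by rw [f6, hL.satCount_eq], f7, f5⟩

end MaxNAE

/-! ### The best assignment so far, random flips and the random start. -/

namespace MaxNAE

variable {n : ℕ} {L : List (List (Literal n))} {F : Instance n} {α : Fin n → Bool} {δ : ℝ}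

/-! ### Remembering the best assignment -/

/-- If the current assignment is better than the best one so far, copy it into array 3. -/
def update : Program :=
  .cond (.lt 3 6)
    (.seq (straight [.copy 3 6, .copy 8 0])
      (.loop (.lt 2 8) (straight [.dec 8, .read 15 4 8, .write 3 8 15])))
    (straight [])

/-- Between register 3 and the stored assignment only an inequality is kept. It holds trivially at
the start, where register 3 is 0, and it is enough for register 3 to certify the quality of the
output. -/
lemma hoare_update {s : Memory} (hs : HasInput L s) (hα : Holds α s)
    (h6 : s.reg 6 = numSat F α) (h3 : s.reg 3 ≤ numSat F (output n s)) :
    Hoare update δ s (n * 5 + 5) fun s' => s'.reg 3 = max (s.reg 3) (numSat F α) ∧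
      s'.reg 3 ≤ numSat F (output n s') := by
  refine Hoare.cond (c := n * 5 + 4) (fun h => ?_) (fun h => ?_) (by omega)
  · simp only [Test.holds, h6] at h
    refine Hoare.seq (c₁ := 3) (c₂ := n * 5 + 1) (hoare_straight (R := fun s' =>
      s'.reg 3 = numSat F α ∧ s'.reg 8 = n) _ rfl (by simp [h6, hs.reg_zero]) (by simp)) ?_
      (by omega)
    rintro s₁ ⟨e3, e8⟩ hF
    refine Hoare.loop (c := 4) (N := n) (fun i s' => s'.reg 8 = i ∧ ∀ v : Fin n, i ≤ v →
      s'.arr 3 v = (α v).toNat) ⟨e8, fun v hv => absurd v.2 (by omega)⟩ ?_ ?_ le_rfl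
    · rintro i s₂ hF₂ ⟨f8, f3⟩ hb
      have hs₂ := (hs.frame hF rfl).frame hF₂ rfl
      have hα₂ := (hα.frame hF rfl).frame hF₂ rfl
      simp only [Test.holds, hs₂.reg_two, f8] at hb
      obtain ⟨i, rfl⟩ : ∃ i', i = i' + 1 := ⟨i - 1, by omega⟩
      refine ⟨i, rfl, hoare_straight _ rfl ⟨by simp [f8], fun v hv => ?_⟩ (by simp)⟩
      simp only [List.foldl_cons, List.foldl_nil, Instr.next, setReg_reg, setReg_arr, setArr_arr,
        f8, Function.update_apply, if_true, Nat.add_sub_cancel]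
      by_cases h' : (v : ℕ) = i
      · simp [← h', hα₂ v]
      · simp [h', f3 v (by omega)]
    · rintro i s₂ hF₂ ⟨f8, f3⟩ hb
      have hs₂ := (hs.frame hF rfl).frame hF₂ rfl
      simp only [Test.holds, hs₂.reg_two, f8] at hb
      have g3 := (hF₂.1 3 rfl).trans e3
      have : output n s₂ = α := by
        funext v
        simp only [output, f3 v (by omega)]
        cases α v <;> simp
      rw [this, g3]
      exact ⟨(max_eq_right h.le).symm, le_rfl⟩
  · simp only [Test.holds, h6] at h
    exact hoare_straight _ rfl ⟨by simp; omega, by simpa [output] using h3⟩ (by simp)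

/-! ### Random steps -/

/-- Change the value of the variable `v`. -/
def flipVar (α : Fin n → Bool) (v : Fin n) : Fin n → Bool := Function.update α v (!α v)

/-- The assignment in array 4. -/
def assigned (n : ℕ) (s : Memory) : Fin n → Bool := fun v => decide (s.arr 4 v = 1)

open Classical in
/-- `W` of the assignment in array 4. -/
noncomputable def onAssigned (W : (Fin n → Bool) → ENNReal) (s : Memory) : ENNReal :=
  if Holds (assigned n s) s then W (assigned n s) else ⊤

lemma Holds.assigned_eq {s : Memory} (h : Holds α s) : assigned n s = α := by
  funext v
  simp only [assigned, h v]
  cases α v <;> simp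

lemma Holds.onAssigned_eq {s : Memory} (h : Holds α s) (W : (Fin n → Bool) → ENNReal) :
    onAssigned W s = W α := by
  unfold onAssigned
  rw [h.assigned_eq, if_pos h]

/-- The average of `W` over the results of flipping a random literal of a random clause in
`unsat F α`; nothing is flipped if there is no such clause. -/
noncomputable def walkAvg (F : Instance n) (W : (Fin n → Bool) → ENNReal) (α : Fin n → Bool) :
    ENNReal :=
  if unsat F α = ∅ then W α else
    (∑ C ∈ unsat F α, (∑ l ∈ C, W (flipVar α l.1)) / C.card) / (unsat F α).card

/-- All random choices of the algorithm are handled by this rule: the bound is the average of the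
bounds for the possible values. -/
lemma Spec.rand_seq {Q : Program} {s : Memory} {i j c c' : ℕ} {φ : Memory → ENNReal}
    {a : ℕ → ENNReal} (hj : 0 < s.reg j) (hQ : ∀ v < s.reg j, Spec Q δ (s.setReg i v) c φ (a v))
    (hc : 1 + c ≤ c') : Spec (.seq (.instr (.rand i j)) Q) δ s c' φ
      ((∑ v ∈ Finset.range (s.reg j), a v) / s.reg j) := by
  refine Spec.mono (c := 1 + c) ?_ hc (fun _ => le_rfl) le_rfl
  intro t
  rw [Program.run, ev_andThen, show t + (1 + c) = t + c + 1 by ring, Program.run, Instr.exec,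
    ev_map, ev_map, ev_uniformOfFinset, Finset.card_range, Nat.max_eq_right hj]
  exact ENNReal.div_le_div_right (Finset.sum_le_sum fun v hv => hQ v (Finset.mem_range.1 hv) t) _

/-- Flip the variable of the literal whose position is register 9 plus register 13. -/
def flipAt : Program :=
  .seq (.loop (.lt 2 13) (straight [.dec 13, .inc 9]))
    (.seq (straight [.read 13 1 9, .read 15 4 13])
      (.seq (.cond (.lt 2 15) (straight [.const 15 0]) (straight [.const 15 1]))
        (straight [.write 4 13 15])))

/-- Flip a random literal of the clause between the positions in registers 9 and 10. -/
def flipIn : Program :=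
  .seq (straight [.copy 11 9, .const 12 0])
    (.seq (.loop (.lt 11 10) (straight [.inc 11, .inc 12]))
      (.seq (.instr (.rand 13 12)) flipAt))

/-- Flip a random literal of a random clause listed in array 5. -/
def flip : Program :=
  .cond (.lt 2 7)
    (.seq (.instr (.rand 16 7))
      (.seq (straight [.read 16 5 16, .read 9 0 16, .inc 16, .read 10 0 16]) flipIn))
    (straight [])

lemma hoare_flipAt {s : Memory} {j q : ℕ} (hs : HasInput L s) (hα : Holds α s)
    (hj : j < L.length) (hq : q < L[j].length) (h9 : s.reg 9 = (input L).arr 0 j)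
    (h13 : s.reg 13 = q) :
    Hoare flipAt δ s (q * 4 + 9) fun s' => Holds (flipVar α L[j][q].1) s' := by
  refine Hoare.seq (c₁ := q * 4 + 1) (c₂ := 8) (R := fun s' =>
    s'.reg 9 = (input L).arr 0 j + q) ?_ ?_ (by omega)
  · refine Hoare.loop (c := 3) (N := q) (fun i s' => s'.reg 13 = i ∧
      s'.reg 9 + i = (input L).arr 0 j + q) ⟨h13, by rw [h9]⟩ ?_ ?_ le_rfl
    · rintro i s' hF ⟨e13, e9⟩ hb
      simp only [Test.holds, (hs.frame hF rfl).reg_two, e13] at hb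
      obtain ⟨i, rfl⟩ : ∃ i', i = i' + 1 := ⟨i - 1, by omega⟩
      exact ⟨i, rfl, hoare_straight _ rfl ⟨by simp [e13], by simp; omega⟩ (by simp)⟩
    · rintro i s' hF ⟨e13, e9⟩ hb
      simp only [Test.holds, (hs.frame hF rfl).reg_two, e13] at hb
      omega
  rintro s₁ e9 hF
  have hs₁ := hs.frame hF rfl
  have hα₁ := hα.frame hF rfl
  have hv := input_var hj hq
  rw [← hs₁.arr_one, ← e9] at hv
  refine Hoare.seq (c₁ := 3) (c₂ := 5) (hoare_straight (R := fun s' =>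
    s'.reg 13 = (L[j][q].1 : ℕ) ∧ s'.reg 15 = (α L[j][q].1).toNat) _ rfl
    (by simp [hv, hα₁ L[j][q].1]) (by simp)) ?_ le_rfl
  rintro s₂ ⟨e13, e15⟩ hF₂
  have hs₂ := hs₁.frame hF₂ rfl
  have hα₂ := hα₁.frame hF₂ rfl
  refine Hoare.seq (c₁ := 3) (c₂ := 2) (R := fun s' => s'.reg 15 = (!α L[j][q].1).toNat) ?_ ?_ le_rfl
  · refine Hoare.cond (c := 2) (fun h => ?_) (fun h => ?_) le_rfl <;>
    · simp only [Test.holds, hs₂.reg_two, e15] at h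
      refine hoare_straight _ rfl ?_ (by simp)
      cases h' : α L[j][q].1 <;> simp_all
  rintro s₃ f15 hF₃
  have f13 := (hF₃.1 13 rfl).trans e13
  have hα₃ := hα₂.frame hF₃ rfl
  refine hoare_straight _ rfl (fun v => ?_) (by simp)
  simp only [List.foldl_cons, List.foldl_nil, Instr.next, setArr_arr, f13, f15, if_true,
    Function.update_apply, flipVar]
  by_cases h : v = L[j][q].1
  · simp [h]
  · have : (v : ℕ) ≠ (L[j][q].1 : ℕ) := fun h' => h (Fin.ext h')
    simp [h, this, hα₃ v]

lemma spec_flipIn (hL : Lists L F) {s : Memory} {j k : ℕ} (hs : HasInput L s) (hα : Holds α s)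
    (hj : j < L.length) (hk : (clauseAt L j).card ≤ k) (h0 : 0 < (clauseAt L j).card)
    (h9 : s.reg 9 = (input L).arr 0 j) (h10 : s.reg 10 = (input L).arr 0 (j + 1))
    (W : (Fin n → Bool) → ENNReal) :
    Spec flipIn δ s (k * 8 + 14) (onAssigned W)
      ((∑ l ∈ clauseAt L j, W (flipVar α l.1)) / (clauseAt L j).card) := by
  have hcard := hL.card_clauseAt hj
  refine Hoare.seq_spec (c₁ := 3) (c₂ := k * 8 + 11) (hoare_straight (R := fun s' =>
    s'.reg 11 = (input L).arr 0 j ∧ s'.reg 12 = 0) _ rfl (by simp [h9]) (by simp)) ?_ (by omega)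
  rintro s₁ ⟨e11, e12⟩ hF
  have hs₁ := hs.frame hF rfl
  have e9 := (hF.1 9 rfl).trans h9
  have e10 := (hF.1 10 rfl).trans h10
  refine Hoare.seq_spec (c₁ := k * 4 + 1) (c₂ := k * 4 + 10) (R := fun s' =>
    s'.reg 12 = L[j].length) ?_ ?_ (by omega)
  · refine Hoare.loop (c := 3) (N := L[j].length) (fun i s' => ∃ q, q + i = L[j].length ∧
      s'.reg 11 = (input L).arr 0 j + q ∧ s'.reg 12 = q)
      ⟨0, by simp, by simpa using e11, e12⟩ ?_ ?_ (by omega)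
    · rintro i s' hF' ⟨q, hq, f11, f12⟩ hb
      have f10 := (hF'.1 10 rfl).trans e10
      simp only [Test.holds, f11, f10, start_succ hj] at hb
      obtain ⟨i, rfl⟩ : ∃ i', i = i' + 1 := ⟨i - 1, by omega⟩
      exact ⟨i, rfl, hoare_straight _ rfl
        ⟨q + 1, by omega, by simp [f11, add_assoc], by simp [f12]⟩ (by simp)⟩
    · rintro i s' hF' ⟨q, hq, f11, f12⟩ hb
      have f10 := (hF'.1 10 rfl).trans e10
      simp only [Test.holds, f11, f10, start_succ hj] at hb
      omega
  rintro s₂ f12 hF₂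
  have hs₂ := hs₁.frame hF₂ rfl
  have hα₂ := (hα.frame hF rfl).frame hF₂ rfl
  have f9 := (hF₂.1 9 rfl).trans e9
  have key := Spec.rand_seq (Q := flipAt) (δ := δ) (s := s₂) (i := 13) (j := 12) (c := k * 4 + 9)
    (c' := k * 4 + 10) (φ := onAssigned W)
    -- The default value is never reached; it is the clause's own first literal because `Literal n`
    -- is empty for `n = 0`.
    (a := fun q => (fun l => W (flipVar α l.1)) (L[j].getD q (L[j][0]'(by omega))))
    (by omega) ?_ (by omega)
  · beta_reduce at key
    rw [f12, sum_range_getD _ (hL.literals_nodup _ (List.getElem_mem hj)) _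
        (fun l => W (flipVar α l.1)),
      ← clauseAt_of_lt hj, ← hcard] at key
    exact key
  · intro q hq
    rw [f12] at hq
    rw [List.getD_eq_getElem _ _ hq]
    refine ((hoare_flipAt (s := s₂.setReg 13 q) (j := j) (q := q) (α := α) (L := L) ?_ ?_ hj hq ?_ ?_).mono
      (c' := k * 4 + 9) (by omega) (fun _ h => h)).spec ?_
    · exact ⟨by simp [hs₂.1], by simp [hs₂.2], by simp [hs₂.3], hs₂.4, hs₂.5, hs₂.6⟩
    · exact hα₂
    · simp [f9]
    · simp
    · intro s' h _
      rw [h.onAssigned_eq]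

lemma spec_flip (hL : Lists L F) {s : Memory} {k : ℕ} (hs : HasInput L s) (hα : Holds α s)
    (hk : IsKInstance k F) (h7 : s.reg 7 = (unsatList L α L.length).length)
    (h5 : ∀ i < (unsatList L α L.length).length, s.arr 5 i = (unsatList L α L.length).getD i 0)
    (W : (Fin n → Bool) → ENNReal) :
    Spec flip δ s (k * 8 + 21) (onAssigned W) (walkAvg F W α) := by
  have hcard := hL.length_unsatList α
  refine Spec.cond (c := k * 8 + 20) (fun h => ?_) (fun h => ?_) le_rfl
  · simp only [Test.holds, hs.reg_two, h7, hcard] at h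
    have key := Spec.rand_seq (Q := .seq (straight [.read 16 5 16, .read 9 0 16, .inc 16,
      .read 10 0 16]) flipIn) (δ := δ) (s := s) (i := 16) (j := 7) (c := k * 8 + 19)
      (c' := k * 8 + 20) (φ := onAssigned W)
      (a := fun r => (fun C : Clause n => (∑ l ∈ C, W (flipVar α l.1)) / C.card)
        (clauseAt L ((unsatList L α L.length).getD r 0)))
      (by omega) ?_ (by omega)
    · unfold walkAvg
      beta_reduce at key
      rw [h7, hL.sum_unsat α (fun C => (∑ l ∈ C, W (flipVar α l.1)) / C.card), hcard] at key
      rw [if_neg (fun h' => by simp [h'] at h)]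
      exact key
    · intro r hr
      rw [h7] at hr
      have hmem : (unsatList L α L.length).getD r 0 ∈ unsatList L α L.length := by
        rw [List.getD_eq_getElem _ _ hr]
        exact List.getElem_mem hr
      obtain ⟨hj, h2, -⟩ := mem_unsatList.1 hmem
      have h5' := h5 r hr
      set j := (unsatList L α L.length).getD r 0
      refine Hoare.seq_spec (c₁ := 5) (c₂ := k * 8 + 14) (hoare_straight (R := fun s' =>
        s'.reg 9 = (input L).arr 0 j ∧ s'.reg 10 = (input L).arr 0 (j + 1)) _ rfl
        (by simp [h5', hs.arr_zero]) (by simp)) ?_ (by omega)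
      rintro s' ⟨e9, e10⟩ hF
      refine spec_flipIn hL ?_ ?_ hj (hk _ (hL.mem hj)) (by omega) e9 e10 W
      · have hs' : HasInput L (s.setReg 16 r) :=
          ⟨by simp [hs.1], by simp [hs.2], by simp [hs.3], hs.4, hs.5, hs.6⟩
        exact hs'.frame hF rfl
      · exact Holds.frame (s := s.setReg 16 r) hα hF rfl
  · simp only [Test.holds, hs.reg_two, h7, hcard] at h
    unfold walkAvg
    rw [if_pos (Finset.card_eq_zero.1 (by omega))]
    refine (hoare_straight (R := fun s' => Holds α s') _ rfl ?_ (by simp)).spec ?_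
    · exact hα
    · intro s' h' _
      rw [h'.onAssigned_eq]

/-- Choose the assignment in array 4 uniformly at random. -/
def randomize : Program :=
  .seq (straight [.copy 8 0, .const 14 2])
    (.loop (.lt 2 8) (.seq (straight [.dec 8])
      (.seq (.instr (.rand 15 14)) (straight [.write 4 8 15]))))

/-- For each `β` the two updates are `β` and `flipVar β v`, in some order, and flipping `v` permutes
the assignments. -/
lemma sum_update (h : (Fin n → Bool) → ENNReal) (v : Fin n) :
    ∑ β, h (Function.update β v false) + ∑ β, h (Function.update β v true) = 2 * ∑ β, h β := by
  have hinv : ∑ β, h (flipVar β v) = ∑ β, h β := by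
    refine Finset.sum_equiv (Function.Involutive.toPerm (fun β => flipVar β v) ?_) (by simp)
      (fun _ _ => rfl)
    intro β
    simp [flipVar]
  rw [two_mul]
  nth_rw 2 [← hinv]
  rw [← Finset.sum_add_distrib, ← Finset.sum_add_distrib]
  refine Finset.sum_congr rfl fun β _ => ?_
  have h1 : Function.update β v (β v) = β := Function.update_eq_self v β
  cases hb : β v <;> rw [hb] at h1 <;> simp only [flipVar, hb, Bool.not_true, Bool.not_false, h1]
  rw [add_comm]

/-- `β` below `i` and the assignment in array 4 from `i` on. -/
def mix (i : ℕ) (β : Fin n → Bool) (s : Memory) : Fin n → Bool :=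
  fun v => if (v : ℕ) < i then β v else assigned n s v

/-- Bits are drawn from the last variable downwards. The potential averages `W` over the bits still
to be drawn and keeps those already in array 4. It sums over all `β`, although `mix` ignores the
coordinates from `i` on: the denominator `2 ^ n` then never changes and one round is exactly
`sum_update`. -/
lemma spec_randomize {s : Memory} (hs : HasInput L s) (W : (Fin n → Bool) → ENNReal) :
    Spec randomize δ s (n * 6 + 4) (onAssigned W) ((∑ β, W β) / 2 ^ n) := by
  classical
  let J : ℕ → Memory → Prop := fun i s' => HasInput L s' ∧ s'.reg 8 = i ∧ i ≤ n ∧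
    s'.reg 14 = 2 ∧ ∀ v : Fin n, i ≤ v → s'.arr 4 v ≤ 1
  let Ψ : ℕ → Memory → ENNReal := fun i s' =>
    if J i s' then (∑ β, W (mix i β s')) / 2 ^ n else ⊤
  refine Hoare.seq_spec (c₁ := 3) (c₂ := n * 6 + 1) (hoare_straight (R := fun s' =>
    s'.reg 8 = n ∧ s'.reg 14 = 2) _ rfl (by simp [hs.reg_zero]) (by simp)) ?_ (by omega)
  rintro s₁ ⟨e8, e14⟩ hF
  have hJ : J n s₁ := ⟨hs.frame hF rfl, e8, le_rfl, e14, fun v hv => absurd v.2 (by omega)⟩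
  have hΨ : Ψ n s₁ = (∑ β, W β) / 2 ^ n := by
    simp only [Ψ, if_pos hJ]
    congr 2
    funext β
    congr 1
    funext v
    simp [mix]
  rw [← hΨ]
  refine Spec.loop (c := 5) Ψ n s₁ ?_ ?_ le_rfl
  · intro i s₂ h hb
    have hJ₂ : J i s₂ := by
      by_contra h'
      exact h (if_neg h')
    obtain ⟨hs₂, f8, hi, f14, f4⟩ := hJ₂
    simp only [Test.holds, hs₂.reg_two, f8] at hb
    obtain ⟨i, rfl⟩ : ∃ i', i = i' + 1 := ⟨i - 1, by omega⟩
    refine ⟨i, rfl, ?_⟩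
    refine Hoare.seq_spec (c₁ := 2) (c₂ := 3) (hoare_straight (R := fun s' => s'.reg 8 = i) _ rfl
      (by simp [f8]) (by simp)) ?_ le_rfl
    intro s₃ g8 hF₃
    have hs₃ := hs₂.frame hF₃ rfl
    have g14 := (hF₃.1 14 rfl).trans f14
    have g4 : s₃.arr 4 = s₂.arr 4 := hF₃.2 4 rfl
    have key := Spec.rand_seq (Q := straight [.write 4 8 15]) (δ := δ) (s := s₃) (i := 15)
      (j := 14) (c := 2) (c' := 3) (φ := Ψ i)
      (a := fun r => (∑ β, W (mix (i + 1) (Function.update β ⟨i, hi⟩ (decide (r = 1))) s₂)) / 2 ^ n)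
      (by omega) ?_ le_rfl
    · refine key.mono le_rfl (fun _ => le_rfl) ?_
      simp only [Ψ]
      rw [if_pos ⟨hs₂, f8, hi, f14, f4⟩, g14, Finset.sum_range_succ, Finset.sum_range_one,
        ← ENNReal.add_div]
      have := sum_update (fun β => W (mix (i + 1) β s₂)) ⟨i, hi⟩
      simp only [zero_ne_one, decide_false, decide_true, this]
      rw [mul_div_assoc, mul_comm, Nat.cast_ofNat, ENNReal.mul_div_cancel_right (by simp) (by simp)]
    · intro r hr
      rw [g14] at hr
      refine (hoare_straight (R := fun s' => s' = (s₃.setReg 15 r).setArr 4 i r) _ rfl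
        (by simp [g8]) (by simp)).spec ?_
      rintro s' rfl -
      simp only [Ψ]
      rw [if_pos]
      · refine (congrArg (· / (2 : ENNReal) ^ n) (Finset.sum_congr rfl fun β _ => ?_)).le
        congr 1
        funext v
        simp only [mix, assigned, setArr_arr, setReg_arr, if_true, Function.update_apply]
        rcases lt_trichotomy (v : ℕ) i with h' | h' | h'
        · rw [if_pos h', if_pos (by omega), if_neg (fun h'' => by simp [h''] at h')]
        · have : v = ⟨i, hi⟩ := Fin.ext h'
          simp [this]
        · rw [if_neg (by omega), if_neg (by omega), if_neg (by omega), g4]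
      · refine ⟨⟨by simp [hs₃.1], by simp [hs₃.2], by simp [hs₃.3], by simp [hs₃.4],
          by simp [hs₃.5], by simp [hs₃.6]⟩, by simp [g8], by omega, by simp [g14], fun v hv => ?_⟩
        simp only [setArr_arr, setReg_arr, if_true, Function.update_apply]
        split_ifs with h'
        · omega
        · rw [g4]
          exact f4 v (by omega)
  · intro i s₂ h hb
    have hJ₂ : J i s₂ := by
      by_contra h'
      exact h (if_neg h')
    simp only [Ψ]
    rw [if_pos hJ₂]
    obtain ⟨hs₂, f8, hi, f14, f4⟩ := hJ₂
    simp only [Test.holds, hs₂.reg_two, f8] at hb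
    obtain rfl : i = 0 := by omega
    have hH : Holds (assigned n s₂) s₂ := by
      intro v
      have := f4 v (by omega)
      simp only [assigned]
      rcases Nat.le_one_iff_eq_zero_or_eq_one.1 this with h' | h' <;> simp [h']
    rw [hH.onAssigned_eq]
    have : ∀ β : Fin n → Bool, mix 0 β s₂ = assigned n s₂ := fun β => by funext v; simp [mix]
    simp only [this, Finset.sum_const, Finset.card_univ, Fintype.card_fun, Fintype.card_bool,
      Fintype.card_fin, nsmul_eq_mul, Nat.cast_pow, Nat.cast_ofNat]
    rw [mul_comm, ENNReal.mul_div_cancel_right (by simp) (by simp)]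

end MaxNAE

/-! ### The walk, the trials, and the computation of their numbers. -/

namespace MaxNAE

variable {n : ℕ} {L : List (List (Literal n))} {F : Instance n} {α : Fin n → Bool} {δ : ℝ}

/-! ### The random walk -/

open Classical in
/-- The probability that `j` rounds of the walk, started in `α`, visit no `δ`-approximation. -/
noncomputable def fail (F : Instance n) (δ : ℝ) : ℕ → (Fin n → Bool) → ENNReal
  | 0, _ => 1
  | j + 1, α => if IsApprox δ F α then 0 else walkAvg F (fail F δ j) α

/-- The average of `fail` over the initial assignments. -/
noncomputable def failAvg (F : Instance n) (δ : ℝ) (j : ℕ) : ENNReal :=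
  (∑ β, fail F δ j β) / 2 ^ n

lemma walkAvg_zero (F : Instance n) (α : Fin n → Bool) : walkAvg F (fun _ => 0) α = 0 := by
  simp [walkAvg]

lemma walkAvg_mul (F : Instance n) (W : (Fin n → Bool) → ENNReal) (a : ENNReal)
    (α : Fin n → Bool) : walkAvg F (fun β => W β * a) α = walkAvg F W α * a := by
  unfold walkAvg
  split_ifs
  · rfl
  · simp only [div_eq_mul_inv, Finset.sum_mul]
    refine Finset.sum_congr rfl fun C _ => Finset.sum_congr rfl fun l _ => ?_
    ring

/-- The input is still there, and array 3 holds an assignment that is at least as good as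
register 3 says. -/
def Sound (L : List (List (Literal n))) (F : Instance n) (s : Memory) : Prop :=
  HasInput L s ∧ s.reg 3 ≤ numSat F (output n s)

lemma Sound.frame {s s' : Memory} {P : Program} (h : Sound L F s) (hF : Frame P s s')
    (hP : P.safe = true) (h3 : P.keeps 3 = true) (ha : P.keepsArr 3 = true) : Sound L F s' := by
  refine ⟨h.1.frame hF hP, ?_⟩
  have : output n s' = output n s := by
    funext v
    simp only [output, hF.2 3 ha]
  rw [this, hF.1 3 h3]
  exact h.2

/-- Register 3 certifies a `δ`-approximation. -/
def Good (F : Instance n) (δ : ℝ) (s : Memory) : Prop := δ * (opt F : ℝ) ≤ (s.reg 3 : ℝ)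

open Classical in
/-- `⊤` if the memory is not sound, `0` if it is good, and `a` otherwise. -/
noncomputable def loss (L : List (List (Literal n))) (F : Instance n) (δ : ℝ) (a : ENNReal)
    (s : Memory) : ENNReal :=
  if Sound L F s then (if Good F δ s then 0 else a) else ⊤

/-- One round of the walk. -/
def walkStep : Program :=
  .seq (straight [.dec 5]) (.seq evalAll (.seq update flip))

/-- Walk as many rounds as register 5 says. -/
def walk : Program := .loop (.lt 2 5) walkStep

/-- The running time of `walkStep`, for `m` clauses. -/
def walkStepTime (n m k : ℕ) : ℕ := m * (k * 11 + 18) + n * 5 + k * 8 + 33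

open Classical in
/-- The invariant of `walk`. -/
noncomputable def walkLoss (L : List (List (Literal n))) (F : Instance n) (δ : ℝ) (a : ENNReal)
    (j : ℕ) (s : Memory) : ENNReal :=
  if (Sound L F s ∧ s.reg 5 = j) ∧ Holds (assigned n s) s then
    (if Good F δ s then 0 else fail F δ j (assigned n s) * a) else ⊤

/-- The factor `a` stands for the probability that all later trials fail. Once register 3 certifies
an approximation the loss is 0 and stays 0; otherwise the current assignment is no approximation
either, and the average over the flip is the recursion that defines `fail`. -/
lemma spec_walkStep (hL : Lists L F) {s : Memory} {j k : ℕ} (hs : Sound L F s)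
    (hα : Holds α s) (hk : IsKInstance k F) (h5 : s.reg 5 = j + 1) (a : ENNReal) :
    Spec walkStep δ s (walkStepTime n L.length k) (walkLoss L F δ a j)
      (walkLoss L F δ a (j + 1) s) := by
  classical
  have hR : walkLoss L F δ a (j + 1) s = if Good F δ s then 0 else fail F δ (j + 1) α * a := by
    unfold walkLoss
    rw [if_pos ⟨⟨hs, h5⟩, by rw [hα.assigned_eq]; exact hα⟩, hα.assigned_eq]
  rw [hR]
  refine Hoare.seq_spec (c₁ := 2) (c₂ := L.length * (k * 11 + 18) + n * 5 + k * 8 + 31)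
    (hoare_straight (R := fun s' => s'.reg 5 = j) _ rfl (by simp [h5]) (by simp)) ?_
    (by unfold walkStepTime; omega)
  intro s₁ e5 hF₁
  have hs₁ := hs.frame hF₁ rfl rfl rfl
  have hα₁ := hα.frame hF₁ rfl
  refine Hoare.seq_spec (c₂ := n * 5 + k * 8 + 26) (hoare_evalAll hL hs₁.1 hα₁ hk) ?_ (by omega)
  rintro s₂ ⟨e6, e7, a5⟩ hF₂
  have hs₂ := hs₁.frame hF₂ rfl rfl rfl
  have hα₂ := hα₁.frame hF₂ rfl
  refine Hoare.seq_spec (c₂ := k * 8 + 21) (hoare_update hs₂.1 hα₂ e6 hs₂.2) ?_ (by omega)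
  rintro s₃ ⟨e3, h3⟩ hF₃
  have hs₃ : Sound L F s₃ := ⟨hs₂.1.frame hF₃ rfl, h3⟩
  have hα₃ := hα₂.frame hF₃ rfl
  have f5 : s₃.reg 5 = j := (hF₃.1 5 rfl).trans ((hF₂.1 5 rfl).trans e5)
  have f3 : s₃.reg 3 = max (s.reg 3) (numSat F α) := by
    rw [e3, hF₂.1 3 rfl, hF₁.1 3 rfl]
  have key := (spec_flip (δ := δ) hL hs₃.1 hα₃ hk ((hF₃.1 7 rfl).trans e7)
    (fun i hi => by rw [hF₃.2 5 rfl]; exact a5 i hi)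
    -- `Good` depends only on register 3, which `flip` keeps, so it can be decided before the flip.
    (fun β => if Good F δ s₃ then 0 else fail F δ j β * a)).frame
  refine key.mono le_rfl (fun s₄ => ?_) ?_
  · by_cases hF₄ : Frame flip s₃ s₄
    swap
    · rw [if_neg hF₄]
      exact le_top
    rw [if_pos hF₄]
    by_cases hH : Holds (assigned n s₄) s₄
    swap
    · unfold onAssigned
      rw [if_neg hH]
      exact le_top
    rw [hH.onAssigned_eq]
    unfold walkLoss
    rw [if_pos ⟨⟨hs₃.frame hF₄ rfl rfl rfl, (hF₄.1 5 rfl).trans f5⟩, hH⟩]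
    unfold Good
    rw [hF₄.1 3 rfl]
  · by_cases hg : Good F δ s₃
    · simp only [hg, if_true, walkAvg_zero]
      exact zero_le
    · simp only [hg, if_false, walkAvg_mul]
      unfold Good at hg
      rw [f3, Nat.cast_max, le_max_iff, not_or] at hg
      rw [if_neg (show ¬ Good F δ s from hg.1)]
      refine le_of_eq ?_
      rw [fail, if_neg (show ¬ IsApprox δ F α from hg.2)]

lemma spec_walk (hL : Lists L F) {s : Memory} {j k : ℕ} (hk : IsKInstance k F) (a : ENNReal) :
    Spec walk δ s (j * (walkStepTime n L.length k + 1) + 1) (loss L F δ a)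
      (walkLoss L F δ a j s) := by
  classical
  refine Spec.loop (walkLoss L F δ a) j s ?_ ?_ le_rfl
  · intro j s h hb
    have h' : (Sound L F s ∧ s.reg 5 = j) ∧ Holds (assigned n s) s := by
      by_contra h'
      exact h (if_neg h')
    simp only [Test.holds, h'.1.1.1.reg_two, h'.1.2] at hb
    obtain ⟨i, rfl⟩ : ∃ i', j = i' + 1 := ⟨j - 1, by omega⟩
    exact ⟨i, rfl, spec_walkStep hL h'.1.1 h'.2 hk h'.1.2 a⟩
  · intro j s h hb
    have h' : (Sound L F s ∧ s.reg 5 = j) ∧ Holds (assigned n s) s := by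
      by_contra h'
      exact h (if_neg h')
    simp only [Test.holds, h'.1.1.1.reg_two, h'.1.2] at hb
    obtain rfl : j = 0 := by omega
    unfold loss walkLoss
    rw [if_pos h'.1.1, if_pos h', fail, one_mul]

/-- Walk from a random assignment; the number of rounds is in register 18. -/
def trial : Program := .seq randomize (.seq (straight [.copy 5 18]) walk)

/-- The running time of `trial`, for `j` rounds. -/
def trialTime (n m k j : ℕ) : ℕ := n * 6 + j * (walkStepTime n m k + 1) + 7

lemma spec_trial (hL : Lists L F) {s : Memory} {k : ℕ} (hs : Sound L F s)
    (hk : IsKInstance k F) (a : ENNReal) :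
    Spec trial δ s (trialTime n L.length k (s.reg 18)) (loss L F δ a)
      (loss L F δ (failAvg F δ (s.reg 18) * a) s) := by
  classical
  have key := (spec_randomize (δ := δ) hs.1
    (fun β => if Good F δ s then 0 else fail F δ (s.reg 18) β * a)).frame
  have hR : loss L F δ (failAvg F δ (s.reg 18) * a) s =
      (∑ β, if Good F δ s then 0 else fail F δ (s.reg 18) β * a) / 2 ^ n := by
    unfold loss
    rw [if_pos hs]
    split_ifs
    · simp
    · rw [← Finset.sum_mul, failAvg]
      simp only [div_eq_mul_inv]
      ring
  rw [hR]
  refine key.seq (c₂ := s.reg 18 * (walkStepTime n L.length k + 1) + 3) ?_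
    (by unfold trialTime; omega)
  intro s₁ h
  by_cases hF₁ : Frame randomize s s₁
  · rw [if_pos hF₁] at h
    have hH : Holds (assigned n s₁) s₁ := by
      by_contra h'
      exact h (if_neg h')
    have hs₁ := hs.frame hF₁ rfl rfl rfl
    have e18 := hF₁.1 18 rfl
    have e3 := hF₁.1 3 rfl
    rw [if_pos hF₁, hH.onAssigned_eq]
    refine Hoare.seq_spec (c₁ := 2) (c₂ := s.reg 18 * (walkStepTime n L.length k + 1) + 1)
      (hoare_straight (R := fun s' => s'.reg 5 = s.reg 18) _ rfl
      (by simp [e18]) (by simp)) ?_ (by omega)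
    intro s₂ f5 hF₂
    have hH₂ := hH.frame hF₂ rfl
    have f3 := (hF₂.1 3 rfl).trans e3
    refine (spec_walk hL hk a (j := s.reg 18)).mono le_rfl (fun _ => le_rfl) ?_
    unfold walkLoss
    rw [if_pos ⟨⟨hs₁.frame hF₂ rfl rfl rfl, f5⟩, by rw [hH₂.assigned_eq]; exact hH₂⟩,
      hH₂.assigned_eq]
    unfold Good
    rw [f3]
  · exact absurd (if_neg hF₁) h

/-- Repeat `trial` as often as register 4 says. -/
def trials : Program := .loop (.lt 2 4) (.seq (straight [.dec 4]) trial)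

/-- Every trial starts from a fresh random assignment, so each contributes a factor `failAvg` to the
probability that none succeeds. -/
lemma spec_trials (hL : Lists L F) {s : Memory} {k N j : ℕ} (hs : Sound L F s)
    (hk : IsKInstance k F) (h4 : s.reg 4 = N) (h18 : s.reg 18 = j) :
    Spec trials δ s (N * (trialTime n L.length k j + 3) + 1) (loss L F δ 1)
      (failAvg F δ j ^ N) := by
  classical
  let J : ℕ → Memory → Prop := fun i s' => Sound L F s' ∧ s'.reg 4 = i ∧ s'.reg 18 = j
  let Ψ : ℕ → Memory → ENNReal := fun i s' =>
    if J i s' then loss L F δ (failAvg F δ j ^ i) s' else ⊤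
  have hΨ : Ψ N s ≤ failAvg F δ j ^ N := by
    simp only [Ψ, if_pos (show J N s from ⟨hs, h4, h18⟩), loss, if_pos hs]
    split_ifs
    · exact zero_le
    · exact le_rfl
  refine Spec.mono (a := Ψ N s) (c := N * (trialTime n L.length k j + 3) + 1) ?_ le_rfl
    (fun _ => le_rfl) hΨ
  refine Spec.loop (c := trialTime n L.length k j + 2) Ψ N s ?_ ?_ le_rfl
  · intro i s₁ h hb
    have hJ : J i s₁ := by
      by_contra h'
      exact h (if_neg h')
    simp only [Ψ]
    rw [if_pos hJ]
    obtain ⟨hs₁, e4, e18⟩ := hJ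
    simp only [Test.holds, hs₁.1.reg_two, e4] at hb
    obtain ⟨i, rfl⟩ : ∃ i', i = i' + 1 := ⟨i - 1, by omega⟩
    refine ⟨i, rfl, ?_⟩
    refine Hoare.seq_spec (c₁ := 2) (hoare_straight (R := fun s' => s'.reg 4 = i) _ rfl
      (by simp [e4]) (by simp)) ?_ (by rw [add_comm])
    intro s₂ f4 hF₂
    have hs₂ := hs₁.frame hF₂ rfl rfl rfl
    have f18 : s₂.reg 18 = j := (hF₂.1 18 rfl).trans e18
    have key := (spec_trial (δ := δ) hL hs₂ hk (failAvg F δ j ^ i)).frame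
    rw [f18] at key
    refine key.mono le_rfl (fun s₃ => ?_) ?_
    · split_ifs with hJ₃ hF₃ hF₃
      · exact le_rfl
      · exact le_top
      · unfold loss
        rw [if_neg fun hs₃ => hJ₃ ⟨hs₃, (hF₃.1 4 rfl).trans f4, (hF₃.1 18 rfl).trans f18⟩]
      · exact le_rfl
    · unfold loss Good
      rw [if_pos hs₁, if_pos hs₂, hF₂.1 3 rfl, pow_succ']
  · intro i s₁ h hb
    have hJ : J i s₁ := by
      by_contra h'
      exact h (if_neg h')
    simp only [Ψ]
    rw [if_pos hJ]
    obtain ⟨hs₁, e4, e18⟩ := hJ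
    simp only [Test.holds, hs₁.1.reg_two, e4] at hb
    obtain rfl : i = 0 := by omega
    rw [pow_zero]

/-! ### The number of trials and of rounds -/

/-- Double register 4. -/
def double : Program :=
  .seq (straight [.copy 16 4]) (.loop (.lt 2 16) (straight [.dec 16, .inc 4]))

/-- Set register 4 to about `n * 2 ^ (u' + u * n / w)`. -/
def setTrials (u' u w : ℕ) : Program :=
  .seq (straight [.copy 4 0]) (.seq (rep double u') (.seq (straight [.const 8 0])
    (.loop (.lt 8 0) (.seq (rep (straight [.inc 8]) w) (rep double u)))))

/-- Set register 18 to `c * (n + 1)`. -/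
def setRounds (c : ℕ) : Program :=
  .seq (straight [.const 18 c, .copy 8 0])
    (.loop (.lt 2 8) (.seq (straight [.dec 8]) (rep (straight [.inc 18]) c)))

/-- The whole algorithm. -/
def algorithm (u' u w c : ℕ) : Program :=
  .seq (setRounds c) (.seq (setTrials u' u w) trials)

lemma hoare_double {s : Memory} (h2 : s.reg 2 = 0) {N M : ℕ} (h4 : s.reg 4 = N) (hM : 2 * N ≤ M) :
    Hoare double δ s (M * 4 + 3) fun s' => s'.reg 4 = 2 * N := by
  refine Hoare.seq (c₁ := 2) (c₂ := N * 4 + 1) (hoare_straight (R := fun s' => s'.reg 16 = N) _ rfl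
    (by simp [h4]) (by simp)) ?_ (by omega)
  intro s₁ e16 hF₁
  have e4 := (hF₁.1 4 rfl).trans h4
  refine Hoare.loop (c := 3) (N := N) (fun i s' => s'.reg 16 = i ∧ s'.reg 4 + i = 2 * N)
    ⟨e16, by omega⟩ ?_ ?_ le_rfl
  · rintro i s₂ hF₂ ⟨f16, f4⟩ hb
    simp only [Test.holds, (hF₂.1 2 rfl).trans ((hF₁.1 2 rfl).trans h2), f16] at hb
    obtain ⟨i, rfl⟩ : ∃ i', i = i' + 1 := ⟨i - 1, by omega⟩
    exact ⟨i, rfl, hoare_straight _ rfl ⟨by simp [f16], by simp; omega⟩ (by simp)⟩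
  · rintro i s₂ hF₂ ⟨f16, f4⟩ hb
    simp only [Test.holds, (hF₂.1 2 rfl).trans ((hF₁.1 2 rfl).trans h2), f16] at hb
    omega

lemma hoare_rep_double {s : Memory} (h2 : s.reg 2 = 0) {N M u : ℕ} (h4 : s.reg 4 = N)
    (hM : N * 2 ^ u ≤ M) :
    Hoare (rep double u) δ s (u * (M * 4 + 3) + 1) fun s' => s'.reg 4 = N * 2 ^ u := by
  induction u generalizing s N with
  | zero => exact hoare_straight [] rfl (by simp [h4]) (by simp)
  | succ u ih =>
    have h1 : 2 * N ≤ M := by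
      refine le_trans ?_ hM
      rw [pow_succ', mul_comm 2 N, ← mul_assoc]
      exact Nat.le_mul_of_pos_right _ (by positivity)
    refine (hoare_double h2 h4 h1).seq (c₂ := u * (M * 4 + 3) + 1) ?_ (by ring_nf; omega)
    intro s₁ e4 hF₁
    refine (ih ((hF₁.1 2 rfl).trans h2) e4 (by rw [pow_succ'] at hM; linarith)).mono
      le_rfl ?_
    intro s' h'
    rw [h', pow_succ']
    ring

lemma hoare_rep_inc (i c : ℕ) {s : Memory} {v : ℕ} (h : s.reg i = v) :
    Hoare (rep (straight [.inc i]) c) δ s (c * 2 + 1) fun s' => s'.reg i = v + c := by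
  refine (hoare_rep (c := 2) (fun r s' => s'.reg i = v + r) ?_ c 0 s h).mono le_rfl ?_
  · intro r s' h'
    exact hoare_straight _ rfl (by simp [h', add_assoc]) (by simp)
  · intro s' h'
    rw [h', zero_add]

lemma safe_rep {P : Program} (hP : P.safe = true) (r : ℕ) : (rep P r).safe = true := by
  simp only [Program.safe, Bool.and_eq_true] at hP ⊢
  obtain ⟨⟨⟨⟨⟨h0, h1⟩, h2⟩, a0⟩, a1⟩, a2⟩ := hP
  exact ⟨⟨⟨⟨⟨keeps_rep _ _ _ h0 (by norm_num), keeps_rep _ _ _ h1 (by norm_num)⟩,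
    keeps_rep _ _ _ h2 (by norm_num)⟩, keepsArr_rep _ _ _ a0⟩, keepsArr_rep _ _ _ a1⟩,
    keepsArr_rep _ _ _ a2⟩

/-- The running time of `setRounds`. -/
def roundsTime (n c : ℕ) : ℕ := n * (c * 2 + 4) + 4

lemma hoare_setRounds {s : Memory} (hs : HasInput L s) (c : ℕ) :
    Hoare (setRounds c) δ s (roundsTime n c) fun s' => s'.reg 18 = c * (n + 1) := by
  refine Hoare.seq (c₁ := 3) (c₂ := n * (c * 2 + 4) + 1) (hoare_straight (R := fun s' =>
    s'.reg 18 = c ∧ s'.reg 8 = n) _ rfl (by simp [hs.reg_zero]) (by simp)) ?_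
    (by unfold roundsTime; omega)
  rintro s₁ ⟨e18, e8⟩ hF₁
  have k2 : (Program.seq (straight [.dec 8]) (rep (straight [.inc 18]) c)).keeps 2 = true := by
    simp [Program.keeps, keeps_rep, straight, Instr.keeps]
  have h2 : ∀ s₂, Frame (.seq (straight [.dec 8]) (rep (straight [.inc 18]) c)) s₁ s₂ →
      s₂.reg 2 = 0 := fun s₂ hF₂ => (hF₂.1 2 k2).trans ((hF₁.1 2 rfl).trans hs.reg_two)
  refine Hoare.loop (c := c * 2 + 3) (N := n) (fun i s' => s'.reg 8 = i ∧
    s'.reg 18 + c * i = c * (n + 1)) ⟨e8, by rw [e18]; ring⟩ ?_ ?_ le_rfl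
  · rintro i s₂ hF₂ ⟨f8, f18⟩ hb
    simp only [Test.holds, h2 s₂ hF₂, f8] at hb
    obtain ⟨i, rfl⟩ : ∃ i', i = i' + 1 := ⟨i - 1, by omega⟩
    refine ⟨i, rfl, Hoare.seq (c₁ := 2) (hoare_straight (R := fun s' => s'.reg 8 = i) _ rfl
      (by simp [f8]) (by simp)) ?_ (by rw [add_comm])⟩
    intro s₃ g8 hF₃
    refine (hoare_rep_inc 18 c rfl).frame.mono le_rfl ?_
    rintro s₄ ⟨h18, hF₄⟩
    refine ⟨(hF₄.1 8 (keeps_rep _ _ _ rfl (by norm_num))).trans g8, ?_⟩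
    rw [h18, hF₃.1 18 rfl, ← f18]
    ring
  · rintro i s₂ hF₂ ⟨f8, f18⟩ hb
    simp only [Test.holds, h2 s₂ hF₂, f8] at hb
    obtain rfl : i = 0 := by omega
    simpa using f18

/-- The running time of `setTrials`, if all numbers are bounded by `M`. -/
def trialsTime (n u' u w M : ℕ) : ℕ :=
  u' * (M * 4 + 3) + n * (w * 2 + u * (M * 4 + 3) + 3) + 6

/-- Division is replaced by counting: register 8 rises in steps of `w` until it reaches `n`, with
`u` doublings per step. The lower bound on the number `r` of steps is needed for the success
probability, the upper bound for the running time. All intermediate values are at most `M`, which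
bounds the cost of each doubling. -/
lemma hoare_setTrials {s : Memory} (hs : HasInput L s) {u' u w M : ℕ} (hw : 0 < w)
    (hM : n * 2 ^ (u' + u * (n / w + 1)) ≤ M) :
    Hoare (setTrials u' u w) δ s (trialsTime n u' u w M) fun s' =>
      ∃ r, n ≤ r * w ∧ r ≤ n / w + 1 ∧ s'.reg 4 = n * 2 ^ (u' + u * r) := by
  refine Hoare.seq (c₁ := 2) (c₂ := u' * (M * 4 + 3) + n * (w * 2 + u * (M * 4 + 3) + 3) + 4)
    (hoare_straight (R := fun s' => s'.reg 4 = n) _ rfl (by simp [hs.reg_zero]) (by simp)) ?_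
    (by unfold trialsTime; omega)
  intro s₁ e4 hF₁
  have hs₁ := hs.frame hF₁ rfl
  refine Hoare.seq (c₂ := n * (w * 2 + u * (M * 4 + 3) + 3) + 3)
    (hoare_rep_double hs₁.reg_two e4 (u := u') (M := M) ?_) ?_ (by omega)
  · refine le_trans ?_ hM
    gcongr
    · norm_num
    · omega
  intro s₂ f4 hF₂
  have hs₂ := hs₁.frame hF₂ (safe_rep rfl _)
  refine Hoare.seq (c₁ := 2) (c₂ := n * (w * 2 + u * (M * 4 + 3) + 3) + 1)
    (hoare_straight (R := fun s' => s'.reg 8 = 0) _ rfl (by simp) (by simp)) ?_ (by omega)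
  intro s₃ g8 hF₃
  have hs₃ := hs₂.frame hF₃ rfl
  have g4 := (hF₃.1 4 rfl).trans f4
  have k0 : (Program.seq (rep (straight [.inc 8]) w) (rep double u)).safe = true := by
    have h1 := safe_rep (P := straight [.inc 8]) rfl w
    have h2 := safe_rep (P := double) rfl u
    simp only [Program.safe, Program.keeps, Program.keepsArr, Bool.and_eq_true] at h1 h2 ⊢
    simp [h1, h2]
  refine Hoare.loop (c := w * 2 + u * (M * 4 + 3) + 2) (N := n) (fun i s' => ∃ r, r + i = n ∧
    s'.reg 8 = r * w ∧ r ≤ n / w + 1 ∧ s'.reg 4 = n * 2 ^ (u' + u * r))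
    ⟨0, by simp, by simp [g8], by simp, by simpa using g4⟩ ?_ ?_ le_rfl
  · rintro i s₄ hF₄ ⟨r, hr, i8, hrw, i4⟩ hb
    have hs₄ := hs₃.frame hF₄ k0
    simp only [Test.holds, hs₄.reg_zero, i8] at hb
    have hrn : r < n := lt_of_le_of_lt (Nat.le_mul_of_pos_right r hw) hb
    have hrw' : r ≤ n / w := (Nat.le_div_iff_mul_le hw).2 hb.le
    obtain ⟨i, rfl⟩ : ∃ i', i = i' + 1 := ⟨i - 1, by omega⟩
    refine ⟨i, rfl, Hoare.seq (c₂ := u * (M * 4 + 3) + 1) (hoare_rep_inc 8 w i8) ?_ (by omega)⟩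
    intro s₅ j8 hF₅
    have j4 := (hF₅.1 4 (keeps_rep _ _ _ rfl (by norm_num))).trans i4
    have hs₅ := hs₄.frame hF₅ (safe_rep rfl _)
    refine (hoare_rep_double hs₅.reg_two j4 (u := u) (M := M) ?_).frame.mono le_rfl ?_
    · refine le_trans (le_of_eq ?_) (le_trans (Nat.mul_le_mul_left n (Nat.pow_le_pow_right
        two_pos (show u' + u * (r + 1) ≤ u' + u * (n / w + 1) by gcongr))) hM)
      ring
    · rintro s₆ ⟨l4, hF₆⟩
      refine ⟨r + 1, by omega, ?_, by omega, ?_⟩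
      · rw [hF₆.1 8 (keeps_rep _ _ _ rfl (by norm_num)), j8]
        ring
      · rw [l4]
        ring
  · rintro i s₄ hF₄ ⟨r, hr, i8, hrw, i4⟩ hb
    have hs₄ := hs₃.frame hF₄ k0
    simp only [Test.holds, hs₄.reg_zero, i8] at hb
    exact ⟨r, by omega, hrw, i4⟩

end MaxNAE

/-! ### The whole algorithm, and what its specification implies. -/

namespace MaxNAE

variable {n : ℕ} {L : List (List (Literal n))} {F : Instance n} {δ : ℝ}

lemma hasInput_input (L : List (List (Literal n))) : HasInput L (input L) :=
  ⟨rfl, rfl, rfl, rfl, rfl, rfl⟩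

lemma sound_input (L : List (List (Literal n))) (F : Instance n) : Sound L F (input L) :=
  ⟨hasInput_input L, zero_le⟩

lemma setRounds_keeps (c i : ℕ) (hi : i ≠ 18 ∧ i ≠ 8 ∧ i ≠ 31) : (setRounds c).keeps i = true := by
  have h := keeps_rep (straight [.inc 18]) i c
    (by simp [Program.keeps, straight, Instr.keeps, hi]) hi.2.2
  simp only [straight] at h
  simp [setRounds, Program.keeps, straight, Instr.keeps, h, hi]

lemma setRounds_keepsArr (c a : ℕ) : (setRounds c).keepsArr a = true := by
  simp [setRounds, Program.keepsArr, straight, Instr.keepsArr, keepsArr_rep]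

lemma setTrials_keeps (u' u w i : ℕ) (hi : i ≠ 4 ∧ i ≠ 8 ∧ i ≠ 16 ∧ i ≠ 31) :
    (setTrials u' u w).keeps i = true := by
  have h := keeps_rep (straight [.inc 8]) i w
    (by simp [Program.keeps, straight, Instr.keeps, hi]) hi.2.2.2
  have h' := fun c => keeps_rep double i c
    (by simp [double, Program.keeps, straight, Instr.keeps, hi]) hi.2.2.2
  simp only [straight] at h
  simp [setTrials, Program.keeps, straight, Instr.keeps, h, h', hi]

lemma setTrials_keepsArr (u' u w a : ℕ) : (setTrials u' u w).keepsArr a = true := by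
  simp [setTrials, Program.keepsArr, straight, Instr.keepsArr, keepsArr_rep, double]

/-- The running time of `algorithm`, for `m` clauses, if there are at most `M` trials. -/
def algorithmTime (n m k u' u w c M : ℕ) : ℕ :=
  roundsTime n c + (trialsTime n u' u w M + (M * (trialTime n m k (c * (n + 1)) + 3) + 1))

lemma spec_algorithm (hL : Lists L F) {k u' u w c M : ℕ} (hk : IsKInstance k F) (hw : 0 < w)
    (hM : n * 2 ^ (u' + u * (n / w + 1)) ≤ M) {a : ENNReal}
    (ha : ∀ r, n ≤ r * w → failAvg F δ (c * (n + 1)) ^ (n * 2 ^ (u' + u * r)) ≤ a) :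
    Spec (algorithm u' u w c) δ (input L) (algorithmTime n L.length k u' u w c M)
      (loss L F δ 1) a := by
  refine Hoare.seq_spec (hoare_setRounds (hasInput_input L) c) ?_ le_rfl
  intro s₁ e18 hF₁
  have hs₁ : Sound L F s₁ := (sound_input L F).frame hF₁
    (by simp [Program.safe, setRounds_keeps, setRounds_keepsArr])
    (setRounds_keeps _ _ (by norm_num)) (setRounds_keepsArr _ _)
  refine Hoare.seq_spec (hoare_setTrials hs₁.1 hw hM) ?_ le_rfl
  rintro s₂ ⟨r, hr, hr', f4⟩ hF₂
  have hs₂ : Sound L F s₂ := hs₁.frame hF₂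
    (by simp [Program.safe, setTrials_keeps, setTrials_keepsArr])
    (setTrials_keeps _ _ _ _ (by norm_num)) (setTrials_keepsArr _ _ _ _)
  have f18 := (hF₂.1 18 (setTrials_keeps _ _ _ _ (by norm_num))).trans e18
  refine (spec_trials hL hs₂ hk f4 f18).mono ?_ (fun _ => le_rfl) (ha r hr)
  gcongr
  refine le_trans ?_ hM
  gcongr
  norm_num

lemma ratioFree_straight (l : List Instr) : (straight l).RatioFree := by
  induction l with
  | nil => trivial
  | cons o l ih => exact ⟨trivial, ih⟩

lemma ratioFree_rep {P : Program} (h : P.RatioFree) (c : ℕ) : (rep P c).RatioFree := by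
  induction c with
  | zero => exact ratioFree_straight _
  | succ c ih => exact ⟨h, ih⟩

/-- The program never checks whether it has found a `δ`-approximation; it just keeps the best
assignment. So `δ` matters only for the choice of the four constants, also when it is irrational. -/
lemma ratioFree_algorithm (u' u w c : ℕ) : (algorithm u' u w c).RatioFree := by
  have h : ∀ c, (rep double c).RatioFree :=
    ratioFree_rep (by simp [double, Program.RatioFree, ratioFree_straight])
  simp [algorithm, setRounds, setTrials, h, trials, trial, randomize, walk, walkStep, evalAll,
    evalClause, evalLiteral, appendClause, update, flip, flipIn, flipAt,
    Program.RatioFree, ratioFree_straight, ratioFree_rep]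

/-- A timeout has value `⊤`, so a finite expectation gives it probability zero. A bad output has
loss at least 1, because a sound and good memory holds an approximation; hence its probability is at
most the expectation. -/
lemma approximates_of_spec {P : Program} {k : ℕ} {T : ℕ → ℝ} {c : (n : ℕ) → ℕ → ℕ}
    (hT : ∀ (n : ℕ) (F : Instance n), IsKInstance k F → (c n F.card : ℝ) ≤ T n)
    (h : ∀ (n : ℕ) (F : Instance n), IsKInstance k F → ∀ L, Lists L F →
      Spec P δ (input L) (c n L.length) (loss L F δ 1) ((1 / 2) ^ n)) :
    Approximates P k δ T := by
  intro n F hk L hL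
  have hS := h n F hk L hL
  have hc : c n L.length ≤ ⌊T n⌋₊ := by
    rw [hL.length_eq]
    exact Nat.le_floor (hT n F hk)
  obtain ⟨t, ht⟩ := Nat.exists_eq_add_of_le' hc
  have h1 := hS t
  rw [← ht] at h1
  set p := P.run δ (input L) ⌊T n⌋₊
  constructor
  · by_contra h0
    have : p none * after (loss L F δ 1) t none ≤ (1 / 2) ^ n :=
      (ENNReal.le_tsum (f := fun o => p o * after (loss L F δ 1) t o) none).trans h1
    simp only [after, ENNReal.mul_top h0, top_le_iff] at this
    exact absurd this (ENNReal.pow_ne_top (by simp))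
  · refine le_trans ?_ h1
    rw [PMF.toOuterMeasure_apply]
    refine ENNReal.tsum_le_tsum fun o => ?_
    by_cases ho : o ∈ {o | ∃ s t, o = some (s, t) ∧ ¬ IsApprox δ F (output n s)}
    · rw [Set.indicator_of_mem ho]
      obtain ⟨s, t', rfl, hs⟩ := ho
      refine le_mul_of_one_le_right' ?_
      simp only [after]
      split_ifs
      · unfold loss
        split_ifs with h2 h3
        · exact absurd (h3.trans (Nat.cast_le.2 h2.2)) hs
        · exact le_rfl
        · exact le_top
      · exact le_top
    · rw [Set.indicator_of_notMem ho]
      exact zero_le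

end MaxNAE

/-! ### Success probability of one trial: the drift of the walk and the counting of approximations.
-/

namespace MaxNAE

variable {n : ℕ} {F : Instance n} {δ : ℝ}

/-! ### Failure probabilities -/

lemma walkAvg_mono {W W' : (Fin n → Bool) → ENNReal} (h : ∀ β, W β ≤ W' β) (α : Fin n → Bool) :
    walkAvg F W α ≤ walkAvg F W' α := by
  unfold walkAvg
  split_ifs
  · exact h α
  · exact ENNReal.div_le_div_right (Finset.sum_le_sum fun C _ =>
      ENNReal.div_le_div_right (Finset.sum_le_sum fun l _ => h _) _) _

lemma walkAvg_one_le (F : Instance n) (α : Fin n → Bool) : walkAvg F (fun _ => 1) α ≤ 1 := by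
  unfold walkAvg
  split_ifs
  · exact le_rfl
  · refine le_trans (ENNReal.div_le_div_right (Finset.sum_le_card_nsmul _ _ 1 fun C _ => ?_) _) ?_
    · simp [ENNReal.div_self_le_one]
    · simp [ENNReal.div_self_le_one]

lemma fail_le_one (j : ℕ) : ∀ α, fail F δ j α ≤ 1 := by
  induction j with
  | zero => exact fun α => le_rfl
  | succ j ih =>
    intro α
    rw [fail]
    split_ifs
    · exact zero_le
    · exact (walkAvg_mono ih α).trans (walkAvg_one_le F α)

lemma failAvg_le_ofReal {j : ℕ} {f : (Fin n → Bool) → ℝ} (hf : ∀ α, 0 ≤ f α)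
    (h : ∀ α, fail F δ j α ≤ ENNReal.ofReal (f α)) :
    failAvg F δ j ≤ ENNReal.ofReal ((∑ α, f α) / 2 ^ n) := by
  unfold failAvg
  rw [ENNReal.ofReal_div_of_pos (by positivity), ENNReal.ofReal_sum_of_nonneg fun α _ => hf α,
    ENNReal.ofReal_pow zero_le_two, ENNReal.ofReal_ofNat]
  exact ENNReal.div_le_div_right (Finset.sum_le_sum fun α _ => h α) _

-- Only the start of the trial is used: if it is a `δ`-approximation, the trial has already
-- succeeded.
open Classical in
lemma failAvg_le_of_card (j : ℕ) {g : ℝ}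
    (h : g * 2 ^ n ≤ ((Finset.univ.filter fun α => IsApprox δ F α).card : ℝ)) :
    failAvg F δ (j + 1) ≤ ENNReal.ofReal (1 - g) := by
  refine (failAvg_le_ofReal (f := fun α => if IsApprox δ F α then 0 else 1)
    (fun α => by split_ifs <;> norm_num) fun α => ?_).trans (ENNReal.ofReal_le_ofReal ?_)
  · split_ifs with h'
    · rw [fail, if_pos h']
      exact zero_le
    · simpa using fail_le_one (j + 1) α
  · rw [div_le_iff₀ (by positivity)]
    have h1 : ∀ α : Fin n → Bool, (if IsApprox δ F α then (0 : ℝ) else 1) =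
        1 - if IsApprox δ F α then 1 else 0 := fun α => by split_ifs <;> norm_num
    simp only [h1, Finset.sum_sub_distrib, Finset.sum_boole]
    simp only [Finset.sum_const, Finset.card_univ, Fintype.card_fun, Fintype.card_bool,
      Fintype.card_fin, nsmul_eq_mul, mul_one, Nat.cast_pow, Nat.cast_ofNat]
    linarith

/-! ### The drift of the walk -/

lemma dist_flipVar_le (α β : Fin n → Bool) (v : Fin n) :
    hammingDist (flipVar α v) β ≤ hammingDist α β + 1 := by
  unfold hammingDist
  refine (Finset.card_le_card (t := insert v (Finset.univ.filter fun i => α i ≠ β i)) ?_).trans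
    (Finset.card_insert_le _ _)
  intro i hi
  simp only [Finset.mem_filter, Finset.mem_univ, true_and, Finset.mem_insert] at hi ⊢
  by_cases h : i = v
  · exact Or.inl h
  · right
    simpa [flipVar, h] using hi

lemma dist_flipVar_of_ne {α β : Fin n → Bool} {v : Fin n} (h : α v ≠ β v) :
    hammingDist (flipVar α v) β + 1 = hammingDist α β := by
  unfold hammingDist
  rw [show (Finset.univ.filter fun i => flipVar α v i ≠ β i) =
    (Finset.univ.filter fun i => α i ≠ β i).erase v from ?_]
  · exact Finset.card_erase_add_one (by simpa using h)
  · ext i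
    simp only [Finset.mem_filter, Finset.mem_univ, true_and, Finset.mem_erase]
    by_cases h' : i = v
    · subst h'
      simp only [flipVar, Function.update_self, ne_eq, not_true_eq_false, false_and, iff_false,
        not_not]
      revert h
      cases α i <;> cases β i <;> simp
    · simp [flipVar, h']

lemma exists_ne_of_nae {α β : Fin n → Bool} {C : Clause n} (hα : ¬ NAE α C) (hβ : NAE β C) :
    ∃ l ∈ C, α l.1 ≠ β l.1 := by
  by_contra! h
  have hv : ∀ l ∈ C, l.value α = l.value β := fun l hl => by simp [Literal.value, h l hl]
  obtain ⟨⟨l, hl, h1⟩, l', hl', h2⟩ := hβ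
  exact hα ⟨⟨l, hl, (hv l hl).trans h1⟩, l', hl', (hv l' hl').trans h2⟩

/-- Every flip multiplies the potential `x ^ hammingDist α β` by at least `x`. If `β` satisfies `C`
and `α` does not, they differ on the variable of some literal of `C`; that literal is chosen with
probability at least `1 / k` and gives the factor `1 / x`. -/
lemma sum_pow_dist_ge {x : ℝ} (h0 : 0 < x) (h1 : x ≤ 1) {k : ℕ} {α β : Fin n → Bool}
    {C : Clause n} (hC : 0 < C.card) (hk : C.card ≤ k) :
    x ^ hammingDist α β * (x + if ¬ NAE α C ∧ NAE β C then (1 / x - x) / k else 0) ≤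
      (∑ l ∈ C, x ^ hammingDist (flipVar α l.1) β) / C.card := by
  have hC' : (0 : ℝ) < C.card := by exact_mod_cast hC
  have hge : ∀ l ∈ C, x ^ hammingDist α β * x ≤ x ^ hammingDist (flipVar α l.1) β := by
    intro l _
    rw [← pow_succ]
    exact pow_le_pow_of_le_one h0.le h1 (dist_flipVar_le α β l.1)
  rw [le_div_iff₀ hC']
  split_ifs with h
  · obtain ⟨l, hl, hne⟩ := exists_ne_of_nae h.1 h.2
    have hd : x ^ hammingDist α β * (1 / x) = x ^ hammingDist (flipVar α l.1) β := by
      rw [← dist_flipVar_of_ne hne, pow_succ]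
      field_simp
    have hsum := Finset.sum_le_sum fun l' (hl' : l' ∈ C.erase l) => hge l' (Finset.mem_of_mem_erase hl')
    rw [Finset.sum_const, nsmul_eq_mul, Finset.card_erase_of_mem hl, Nat.cast_sub hC,
      Nat.cast_one] at hsum
    rw [← Finset.add_sum_erase _ _ hl, ← hd]
    have hk' : (C.card : ℝ) / k ≤ 1 := div_le_one_of_le₀ (by exact_mod_cast hk) (by positivity)
    have hx : 0 ≤ x ^ hammingDist α β * (1 / x - x) := by
      have : x ≤ 1 / x := by
        rw [le_div_iff₀ h0]
        nlinarith
      exact mul_nonneg (by positivity) (by linarith)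
    have := mul_le_mul_of_nonneg_left hk' hx
    calc _ = C.card * (x ^ hammingDist α β * x) +
          x ^ hammingDist α β * (1 / x - x) * (C.card / k) := by ring
      _ ≤ C.card * (x ^ hammingDist α β * x) + x ^ hammingDist α β * (1 / x - x) := by linarith
      _ ≤ _ := by linarith
  · have hsum := Finset.sum_le_sum hge
    rw [Finset.sum_const, nsmul_eq_mul] at hsum
    rw [add_zero]
    linarith

/-- Away from approximations the potential grows in expectation by a factor of at least `x + q * (1
/ x - x) ≥ 1 / ρ` per round, while it never exceeds 1. With unlimited rounds failure would have
probability at most one minus the initial potential; `ρ ^ j` pays for stopping after `j` rounds. -/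
lemma fail_le_walk {x ρ q : ℝ} {k : ℕ} (hk : IsKInstance k F) (hk0 : 0 < k) (β : Fin n → Bool)
    (h0 : 0 < x) (h1 : x ≤ 1) (hρ0 : 0 < ρ) (hρ1 : ρ ≤ 1) (hρ : 1 ≤ ρ * (x + q * (1 / x - x)))
    (hq : ∀ α, ¬ IsApprox δ F α → 0 < (unsat F α).card ∧
      q * k * (unsat F α).card ≤ ((unsat F α).filter (NAE β)).card) (j : ℕ) :
    ∀ α, fail F δ j α ≤ ENNReal.ofReal (1 - x ^ hammingDist α β + ρ ^ j) := by
  have hpow : ∀ α, x ^ hammingDist α β ≤ 1 := fun α => pow_le_one₀ h0.le h1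
  induction j with
  | zero =>
    intro α
    rw [fail, ← ENNReal.ofReal_one]
    refine ENNReal.ofReal_le_ofReal ?_
    have := hpow α
    simp
    linarith
  | succ j ih =>
    intro α
    rw [fail]
    split_ifs with happ
    · exact zero_le
    -- If the potential is this small, the claimed bound is at least 1. Otherwise the gain of a
    -- round, the potential times (growth factor minus one), covers the decrease from `ρ ^ j` to `ρ
    -- ^ (j + 1)`.
    by_cases htriv : x ^ hammingDist α β ≤ ρ ^ (j + 1)
    · refine le_trans (b := 1) ?_ ?_
      · have := fail_le_one (F := F) (δ := δ) (j + 1) α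
        rwa [fail, if_neg happ] at this
      · rw [← ENNReal.ofReal_one]
        exact ENNReal.ofReal_le_ofReal (by linarith)
    obtain ⟨hU, hN⟩ := hq α happ
    have hU' : (0 : ℝ) < (unsat F α).card := by exact_mod_cast hU
    set g : (Fin n → Bool) → ℝ := fun γ => 1 - x ^ hammingDist γ β + ρ ^ j with hg
    have hg0 : ∀ γ, 0 ≤ g γ := fun γ => by
      have := hpow γ
      have : 0 ≤ ρ ^ j := by positivity
      simp only [hg]
      linarith
    have hcard : ∀ C ∈ unsat F α, 0 < C.card ∧ C.card ≤ k ∧ ¬ NAE α C := by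
      intro C hC
      simp only [unsat, Finset.mem_filter] at hC
      exact ⟨by omega, hk C hC.1, hC.2.2⟩
    have hreal : walkAvg F (fun γ => ENNReal.ofReal (g γ)) α = ENNReal.ofReal
        ((∑ C ∈ unsat F α, (∑ l ∈ C, g (flipVar α l.1)) / C.card) / (unsat F α).card) := by
      unfold walkAvg
      rw [if_neg (fun h => by simp [h] at hU), ENNReal.ofReal_div_of_pos hU',
        ENNReal.ofReal_natCast, ENNReal.ofReal_sum_of_nonneg]
      · congr 1
        refine Finset.sum_congr rfl fun C hC => ?_
        have hC0 : (0 : ℝ) < C.card := by exact_mod_cast (hcard C hC).1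
        rw [ENNReal.ofReal_div_of_pos hC0, ENNReal.ofReal_natCast,
          ENNReal.ofReal_sum_of_nonneg fun l _ => hg0 _]
      · exact fun C _ => div_nonneg (Finset.sum_nonneg fun l _ => hg0 _) (by positivity)
    refine (walkAvg_mono ih α).trans ?_
    rw [hreal]
    refine ENNReal.ofReal_le_ofReal ?_
    rw [div_le_iff₀ hU']
    set d := x ^ hammingDist α β with hd
    have hC : ∀ C ∈ unsat F α, (∑ l ∈ C, g (flipVar α l.1)) / C.card ≤
        1 + ρ ^ j - d * x - if NAE β C then d * (1 / x - x) / k else 0 := by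
      intro C hC
      obtain ⟨c0, ck, hn⟩ := hcard C hC
      have := sum_pow_dist_ge h0 h1 (α := α) (β := β) c0 ck
      have hC0 : (0 : ℝ) < C.card := by exact_mod_cast c0
      have heq : (∑ l ∈ C, g (flipVar α l.1)) / C.card =
          1 + ρ ^ j - (∑ l ∈ C, x ^ hammingDist (flipVar α l.1) β) / C.card := by
        simp only [hg, Finset.sum_add_distrib, Finset.sum_sub_distrib, Finset.sum_const,
          nsmul_eq_mul]
        field_simp
        ring
      rw [heq]
      simp only [hn, not_false_eq_true, true_and] at this
      have h3 : d * (x + if NAE β C then (1 / x - x) / k else 0) =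
          d * x + if NAE β C then d * (1 / x - x) / k else 0 := by
        split_ifs <;> ring
      rw [← hd, h3] at this
      linarith
    refine (Finset.sum_le_sum hC).trans ?_
    rw [Finset.sum_sub_distrib, Finset.sum_const, nsmul_eq_mul, ← Finset.sum_filter,
      Finset.sum_const, nsmul_eq_mul]
    have hx : x ≤ 1 / x := by
      rw [le_div_iff₀ h0]
      nlinarith
    have hd0 : 0 < d := by positivity
    have hk' : (0 : ℝ) < k := by exact_mod_cast hk0
    have h4 : q * (unsat F α).card * (d * (1 / x - x)) ≤
        ((unsat F α).filter (NAE β)).card * (d * (1 / x - x) / k) := by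
      have := mul_le_mul_of_nonneg_right hN (show 0 ≤ d * (1 / x - x) / k from
        div_nonneg (mul_nonneg hd0.le (by linarith)) hk'.le)
      refine le_trans (le_of_eq ?_) this
      field_simp
    have h5 : 1 + ρ ^ j - d * (x + q * (1 / x - x)) ≤ 1 - d + ρ ^ (j + 1) := by
      push Not at htriv
      set z := x + q * (1 / x - x)
      have hz1 : 1 ≤ z := by nlinarith
      have h6 : ρ ^ j ≤ ρ ^ (j + 1) * z := by
        have := mul_le_mul_of_nonneg_left hρ (show 0 ≤ ρ ^ j by positivity)
        rw [pow_succ]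
        linarith
      nlinarith
    have h7 := mul_le_mul_of_nonneg_left h5 hU'.le
    linarith

lemma sum_pow_dist (x : ℝ) (β : Fin n → Bool) : ∑ α, x ^ hammingDist α β = (1 + x) ^ n := by
  have h1 : ∀ α : Fin n → Bool, x ^ hammingDist α β = ∏ v, if α v ≠ β v then x else 1 := by
    intro α
    rw [← Finset.prod_filter, Finset.prod_const]
    rfl
  simp only [h1]
  have h2 := (Finset.prod_univ_sum (fun _ : Fin n => (Finset.univ : Finset Bool))
    (fun v b => if b ≠ β v then x else 1)).symm
  rw [Fintype.piFinset_univ] at h2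
  rw [h2]
  have h3 : ∀ v : Fin n, (∑ b : Bool, if b ≠ β v then x else 1) = 1 + x := by
    intro v
    cases β v <;> simp [add_comm]
  simp only [h3, Finset.prod_const, Finset.card_univ, Fintype.card_fin]

/-- The initial potential averages to `((1 + x) / 2) ^ n`, which is at least `2 ^ (-n)`. After `c *
(n + 1)` rounds the truncation error is at most `2 ^ (-(n + 1))`, hence at most half of it. -/
lemma failAvg_le_walk {x ρ q : ℝ} {k c : ℕ} (hk : IsKInstance k F) (hk0 : 0 < k)
    (β : Fin n → Bool) (h0 : 0 < x) (h1 : x ≤ 1) (hρ0 : 0 < ρ) (hρ1 : ρ ≤ 1)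
    (hρ : 1 ≤ ρ * (x + q * (1 / x - x))) (hc : ρ ^ c ≤ 1 / 2)
    (hq : ∀ α, ¬ IsApprox δ F α → 0 < (unsat F α).card ∧
      q * k * (unsat F α).card ≤ ((unsat F α).filter (NAE β)).card) :
    failAvg F δ (c * (n + 1)) ≤ ENNReal.ofReal (1 - 1 / 2 * ((1 + x) / 2) ^ n) := by
  refine (failAvg_le_ofReal (fun α => ?_)
    (fail_le_walk hk hk0 β h0 h1 hρ0 hρ1 hρ hq (c * (n + 1)))).trans (ENNReal.ofReal_le_ofReal ?_)
  · have : x ^ hammingDist α β ≤ 1 := pow_le_one₀ h0.le h1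
    have : 0 ≤ ρ ^ (c * (n + 1)) := by positivity
    linarith
  · simp only [Finset.sum_add_distrib, Finset.sum_sub_distrib, sum_pow_dist, Finset.sum_const,
      Finset.card_univ, Fintype.card_fun, Fintype.card_bool, Fintype.card_fin, nsmul_eq_mul,
      mul_one, Nat.cast_pow, Nat.cast_ofNat]
    rw [div_le_iff₀ (by positivity), div_pow]
    have h2 : ρ ^ (c * (n + 1)) ≤ (1 / 2) ^ (n + 1) := by
      rw [pow_mul]
      exact pow_le_pow_left₀ (by positivity) hc _
    have h3 : (2 : ℝ) ^ n * ρ ^ (c * (n + 1)) ≤ 1 / 2 := by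
      have := mul_le_mul_of_nonneg_left h2 (show (0 : ℝ) ≤ 2 ^ n by positivity)
      refine this.trans (le_of_eq ?_)
      rw [pow_succ, ← mul_assoc, ← mul_pow]
      norm_num
    have h4 : 1 ≤ (1 + x) ^ n := one_le_pow₀ (by linarith)
    have h5 : (1 - 1 / 2 * ((1 + x) ^ n / 2 ^ n)) * 2 ^ n = 2 ^ n - 1 / 2 * (1 + x) ^ n := by
      field_simp
    rw [h5]
    linarith

/-! ### Optimal assignments and random assignments -/

/-- The clauses with at least two literals. -/
def longs (F : Instance n) : Instance n := F.filter fun C => 2 ≤ C.card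

lemma NAE.two_le_card {α : Fin n → Bool} {C : Clause n} (h : NAE α C) : 2 ≤ C.card := by
  obtain ⟨⟨l, hl, h1⟩, l', hl', h2⟩ := h
  refine Finset.one_lt_card.2 ⟨l, hl, l', hl', ?_⟩
  rintro rfl
  simp [h1] at h2

lemma numSat_eq_longs (F : Instance n) (α : Fin n → Bool) :
    numSat F α = ((longs F).filter (NAE α)).card := by
  rw [numSat_eq, longs, Finset.filter_filter]
  congr 1
  ext C
  simp only [Finset.mem_filter]
  exact ⟨fun h => ⟨h.1, h.2.two_le_card, h.2⟩, fun h => ⟨h.1, h.2.2⟩⟩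

lemma numSat_add_unsat (F : Instance n) (α : Fin n → Bool) :
    numSat F α + (unsat F α).card = (longs F).card := by
  rw [numSat_eq_longs, unsat, ← Finset.filter_filter]
  exact Finset.card_filter_add_card_filter_not (s := longs F) (NAE α)

lemma exists_opt (F : Instance n) : ∃ α, numSat F α = opt F := by
  obtain ⟨α, -, h⟩ := Finset.exists_mem_eq_sup Finset.univ Finset.univ_nonempty (numSat F)
  exact ⟨α, h.symm⟩

lemma numSat_le_opt (F : Instance n) (α : Fin n → Bool) : numSat F α ≤ opt F :=
  Finset.le_sup (Finset.mem_univ α)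

lemma opt_le_longs (F : Instance n) : opt F ≤ (longs F).card := by
  obtain ⟨α, h⟩ := exists_opt F
  rw [← h, ← numSat_add_unsat F α]
  exact Nat.le_add_right _ _

lemma opt_le_numSat_add (F : Instance n) (α : Fin n → Bool) {β : Fin n → Bool}
    (hβ : numSat F β = opt F) : opt F ≤ numSat F α + ((unsat F α).filter (NAE β)).card := by
  rw [← hβ, numSat_eq_longs F β, numSat_eq_longs F α]
  refine (Finset.card_le_card fun C hC => ?_).trans (Finset.card_union_le _ _)
  simp only [longs, unsat, Finset.mem_filter, Finset.mem_union] at hC ⊢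
  tauto

/-- Walking is effective while the current assignment is not a `δ`-approximation. -/
lemma walk_condition {K r : ℝ} (hδ : δ ≤ 1) (hK : K ≤ 1)
    (hKr : K * (1 - r * δ) ≤ r * (1 - δ)) (hKδ : 0 ≤ 1 - δ + K * δ)
    (hr : r * (longs F).card ≤ opt F) {α β : Fin n → Bool}
    (hβ : numSat F β = opt F) (hα : ¬ IsApprox δ F α) :
    0 < (unsat F α).card ∧
      K * (unsat F α).card ≤ ((unsat F α).filter (NAE β)).card := by
  have h1 := opt_le_numSat_add F α hβ
  have h2 := numSat_add_unsat F α
  have h3 := opt_le_longs F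
  unfold IsApprox at hα
  push Not at hα
  have h1' : (opt F : ℝ) ≤ numSat F α + ((unsat F α).filter (NAE β)).card := by exact_mod_cast h1
  have h2' : (numSat F α : ℝ) + (unsat F α).card = (longs F).card := by exact_mod_cast h2
  have h3' : (opt F : ℝ) ≤ (longs F).card := by exact_mod_cast h3
  have h4 : (0 : ℝ) ≤ opt F := by positivity
  have h5 : (0 : ℝ) ≤ (longs F).card := by positivity
  constructor
  · have : (0 : ℝ) < (unsat F α).card := by nlinarith
    exact_mod_cast this
  -- With `s`, `o`, `m` for the value of `α`, the optimum and the number of long clauses, it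
  -- suffices that `o - s ≥ K (m - s)`. The difference does not increase with `s`, and `s < δ o`; so
  -- `o (1 - δ + K δ) ≥ K m` is enough, which follows from `o ≥ r m` and `hKr`.
  · have h6 := mul_le_mul_of_nonneg_left hr hKδ
    have h7 := mul_le_mul_of_nonneg_right hKr h5
    have h8 := mul_nonneg (sub_nonneg.2 hK) (sub_nonneg.2 hα.le)
    nlinarith

/-- Adding a literal on a new variable halves the set, since flipping that variable maps it
injectively to a disjoint part of the old set. A literal on an old variable is complementary to one
present and empties the set; hence only an inequality. -/
lemma card_all_eq (b : Bool) (C : Clause n) :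
    (Finset.univ.filter fun α : Fin n → Bool => ∀ l ∈ C, l.value α = b).card * 2 ^ C.card ≤
      2 ^ n := by
  induction C using Finset.induction_on with
  | empty => simp
  | insert l C hl ih =>
    rw [Finset.card_insert_of_notMem hl]
    set A := Finset.univ.filter fun α : Fin n → Bool => ∀ l ∈ C, l.value α = b with hA
    set B := Finset.univ.filter fun α : Fin n → Bool => ∀ l' ∈ insert l C, l'.value α = b with hB
    by_cases h : ∃ l' ∈ C, l'.1 = l.1
    · obtain ⟨l', hl', h1⟩ := h
      have h2 : l'.2 ≠ l.2 := fun h2 => hl (by rwa [← Prod.ext h1 h2])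
      have : B = ∅ := by
        refine Finset.eq_empty_of_forall_notMem fun α hα => ?_
        simp only [hB, Finset.mem_filter, Finset.mem_univ, true_and] at hα
        have e1 := hα l (Finset.mem_insert_self _ _)
        have e2 := hα l' (Finset.mem_insert_of_mem hl')
        rw [← e2] at e1
        simp only [Literal.value, h1] at e1
        revert h2 e1
        cases l'.2 <;> cases l.2 <;> cases α l.1 <;> simp
      simp [this]
    · push Not at h
      have hval : ∀ (α : Fin n → Bool), l.value (flipVar α l.1) = !l.value α := by
        intro α
        simp only [Literal.value, flipVar, Function.update_self]
        split_ifs <;> rfl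
      have hval' : ∀ (α : Fin n → Bool), ∀ l' ∈ C,
          Literal.value (flipVar α l.1) l' = l'.value α := by
        intro α l' hl'
        simp [Literal.value, flipVar, h l' hl']
      have hinj : Function.Injective fun α : Fin n → Bool => flipVar α l.1 := by
        refine Function.Involutive.injective fun α => ?_
        simp [flipVar]
      have hle : B.card + (B.image fun α => flipVar α l.1).card ≤ A.card := by
        rw [← Finset.card_union_of_disjoint]
        · refine Finset.card_le_card (Finset.union_subset ?_ ?_)
          · intro α hα
            simp only [hA, hB, Finset.mem_filter, Finset.mem_univ, true_and] at hα ⊢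
            exact fun l' hl' => hα l' (Finset.mem_insert_of_mem hl')
          · intro α hα
            obtain ⟨γ, hγ, rfl⟩ := Finset.mem_image.1 hα
            simp only [hA, hB, Finset.mem_filter, Finset.mem_univ, true_and] at hγ ⊢
            exact fun l' hl' => (hval' γ l' hl').trans (hγ l' (Finset.mem_insert_of_mem hl'))
        · rw [Finset.disjoint_left]
          intro α hα hα'
          obtain ⟨γ, hγ, rfl⟩ := Finset.mem_image.1 hα'
          simp only [hB, Finset.mem_filter, Finset.mem_univ, true_and] at hα hγ
          have e1 := hα l (Finset.mem_insert_self _ _)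
          have e2 := hγ l (Finset.mem_insert_self _ _)
          rw [hval, e2] at e1
          simp at e1
      rw [Finset.card_image_of_injective _ hinj] at hle
      calc _ = (B.card + B.card) * 2 ^ C.card := by ring
        _ ≤ A.card * 2 ^ C.card := by gcongr
        _ ≤ 2 ^ n := ih

lemma card_nae_ge (C : Clause n) :
    (2 : ℝ) ^ n * (1 - 2 / 2 ^ C.card) ≤
      (Finset.univ.filter fun α : Fin n → Bool => NAE α C).card := by
  have h1 := card_all_eq true C
  have h2 := card_all_eq false C
  have h3 : (Finset.univ.filter fun α : Fin n → Bool => ¬ NAE α C) ⊆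
      (Finset.univ.filter fun α : Fin n → Bool => ∀ l ∈ C, l.value α = true) ∪
      (Finset.univ.filter fun α : Fin n → Bool => ∀ l ∈ C, l.value α = false) := by
    intro α hα
    simp only [Finset.mem_filter, Finset.mem_univ, true_and, Finset.mem_union] at hα ⊢
    by_contra! h
    obtain ⟨⟨l, hl, h4⟩, l', hl', h5⟩ := h
    exact hα ⟨⟨l', hl', by simpa using h5⟩, l, hl, by simpa using h4⟩
  have h4 := (Finset.card_le_card h3).trans (Finset.card_union_le _ _)
  have h5 := Finset.card_filter_add_card_filter_not (s := (Finset.univ : Finset (Fin n → Bool)))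
    (fun α => NAE α C)
  simp only [Finset.card_univ, Fintype.card_fun, Fintype.card_bool, Fintype.card_fin] at h5
  set a := (Finset.univ.filter fun α : Fin n → Bool => ∀ l ∈ C, l.value α = true).card
  set b := (Finset.univ.filter fun α : Fin n → Bool => ∀ l ∈ C, l.value α = false).card
  have h1' : (a : ℝ) * 2 ^ C.card ≤ 2 ^ n := by exact_mod_cast h1
  have h2' : (b : ℝ) * 2 ^ C.card ≤ 2 ^ n := by exact_mod_cast h2
  rw [← le_div_iff₀ (by positivity)] at h1' h2'
  have h4' : ((Finset.univ.filter fun α : Fin n → Bool => ¬ NAE α C).card : ℝ) ≤ a + b := by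
    exact_mod_cast h4
  have h5' : ((Finset.univ.filter fun α : Fin n → Bool => NAE α C).card : ℝ) +
      (Finset.univ.filter fun α : Fin n → Bool => ¬ NAE α C).card = 2 ^ n := by exact_mod_cast h5
  have : (2 : ℝ) ^ n * (1 - 2 / 2 ^ C.card) = 2 ^ n - 2 ^ n / 2 ^ C.card - 2 ^ n / 2 ^ C.card := by
    ring
  linarith

lemma sum_numSat_ge (F : Instance n) :
    (2 : ℝ) ^ n * ∑ C ∈ longs F, (1 - 2 / (2 : ℝ) ^ C.card) ≤ ∑ α, (numSat F α : ℝ) := by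
  have h : ∑ α, (numSat F α : ℝ) =
      ∑ C ∈ longs F, ((Finset.univ.filter fun α : Fin n → Bool => NAE α C).card : ℝ) := by
    simp only [numSat_eq_longs, Finset.card_filter, Nat.cast_sum]
    exact Finset.sum_comm
  rw [h, Finset.mul_sum]
  exact Finset.sum_le_sum fun C _ => card_nae_ge C

-- Reverse Markov inequality: a non-approximation contributes at most `δ * opt F` to the sum, any
-- other assignment at most the number of long clauses.
open Classical in
lemma card_approx_ge {a : ℝ} (ha : 2 ^ n * a ≤ ∑ α, (numSat F α : ℝ)) (hδ : 0 ≤ δ) :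
    2 ^ n * (a - δ * opt F) ≤
      (Finset.univ.filter fun α : Fin n → Bool => IsApprox δ F α).card * (longs F).card := by
  have h : ∀ α : Fin n → Bool, (numSat F α : ℝ) ≤
      (if IsApprox δ F α then ((longs F).card : ℝ) else 0) + δ * opt F := by
    intro α
    have h1 : (numSat F α : ℝ) ≤ (longs F).card := by
      exact_mod_cast (numSat_le_opt F α).trans (opt_le_longs F)
    have h2 : 0 ≤ δ * (opt F : ℝ) := by positivity
    split_ifs with h3
    · linarith
    · unfold IsApprox at h3
      linarith
  have h' := ha.trans (Finset.sum_le_sum fun α _ => h α)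
  rw [Finset.sum_add_distrib, ← Finset.sum_filter, Finset.sum_const, Finset.sum_const,
    Finset.card_univ, Fintype.card_fun, Fintype.card_bool, Fintype.card_fin, nsmul_eq_mul,
    nsmul_eq_mul, Nat.cast_pow, Nat.cast_ofNat] at h'
  linarith

/-! ### Assignments that agree with an optimal one on many variables -/

/-- Average over the `n` cyclic translates of one set of size `w`; together they cover every element
exactly `w` times. -/
lemma exists_subset_sum_le (f : Fin n → ℝ) {w : ℕ} (hw : w ≤ n) :
    ∃ W : Finset (Fin n), W.card = w ∧ n * ∑ v ∈ W, f v ≤ w * ∑ v, f v := by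
  rcases Nat.eq_zero_or_pos n with rfl | hn
  · exact ⟨∅, by simp; omega, by simp⟩
  have : NeZero n := ⟨hn.ne'⟩
  obtain ⟨W₀, hW₀⟩ : ∃ W₀ : Finset (Fin n), W₀.card = w := by
    obtain ⟨W₀, -, h⟩ := Finset.exists_subset_card_eq (s := (Finset.univ : Finset (Fin n)))
      (by simpa using hw)
    exact ⟨W₀, h⟩
  have hsum : ∑ r : Fin n, n * ∑ v ∈ W₀, f (v + r) = ∑ _r : Fin n, w * ∑ v, f v := by
    rw [← Finset.mul_sum, Finset.sum_comm]
    have : ∀ v : Fin n, ∑ r, f (v + r) = ∑ u, f u := fun v =>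
      Equiv.sum_comp (Equiv.addLeft v) f
    simp [this, hW₀]
  obtain ⟨r, -, hr⟩ := Finset.exists_le_of_sum_le (Finset.univ_nonempty (α := Fin n)) hsum.le
  refine ⟨W₀.map (Equiv.addRight r).toEmbedding, by simp [hW₀], ?_⟩
  simpa using hr

lemma card_touched_le (S : Instance n) (W : Finset (Fin n)) :
    (S.filter fun C => ∃ l ∈ C, l.1 ∈ W).card ≤
      ∑ v ∈ W, ∑ C ∈ S, (C.filter fun l => l.1 = v).card := by
  rw [Finset.sum_comm, Finset.card_filter]
  refine Finset.sum_le_sum fun C _ => ?_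
  split_ifs with h
  · obtain ⟨l, hl, hlW⟩ := h
    have h1 : 1 ≤ (C.filter fun l' => l'.1 = l.1).card := Finset.card_pos.2 ⟨l, by simp [hl]⟩
    exact h1.trans (Finset.single_le_sum_of_canonicallyOrdered
      (f := fun v => (C.filter fun l' => l'.1 = v).card) hlW)
  · exact Nat.zero_le _

/-- Apply the averaging with the number of occurrences of each variable as its weight: the total
weight is the sum of the clause lengths. -/
lemma exists_few_touched (S : Instance n) {κ : ℝ} (hκ : 0 ≤ κ) (hκ1 : κ ≤ 1) :
    ∃ W : Finset (Fin n), W.card = ⌊κ * n⌋₊ ∧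
      ((S.filter fun C => ∃ l ∈ C, l.1 ∈ W).card : ℝ) ≤ κ * ∑ C ∈ S, (C.card : ℝ) := by
  have hw : ⌊κ * n⌋₊ ≤ n := by
    refine Nat.floor_le_of_le ?_
    have : (0 : ℝ) ≤ n := by positivity
    nlinarith
  obtain ⟨W, hW, hle⟩ := exists_subset_sum_le
    (fun v => ((∑ C ∈ S, (C.filter fun l => l.1 = v).card : ℕ) : ℝ)) hw
  refine ⟨W, hW, ?_⟩
  have htotal : ∑ v, ∑ C ∈ S, (C.filter fun l => l.1 = v).card = ∑ C ∈ S, C.card := by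
    rw [Finset.sum_comm]
    refine Finset.sum_congr rfl fun C _ => ?_
    exact (Finset.card_eq_sum_card_fiberwise (f := fun l : Literal n => l.1) (t := Finset.univ)
      (by simp)).symm
  rw [← Nat.cast_sum, ← Nat.cast_sum, htotal] at hle
  have htouch : ((S.filter fun C => ∃ l ∈ C, l.1 ∈ W).card : ℝ) ≤
      ((∑ v ∈ W, ∑ C ∈ S, (C.filter fun l => l.1 = v).card : ℕ) : ℝ) :=
    Nat.cast_le.2 (card_touched_le S W)
  rw [← Nat.cast_sum]
  rcases Nat.eq_zero_or_pos n with hn | hn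
  · subst hn
    have : W = ∅ := Finset.eq_empty_of_isEmpty W
    rw [this, Finset.sum_empty, Nat.cast_zero] at htouch
    rw [this]
    exact htouch.trans (by positivity)
  · have hn' : (0 : ℝ) < n := by exact_mod_cast hn
    have hfl : (⌊κ * n⌋₊ : ℝ) ≤ κ * n := Nat.floor_le (by positivity)
    refine le_of_mul_le_mul_left ?_ hn'
    calc _ ≤ _ := mul_le_mul_of_nonneg_left htouch hn'.le
      _ ≤ _ := hle
      _ ≤ κ * n * ((∑ C ∈ S, C.card : ℕ) : ℝ) := by gcongr
      _ = _ := by ring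

lemma numSat_ge_of_agree {α β : Fin n → Bool} {W : Finset (Fin n)}
    (h : ∀ v ∉ W, α v = β v) :
    numSat F β ≤ ((F.filter (NAE β)).filter fun C => ∃ l ∈ C, l.1 ∈ W).card + numSat F α := by
  have hsub : (F.filter (NAE β)).filter (fun C => ¬ ∃ l ∈ C, l.1 ∈ W) ⊆ F.filter (NAE α) := by
    intro C hC
    simp only [Finset.mem_filter, not_exists, not_and] at hC ⊢
    refine ⟨hC.1.1, ?_⟩
    by_contra hn
    obtain ⟨l, hl, hne⟩ := exists_ne_of_nae hn hC.1.2
    exact hne (h _ (hC.2 l hl))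
  rw [numSat_eq F β, numSat_eq F α,
    ← Finset.card_filter_add_card_filter_not (s := F.filter (NAE β)) (fun C => ∃ l ∈ C, l.1 ∈ W)]
  exact Nat.add_le_add_left (Finset.card_le_card hsub) _

lemma card_agree (β : Fin n → Bool) (W : Finset (Fin n)) :
    (Fintype.piFinset fun v => if v ∈ W then (Finset.univ : Finset Bool) else {β v}).card =
      2 ^ W.card := by
  rw [Fintype.card_piFinset]
  simp only [apply_ite Finset.card, Finset.card_univ, Fintype.card_bool, Finset.card_singleton]
  rw [Finset.prod_ite_mem, Finset.univ_inter, Finset.prod_const]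

-- Freeing `⌊κ n⌋` well-chosen variables of an optimal `β` endangers at most `κ * θ * opt F ≤ (1 -
-- δ) * opt F` of its satisfied clauses. So all assignments agreeing with `β` elsewhere are
-- approximations.
open Classical in
lemma card_approx_ge_pow {θ κ : ℝ} {β : Fin n → Bool} (hβ : numSat F β = opt F)
    (hθ : ∑ C ∈ F.filter (NAE β), (C.card : ℝ) ≤ θ * opt F) (hκ : 0 ≤ κ) (hκ1 : κ ≤ 1)
    (hκθ : κ * θ ≤ 1 - δ) :
    2 ^ ⌊κ * n⌋₊ ≤ (Finset.univ.filter fun α : Fin n → Bool => IsApprox δ F α).card := by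
  obtain ⟨W, hW, hle⟩ := exists_few_touched (F.filter (NAE β)) hκ hκ1
  rw [← hW, ← card_agree β W]
  refine Finset.card_le_card fun α hα => ?_
  rw [Fintype.mem_piFinset] at hα
  simp only [Finset.mem_filter, Finset.mem_univ, true_and]
  have h := numSat_ge_of_agree (F := F) (α := α) (β := β) (W := W)
    fun v hv => by simpa [hv] using hα v
  rw [hβ] at h
  have h' : (opt F : ℝ) ≤
      ((F.filter (NAE β)).filter fun C => ∃ l ∈ C, l.1 ∈ W).card + numSat F α := by
    exact_mod_cast h
  have h1 := mul_le_mul_of_nonneg_left hθ hκ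
  have h2 := mul_le_mul_of_nonneg_right hκθ (show (0 : ℝ) ≤ opt F by positivity)
  unfold IsApprox
  linarith

end MaxNAE

/-! ### Solving the equation system, and the three cases of the analysis. -/

namespace MaxNAE

/-! ### The equation system -/

/-- The slope of the linear interpolation of `1 - 2 / 2 ^ i` between `i = 2` and `i = k`. -/
noncomputable def slope (k : ℕ) : ℝ := (1 / 2 - 2 / 2 ^ k) / ((k : ℝ) - 2)

/-- Concavity of `c ↦ 1 - 2 ^ (-c)`, which vanishes at 0: the quotient by `c` decreases. The
cross-multiplied form also covers `a = 0`. -/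
lemma mul_one_sub_pow_le {a b : ℕ} (h : a ≤ b) :
    (a : ℝ) * (1 - (1 / 2) ^ b) ≤ b * (1 - (1 / 2) ^ a) := by
  induction b, h using Nat.le_induction with
  | base => exact le_rfl
  | succ b hab ih =>
    have h1 : (1 / 2 : ℝ) ^ b ≤ (1 / 2) ^ a := pow_le_pow_of_le_one (by norm_num) (by norm_num) hab
    have h2 : (a : ℝ) + 1 ≤ 2 ^ a := by exact_mod_cast Nat.lt_two_pow_self
    have h3 : (a : ℝ) * (1 / 2) ^ a + (1 / 2) ^ a ≤ 1 := by
      have := mul_le_mul_of_nonneg_right h2 (show (0 : ℝ) ≤ (1 / 2) ^ a by positivity)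
      rw [← mul_pow] at this
      norm_num at this ⊢
      linarith
    have h4 := mul_le_mul_of_nonneg_left h1 (show (0 : ℝ) ≤ a by positivity)
    have h5 : 0 ≤ (a : ℝ) * (1 / 2) ^ a := by positivity
    rw [pow_succ]
    push_cast
    linarith

lemma slope_nonneg {k : ℕ} (hk : 2 ≤ k) : 0 ≤ slope k := by
  have h1 : (2 : ℝ) ≤ k := by exact_mod_cast hk
  have h2 : (4 : ℝ) ≤ 2 ^ k := by
    have := pow_le_pow_right₀ (one_le_two (α := ℝ)) hk
    linarith
  refine div_nonneg ?_ (by linarith)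
  rw [sub_nonneg, div_le_div_iff₀ (by positivity) (by positivity)]
  linarith

/-- A concave function lies above its chord; shifting the lengths by 2 reduces this to
`mul_one_sub_pow_le`. -/
lemma interpolation_le {i k : ℕ} (hi : 2 ≤ i) (hik : i ≤ k) :
    1 / 2 + ((i : ℝ) - 2) * slope k ≤ 1 - 2 / 2 ^ i := by
  obtain ⟨a, rfl⟩ := Nat.exists_eq_add_of_le hi
  obtain ⟨b, rfl⟩ := Nat.exists_eq_add_of_le (hi.trans hik)
  have h := mul_one_sub_pow_le (show a ≤ b by omega)
  have e : ∀ c : ℕ, (2 : ℝ) / 2 ^ (2 + c) = (1 / 2) * (1 / 2) ^ c := by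
    intro c
    rw [pow_add, div_pow, one_pow]
    field_simp
  unfold slope
  rw [e, e]
  push_cast
  rw [add_sub_cancel_left, add_sub_cancel_left]
  rcases Nat.eq_zero_or_pos b with rfl | hb
  -- Here `k = 2`, and `slope` is 0 by the convention for division by zero.
  · obtain rfl : a = 0 := by omega
    norm_num
  · have hb' : (0 : ℝ) < b := by exact_mod_cast hb
    have : (a : ℝ) * ((1 / 2 - 1 / 2 * (1 / 2) ^ b) / b) ≤ 1 / 2 * (1 - (1 / 2) ^ a) := by
      rw [← mul_div_assoc, div_le_iff₀ hb']
      linarith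
    linarith

/-- The fraction of clauses that a random assignment satisfies, if the average length is `η`. -/
noncomputable def xi (k : ℕ) (η : ℝ) : ℝ := 1 / 2 + (η - 2) * slope k

/-- The bound for the average length of the clauses that an optimal assignment satisfies. -/
noncomputable def theta (k : ℕ) (η : ℝ) : ℝ := 2 + (η - 2) / xi k η

/-- The base of the running time of the walk. -/
noncomputable def walkBase (k : ℕ) (δ ξ : ℝ) : ℝ := 2 - (2 * ξ - 2 * ξ * δ) / (k - ξ * δ * k)

variable {k : ℕ} {δ : ℝ}

lemma half_le_xi (hk : 2 ≤ k) {η : ℝ} (hη : 2 ≤ η) : 1 / 2 ≤ xi k η := by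
  have := mul_nonneg (sub_nonneg.2 hη) (slope_nonneg hk)
  unfold xi
  linarith

lemma xi_self (hk : 3 ≤ k) : xi k k = 1 - 2 / 2 ^ k := by
  have h1 : (3 : ℝ) ≤ k := by exact_mod_cast hk
  unfold xi slope
  rw [mul_div_cancel₀ _ (by linarith)]
  ring

lemma xi_mono (hk : 2 ≤ k) : Monotone (xi k) := by
  intro a b h
  have := mul_le_mul_of_nonneg_right h (slope_nonneg hk)
  unfold xi
  linarith

lemma xi_lt_one (hk : 3 ≤ k) {η : ℝ} (hη : η ≤ k) : xi k η < 1 := by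
  refine (xi_mono (by omega) hη).trans_lt ?_
  rw [xi_self hk]
  have : (0 : ℝ) < 2 / 2 ^ k := by positivity
  linarith

lemma theta_mono (hk : 2 ≤ k) {a b : ℝ} (ha : 2 ≤ a) (h : a ≤ b) : theta k a ≤ theta k b := by
  have h1 := half_le_xi hk ha
  have h2 := half_le_xi hk (ha.trans h)
  unfold theta
  rw [add_le_add_iff_left, div_le_div_iff₀ (by linarith) (by linarith)]
  unfold xi
  nlinarith

lemma two_le_theta (hk : 2 ≤ k) {η : ℝ} (hη : 2 ≤ η) : 2 ≤ theta k η := by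
  have h1 := half_le_xi hk hη
  have := div_nonneg (sub_nonneg.2 hη) (show 0 ≤ xi k η by linarith)
  unfold theta
  linarith

lemma walkBase_anti (hk : 0 < k) (hδ₀ : 0 ≤ δ) (hδ₁ : δ ≤ 1) {a b : ℝ} (ha : 0 ≤ a) (h : a ≤ b)
    (hb : b < 1) : walkBase k δ b ≤ walkBase k δ a := by
  have hk' : (0 : ℝ) < k := by exact_mod_cast hk
  have h1 : 0 < 1 - b * δ := by nlinarith
  have h2 : 0 < 1 - a * δ := by nlinarith
  unfold walkBase
  rw [sub_le_sub_iff_left, show (k : ℝ) - a * δ * k = (1 - a * δ) * k by ring,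
    show (k : ℝ) - b * δ * k = (1 - b * δ) * k by ring]
  refine div_le_div₀ ?_ ?_ (by positivity) ?_
  · nlinarith
  · nlinarith
  · refine mul_le_mul_of_nonneg_right ?_ hk'.le
    nlinarith

lemma system_two {γ ξ θ η : ℝ} : System 2 δ γ ξ θ η ↔ ξ = 1 / 2 ∧ γ = walkBase 2 δ ξ := by
  unfold System walkBase
  simp

/-- The equations are `xi` and `theta` in disguise: the last one reads `2 / (θ - 2) = 2 * ξ / (η -
2)`. So `η` determines everything, and what remains is one equation between two expressions for `γ`.
-/
lemma system_iff (hk : 3 ≤ k) {γ ξ θ η : ℝ} : System k δ γ ξ θ η ↔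
    (2 < η ∧ η ≤ k) ∧ ξ = xi k η ∧ θ = theta k η ∧ γ = walkBase k δ ξ ∧
      γ = (2 : ℝ) ^ (θ / (1 - δ + θ)) := by
  have h3 : (3 : ℝ) ≤ k := by exact_mod_cast hk
  have hk2 : (k : ℝ) - 2 ≠ 0 := by linarith
  obtain ⟨b, rfl⟩ := Nat.exists_eq_add_of_le (show 2 ≤ k by omega)
  have hpow : (0 : ℝ) < 2 ^ b := by positivity
  have hxi : (2 ^ (2 + b - 1) * (η + ((2 + b : ℕ) : ℝ) - 4) - 2 * η + 4) /
      (2 ^ (2 + b) * (((2 + b : ℕ) : ℝ) - 2)) = xi (2 + b) η := by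
    unfold xi slope
    rw [show 2 + b - 1 = b + 1 by omega, show 2 + b = b + 2 by omega, pow_succ, pow_add]
    rw [add_comm] at hk2
    field_simp
    ring
  have htheta : 2 < η → (2 / (θ - 2) = 1 / (η - 2) + 1 / (((2 + b : ℕ) : ℝ) - 2) *
      ((2 ^ (2 + b - 2) - 1) / 2 ^ (2 + b - 2)) ↔ θ = theta (2 + b) η) := by
    intro hη
    have hη' : 0 < η - 2 := by linarith
    have hx := half_le_xi (k := 2 + b) (by omega) hη.le
    have hx0 : 0 < xi (2 + b) η := by linarith
    have h4 : 1 / (η - 2) + 1 / (((2 + b : ℕ) : ℝ) - 2) * ((2 ^ (2 + b - 2) - 1) / 2 ^ (2 + b - 2))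
        = 2 / ((η - 2) / xi (2 + b) η) := by
      rw [div_div_eq_mul_div]
      unfold xi slope
      rw [show 2 + b - 2 = b by omega, show 2 + b = b + 2 by omega, pow_add]
      rw [add_comm] at hk2
      field_simp
    rw [h4]
    unfold theta
    constructor
    · intro h
      -- Inversion is injective even with `0⁻¹ = 0`, so `θ = 2` needs no separate treatment.
      rw [div_eq_mul_inv, div_eq_mul_inv] at h
      have h5 := inv_inj.1 (mul_left_cancel₀ two_ne_zero h)
      linarith
    · rintro rfl
      rw [add_sub_cancel_left]
  unfold System
  rw [if_neg (by omega), hxi]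
  constructor
  · rintro ⟨h1, h2, h4⟩
    obtain ⟨h5, h6, h7, h8⟩ := h4 hk
    exact ⟨⟨h5, h6⟩, h1, (htheta h5).1 h8, h2, h7⟩
  · rintro ⟨⟨h5, h6⟩, h1, h8, h2, h7⟩
    exact ⟨h1, h2, fun _ => ⟨h5, h6, h7, (htheta h5).2 h8⟩⟩

lemma splitExponent_mono (hδ₁ : δ ≤ 1) {a b : ℝ} (ha : 0 < a) (h : a ≤ b) :
    a / (1 - δ + a) ≤ b / (1 - δ + b) := by
  rw [div_le_div_iff₀ (by linarith) (by linarith)]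
  nlinarith

/-- For `k ≥ 3`, the exponential expression for `γ` is nondecreasing in `η` through `theta`, and
`walkBase` is nonincreasing in `η` through `xi`. Two solutions with `η ≤ η'` therefore satisfy both
`γ ≤ γ'` and `γ' ≤ γ`. -/
lemma system_unique (hk : 2 ≤ k) (hδ₀ : 0 ≤ δ) (hδ₁ : δ ≤ 1) {γ ξ θ η γ' ξ' θ' η' : ℝ}
    (h : System k δ γ ξ θ η) (h' : System k δ γ' ξ' θ' η') : γ = γ' := by
  rcases hk.eq_or_lt with rfl | hk3
  · rw [system_two] at h h'
    rw [h.2, h'.2, h.1, h'.1]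
  · rw [system_iff hk3] at h h'
    wlog hle : η ≤ η' generalizing γ ξ θ η γ' ξ' θ' η'
    · exact (this h' h (le_of_not_ge hle)).symm
    obtain ⟨⟨h1, h2⟩, rfl, rfl, h3, h4⟩ := h
    obtain ⟨⟨h1', h2'⟩, rfl, rfl, h3', h4'⟩ := h'
    refine le_antisymm ?_ ?_
    · rw [h4, h4']
      refine Real.rpow_le_rpow_of_exponent_le one_le_two (splitExponent_mono hδ₁ ?_ ?_)
      · linarith [two_le_theta hk h1.le]
      · exact theta_mono hk h1.le hle
    · rw [h3, h3']
      exact walkBase_anti (by omega) hδ₀ hδ₁ (by linarith [half_le_xi hk h1.le]) (xi_mono hk hle)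
        (xi_lt_one hk3 h2')

lemma walkBase_lt_two (hk : 0 < k) (hδ₀ : 0 ≤ δ) (hδ₁ : δ < 1) {ξ : ℝ} (h0 : 0 < ξ) (h1 : ξ < 1) :
    walkBase k δ ξ < 2 := by
  have hk' : (0 : ℝ) < k := by exact_mod_cast hk
  have h2 : 0 < 1 - ξ * δ := by nlinarith
  unfold walkBase
  rw [sub_lt_self_iff, show (k : ℝ) - ξ * δ * k = (1 - ξ * δ) * k by ring]
  refine div_pos ?_ (by positivity)
  nlinarith

lemma one_add_mul_log_two_le (s : ℝ) : 1 + s * Real.log 2 ≤ (2 : ℝ) ^ s := by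
  rw [Real.rpow_def_of_pos two_pos, mul_comm (Real.log 2)]
  linarith [Real.add_one_le_exp (s * Real.log 2)]

lemma two_rpow_split {x θ : ℝ} (h : 0 < x + θ) :
    (2 : ℝ) ^ (θ / (x + θ)) = 2 * 2 ^ (-(x / (x + θ))) := by
  nth_rw 2 [← Real.rpow_one 2]
  rw [← Real.rpow_add two_pos]
  congr 1
  field_simp
  ring

/-- At `η = 2` one has `ξ = 1 / 2` and `θ = 2`, and `k = 3` is the worst case. The tangent of `2 ^
s` at 0 reduces the claim to rational functions of `x = 1 - δ`. -/
lemma split_lt_walk (hk : 3 ≤ k) (hδ₀ : 0 ≤ δ) (hδ₁ : δ < 1) :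
    (2 : ℝ) ^ (theta k 2 / (1 - δ + theta k 2)) < walkBase k δ (xi k 2) := by
  have h3 : (3 : ℝ) ≤ k := by exact_mod_cast hk
  have e1 : xi k 2 = 1 / 2 := by simp [xi]
  have e2 : theta k 2 = 2 := by simp [theta]
  rw [e2, e1]
  obtain ⟨x, rfl⟩ : ∃ x, δ = 1 - x := ⟨1 - δ, by ring⟩
  have hx0 : 0 < x := by linarith
  have hx1 : x ≤ 1 := by linarith
  rw [show 1 - (1 - x) = x by ring, two_rpow_split (by linarith), Real.rpow_neg zero_le_two]
  set s := x / (x + 2) with hs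
  have hs0 : 0 < s := by positivity
  -- With `2 / 3 < log 2` in place of the logarithm, both sides of `h6` agree to first order at `x =
  -- 0`.
  have h4 : 1 + s * (2 / 3) < (2 : ℝ) ^ s := by
    refine lt_of_lt_of_le ?_ (one_add_mul_log_two_le s)
    have := Real.log_two_gt_d9
    nlinarith
  have h5 : ((2 : ℝ) ^ s)⁻¹ < (1 + s * (2 / 3))⁻¹ :=
    inv_strictAnti₀ (by positivity) h4
  have h6 : 2 * (1 + s * (2 / 3))⁻¹ ≤ 2 - 2 * x / (3 * (1 + x)) := by
    rw [hs]
    rw [show 2 - 2 * x / (3 * (1 + x)) = (6 + 4 * x) / (3 * (1 + x)) by field_simp; ring,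
      show 1 + x / (x + 2) * (2 / 3) = (5 * x + 6) / (3 * (x + 2)) by field_simp; ring, inv_div,
      ← mul_div_assoc, div_le_div_iff₀ (by positivity) (by positivity)]
    nlinarith
  have h7 : (2 * (1 / 2) - 2 * (1 / 2) * (1 - x)) / (k - 1 / 2 * (1 - x) * k) ≤
      2 * x / (3 * (1 + x)) := by
    rw [show 2 * (1 / 2) - 2 * (1 / 2) * (1 - x) = x by ring,
      show (k : ℝ) - 1 / 2 * (1 - x) * k = k * (1 + x) / 2 by ring, div_div_eq_mul_div,
      mul_comm x 2]
    gcongr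
  unfold walkBase
  linarith

/-- At `η = k` the tangent bound suffices because `log 2 < 3 / 4 ≤ ξ` and `k ≤ θ`. -/
lemma walk_le_split (hk : 3 ≤ k) (hδ₀ : 0 ≤ δ) (hδ₁ : δ < 1) :
    walkBase k δ (xi k k) ≤ (2 : ℝ) ^ (theta k k / (1 - δ + theta k k)) := by
  have h3 : (3 : ℝ) ≤ k := by exact_mod_cast hk
  have hξ1 := xi_lt_one hk (le_refl (k : ℝ))
  have hξ0 : 3 / 4 ≤ xi k k := by
    rw [xi_self hk]
    have h8 : (8 : ℝ) ≤ 2 ^ k := by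
      have := pow_le_pow_right₀ (one_le_two (α := ℝ)) hk
      linarith
    have : (2 : ℝ) / 2 ^ k ≤ 2 / 8 := by gcongr
    linarith
  have hθ : (k : ℝ) ≤ theta k k := by
    unfold theta
    have : (k : ℝ) - 2 ≤ (k - 2) / xi k k := by
      rw [le_div_iff₀ (by linarith)]
      nlinarith
    linarith
  set ξ := xi k k
  set θ := theta k k
  obtain ⟨x, rfl⟩ : ∃ x, δ = 1 - x := ⟨1 - δ, by ring⟩
  have hx0 : 0 < x := by linarith
  have hx1 : x ≤ 1 := by linarith
  rw [show 1 - (1 - x) = x by ring, two_rpow_split (by linarith)]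
  have h4 := one_add_mul_log_two_le (-(x / (x + θ)))
  have h5 : x / (x + θ) * Real.log 2 ≤ ξ * x / (k * (1 - ξ + ξ * x)) := by
    have hlog := Real.log_two_lt_d9
    have hden : 0 < 1 - ξ + ξ * x := by nlinarith
    have hden1 : 1 - ξ + ξ * x ≤ 1 := by nlinarith
    rw [div_mul_eq_mul_div, div_le_div_iff₀ (by linarith) (by positivity)]
    have h6 : Real.log 2 * (k * (1 - ξ + ξ * x)) ≤ ξ * (x + θ) := by
      calc Real.log 2 * (k * (1 - ξ + ξ * x)) ≤ 3 / 4 * (k * 1) := by gcongr; linarith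
        _ ≤ ξ * (x + θ) := by nlinarith
    nlinarith
  have h7 : (2 * ξ - 2 * ξ * (1 - x)) / (k - ξ * (1 - x) * k) =
      2 * (ξ * x / (k * (1 - ξ + ξ * x))) := by
    rw [← mul_div_assoc]
    congr 1 <;> ring
  unfold walkBase
  rw [h7]
  linarith

/-- For `k ≥ 3` and `δ < 1` apply the intermediate value theorem in `η` on `[2, k]`; strictness at
`η = 2` excludes that endpoint. For `δ = 1` both expressions for `γ` equal 2, and `η = k` is one
choice. -/
lemma exists_system (hk : 2 ≤ k) (hδ₀ : 0 ≤ δ) (hδ₁ : δ ≤ 1) :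
    ∃ γ ξ θ η : ℝ, System k δ γ ξ θ η := by
  rcases hk.eq_or_lt with rfl | hk3
  · exact ⟨walkBase 2 δ (1 / 2), 1 / 2, 0, 0, system_two.2 ⟨rfl, rfl⟩⟩
  have hk3' : 3 ≤ k := hk3
  have h3 : (3 : ℝ) ≤ k := by exact_mod_cast hk3'
  rcases hδ₁.eq_or_lt with rfl | hδ
  · refine ⟨2, xi k k, theta k k, k, (system_iff hk3').2 ⟨⟨by linarith, le_rfl⟩, rfl, rfl, ?_, ?_⟩⟩
    · simp [walkBase]
    · have := two_le_theta hk (show (2 : ℝ) ≤ k by linarith)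
      rw [sub_self, zero_add, div_self (by linarith), Real.rpow_one]
  set h : ℝ → ℝ := fun η => (2 : ℝ) ^ (theta k η / (1 - δ + theta k η)) - walkBase k δ (xi k η)
  have hcxi : Continuous (xi k) := by
    unfold xi
    fun_prop
  have hctheta : ContinuousOn (theta k) (Set.Icc 2 k) := by
    unfold theta
    refine continuousOn_const.add (ContinuousOn.div (by fun_prop) hcxi.continuousOn ?_)
    intro η hη
    linarith [half_le_xi hk hη.1]
  have hcont : ContinuousOn h (Set.Icc 2 k) := by
    refine ContinuousOn.sub ?_ ?_
    · refine ContinuousOn.rpow continuousOn_const (hctheta.div (continuousOn_const.add hctheta) ?_)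
        (fun _ _ => Or.inl two_ne_zero)
      intro η hη
      linarith [two_le_theta hk hη.1]
    · unfold walkBase
      refine continuousOn_const.sub (ContinuousOn.div
        ((continuous_const.mul hcxi).sub ((continuous_const.mul hcxi).mul
          continuous_const)).continuousOn
        (continuous_const.sub ((hcxi.mul continuous_const).mul continuous_const)).continuousOn ?_)
      intro η hη
      have h4 := half_le_xi hk hη.1
      have h5 := xi_lt_one hk3' hη.2
      have h6 : 0 < 1 - xi k η * δ := by nlinarith
      have : 0 < (1 - xi k η * δ) * k := by positivity
      linarith
  have h2 : h 2 < 0 := sub_neg.2 (split_lt_walk hk3' hδ₀ hδ)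
  have hk' : 0 ≤ h k := sub_nonneg.2 (walk_le_split hk3' hδ₀ hδ)
  obtain ⟨η, hη, h0⟩ := intermediate_value_Icc (show (2 : ℝ) ≤ k by linarith) hcont ⟨h2.le, hk'⟩
  refine ⟨_, _, _, η, (system_iff hk3').2 ⟨⟨lt_of_le_of_ne hη.1 ?_, hη.2⟩, rfl, rfl, rfl, ?_⟩⟩
  · rintro rfl
    exact h2.ne h0
  · exact (sub_eq_zero.1 h0).symm

/-! ### The success probability of a trial -/

lemma longs_card_bounds {n : ℕ} {F : Instance n} (hF : IsKInstance k F) {C : Clause n}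
    (hC : C ∈ longs F) : 2 ≤ C.card ∧ C.card ≤ k := by
  simp only [longs, Finset.mem_filter] at hC
  exact ⟨hC.2, hF C hC.1⟩

lemma sum_numSat_ge_interpolation {n : ℕ} {F : Instance n} (hF : IsKInstance k F) :
    2 ^ n * (1 / 2 * ((longs F).card : ℝ) + (∑ C ∈ longs F, ((C.card : ℝ) - 2)) * slope k) ≤
      ∑ α, (numSat F α : ℝ) := by
  refine le_trans ?_ (sum_numSat_ge F)
  refine mul_le_mul_of_nonneg_left ?_ (by positivity)
  rw [Finset.sum_mul, mul_comm (1 / 2 : ℝ), ← nsmul_eq_mul, ← Finset.sum_const,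
    ← Finset.sum_add_distrib]
  refine Finset.sum_le_sum fun C hC => ?_
  obtain ⟨h1, h2⟩ := longs_card_bounds hF hC
  exact interpolation_le h1 h2

lemma opt_ge_interpolation {n : ℕ} {F : Instance n} (hF : IsKInstance k F) :
    1 / 2 * ((longs F).card : ℝ) + (∑ C ∈ longs F, ((C.card : ℝ) - 2)) * slope k ≤ opt F := by
  have h1 := sum_numSat_ge_interpolation hF
  have h2 : ∑ α, (numSat F α : ℝ) ≤ 2 ^ n * opt F := by
    refine (Finset.sum_le_card_nsmul _ _ (opt F : ℝ) fun α _ => ?_).trans (le_of_eq ?_)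
    · exact_mod_cast numSat_le_opt F α
    · simp
  exact le_of_mul_le_mul_left (h1.trans h2) (by positivity)

open Classical in
/-- If the clauses are short on average, guessing most of an optimal assignment suffices. -/
lemma failAvg_le_of_short {n : ℕ} {F : Instance n} (hk : 2 ≤ k) (hF : IsKInstance k F)
    (hδ₀ : 0 ≤ δ) (hδ₁ : δ ≤ 1)
    {η : ℝ} (hη : 2 ≤ η) (hlen : ∑ C ∈ longs F, ((C.card : ℝ) - 2) ≤ (η - 2) * (longs F).card)
    (j : ℕ) :
    failAvg F δ (j + 1) ≤
      ENNReal.ofReal (1 - 1 / 2 / ((2 : ℝ) ^ (1 - (1 - δ) / theta k η)) ^ n) := by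
  obtain ⟨β, hβ⟩ := exists_opt F
  have hξ := half_le_xi hk hη
  have hθ := two_le_theta hk hη
  have hB := slope_nonneg hk
  have hopt := opt_ge_interpolation hF
  set y := ∑ C ∈ longs F, ((C.card : ℝ) - 2) with hy
  have h1 : ∑ C ∈ F.filter (NAE β), (C.card : ℝ) ≤ theta k η * opt F := by
    have h2 : ∑ C ∈ F.filter (NAE β), ((C.card : ℝ) - 2) ≤ y := by
      refine Finset.sum_le_sum_of_subset_of_nonneg ?_ ?_
      · intro C hC
        simp only [longs, Finset.mem_filter] at hC ⊢
        exact ⟨hC.1, hC.2.two_le_card⟩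
      · intro C hC _
        have : (2 : ℝ) ≤ C.card := by exact_mod_cast (longs_card_bounds hF hC).1
        linarith
    rw [Finset.sum_sub_distrib, Finset.sum_const, nsmul_eq_mul, ← numSat_eq, hβ] at h2
    -- By `hlen` and `opt_ge_interpolation`, `(η - 2) * opt F` is at least `y / 2 + (η - 2) * y *
    -- slope k`, which is `y * xi k η`.
    have h3 : y ≤ (theta k η - 2) * opt F := by
      unfold theta
      rw [add_sub_cancel_left, div_mul_eq_mul_div, le_div_iff₀ (by linarith)]
      have h4 := mul_le_mul_of_nonneg_left hopt (sub_nonneg.2 hη)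
      refine le_trans ?_ h4
      unfold xi
      linarith
    linarith
  have hθ0 : 0 < theta k η := by linarith
  have hκ0 : 0 ≤ (1 - δ) / theta k η := div_nonneg (by linarith) hθ0.le
  have hκ1 : (1 - δ) / theta k η ≤ 1 := by
    rw [div_le_one hθ0]
    linarith
  have hcard := card_approx_ge_pow (δ := δ) hβ h1 hκ0 hκ1 (by rw [div_mul_cancel₀ _ hθ0.ne'])
  set κ := (1 - δ) / theta k η
  refine failAvg_le_of_card j ?_
  refine le_trans ?_ (Nat.cast_le.2 hcard)
  -- Rounding down costs at most a factor 2, the `1 / 2` in the bound.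
  have hfl : κ * n - 1 ≤ (⌊κ * n⌋₊ : ℝ) := (Nat.sub_one_lt_floor _).le
  rw [Nat.cast_pow, Nat.cast_ofNat, ← Real.rpow_natCast 2 ⌊κ * n⌋₊]
  refine le_trans (le_of_eq ?_) (Real.rpow_le_rpow_of_exponent_le one_le_two hfl)
  rw [← Real.rpow_natCast, ← Real.rpow_mul zero_le_two, ← Real.rpow_natCast,
    show (1 / 2 : ℝ) = 2 ^ (-1 : ℝ) by rw [Real.rpow_neg_one]; norm_num,
    ← Real.rpow_sub two_pos, ← Real.rpow_add two_pos]
  congr 1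
  ring

open Classical in
/-- If an optimal assignment is little better than a random one, guessing suffices. -/
lemma failAvg_le_of_opt_lt {n : ℕ} {F : Instance n} (hδ₀ : 0 ≤ δ) {ξ ξ₁ : ℝ}
    (hsum : 2 ^ n * (ξ * (longs F).card) ≤ ∑ α, (numSat F α : ℝ))
    (hopt : (opt F : ℝ) < ξ₁ * (longs F).card) (j : ℕ) :
    failAvg F δ (j + 1) ≤ ENNReal.ofReal (1 - (ξ - δ * ξ₁)) := by
  have h1 := card_approx_ge hsum hδ₀
  have hm : (0 : ℝ) < (longs F).card := by
    have h2 : (0 : ℝ) ≤ (longs F).card := by positivity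
    have h3 : (opt F : ℝ) ≤ (longs F).card := by exact_mod_cast opt_le_longs F
    have h4 : (0 : ℝ) ≤ opt F := by positivity
    refine lt_of_le_of_ne h2 fun h => ?_
    rw [← h, mul_zero] at hopt
    linarith
  refine failAvg_le_of_card j (le_of_mul_le_mul_right ?_ hm)
  refine le_trans ?_ h1
  have h2 : δ * opt F ≤ δ * (ξ₁ * (longs F).card) := mul_le_mul_of_nonneg_left hopt.le hδ₀
  have h3 := mul_le_mul_of_nonneg_left h2 (show (0 : ℝ) ≤ 2 ^ n by positivity)
  nlinarith

/-- A walk with a slightly better bound than `walkBase`. -/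
lemma exists_walk (hk : 2 ≤ k) (hδ₀ : 0 ≤ δ) (hδ₁ : δ < 1) {ξ : ℝ} (h0 : 0 < ξ) (h1 : ξ < 1) :
    ∃ ξ₁ b : ℝ, ∃ c : ℕ, 0 < c ∧ δ * ξ₁ < ξ ∧ 1 < b ∧ b < walkBase k δ ξ ∧
      ∀ (n : ℕ) (F : Instance n), IsKInstance k F → ξ₁ * (longs F).card ≤ opt F →
        failAvg F δ (c * (n + 1)) ≤ ENNReal.ofReal (1 - 1 / 2 / b ^ n) := by
  have hk2 : (2 : ℝ) ≤ k := by exact_mod_cast hk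
  have hk0 : (0 : ℝ) < k := by linarith
  -- The increment is positive, which gives the walk room below `walkBase k δ ξ`, yet small enough
  -- for `ξ₁ < 1` and `δ * ξ₁ < ξ`.
  set ξ₁ := ξ + (1 - δ) * ξ * (1 - ξ) / 2 with hξ₁
  have hinc : 0 < (1 - δ) * ξ * (1 - ξ) := mul_pos (mul_pos (by linarith) h0) (by linarith)
  have hlt : ξ < ξ₁ := by linarith
  have hlt1 : ξ₁ < 1 := by
    have h2 : (1 - δ) * ξ ≤ 1 := by nlinarith
    have := mul_le_mul_of_nonneg_right h2 (sub_nonneg.2 h1.le)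
    linarith
  have hδξ : δ * ξ₁ < ξ := by
    have h2 : δ * (1 + (1 - δ) * (1 - ξ) / 2) < 1 := by
      have h3 : 0 < (1 - δ) * ξ := mul_pos (by linarith) h0
      have h4 : 0 < (1 - δ) * (1 - δ) := mul_pos (by linarith) (by linarith)
      have h5 := mul_nonneg hδ₀ h3.le
      linarith
    have := mul_lt_mul_of_pos_right h2 h0
    rw [hξ₁]
    linarith
  have hd0 : 0 < 1 - ξ * δ := by nlinarith
  have hd1 : 0 < 1 - ξ₁ * δ := by nlinarith
  -- `K` is the fraction from `walk_condition` and `q` the resulting probability of a step towards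
  -- `β`; `p` is the same for `ξ` itself, so that `walkBase k δ ξ = 2 * (1 - p)`.
  set K := ξ₁ * (1 - δ) / (1 - ξ₁ * δ) with hK
  set p := ξ * (1 - δ) / (1 - ξ * δ) / k with hp
  set q := K / k with hq
  have hKle : K ≤ 1 := by
    rw [hK, div_le_one hd1]
    nlinarith
  have hK0 : 0 < K := div_pos (mul_pos (by linarith) (by linarith)) hd1
  have hp0 : 0 < p := div_pos (div_pos (mul_pos h0 (by linarith)) hd0) hk0
  have hpq : p < q := by
    rw [hp, hq, hK]
    refine div_lt_div_of_pos_right ?_ hk0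
    rw [div_lt_div_iff₀ hd0 hd1]
    nlinarith
  have hq1 : q ≤ 1 / 2 := by
    rw [hq, div_le_div_iff₀ hk0 two_pos]
    linarith
  -- The growth factor `x + q * (1 / x - x)` equals 1 at `x = q / (1 - q)` and at `x = 1`. Using `r
  -- < q` makes it exceed 1, and `r > p` makes the base `2 / (1 + x) = 2 * (1 - r)` smaller than `2
  -- * (1 - p)`.
  set r := (p + q) / 2 with hr
  have hr1 : p < r := by linarith
  have hr2 : r < q := by linarith
  set x := r / (1 - r) with hx
  have hx0 : 0 < x := div_pos (by linarith) (by linarith)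
  have hxr : x * (1 - r) = r := div_mul_cancel₀ _ (by linarith)
  have hx1 : x < 1 := by
    rw [hx, div_lt_one (by linarith)]
    linarith
  have hxq : 0 < q - (1 - q) * x := by nlinarith
  set z := x + q * (1 / x - x) with hz
  have hz1 : 1 < z := by
    have : x * (z - 1) = (1 - x) * (q - (1 - q) * x) := by
      rw [hz]
      field_simp
      ring
    have h2 : 0 < x * (z - 1) := by
      rw [this]
      exact mul_pos (by linarith) hxq
    have := pos_of_mul_pos_right h2 hx0.le
    linarith
  obtain ⟨c, hc⟩ := exists_pow_lt_of_lt_one (show (0 : ℝ) < 1 / 2 by norm_num)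
    (show z⁻¹ < 1 from inv_lt_one_of_one_lt₀ hz1)
  have hc0 : 0 < c := by
    refine Nat.pos_of_ne_zero fun h => ?_
    rw [h, pow_zero] at hc
    norm_num at hc
  refine ⟨ξ₁, 2 / (1 + x), c, hc0, hδξ, ?_, ?_, ?_⟩
  · rw [lt_div_iff₀ (by linarith)]
    linarith
  · have h2 : walkBase k δ ξ = 2 * (1 - p) := by
      unfold walkBase
      rw [hp, div_div, show (1 - ξ * δ) * (k : ℝ) = k - ξ * δ * k by ring]
      ring
    have h3 : 1 + x = 1 / (1 - r) := by
      rw [eq_div_iff (by linarith)]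
      linarith
    rw [h2, h3, div_div_eq_mul_div, div_one]
    linarith
  · intro n F hF hopt
    obtain ⟨β, hβ⟩ := exists_opt F
    refine (failAvg_le_walk (q := q) hF (by omega) β hx0 hx1.le (inv_pos.2 (by linarith))
      (inv_lt_one_of_one_lt₀ hz1).le (by rw [inv_mul_cancel₀ (by linarith)]) hc.le ?_).trans
      (ENNReal.ofReal_le_ofReal ?_)
    · intro α hα
      rw [hq, div_mul_cancel₀ _ hk0.ne']
      refine walk_condition hδ₁.le hKle ?_ ?_ hopt hβ hα
      · rw [hK, div_mul_cancel₀ _ hd1.ne']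
      · have : 0 ≤ K * δ := mul_nonneg hK0.le hδ₀
        linarith
    · rw [div_pow, div_pow, div_div_eq_mul_div]
      refine le_of_eq ?_
      field_simp

/-- A program contains only natural numbers as constants, so a base whose powers it can approximate
by doubling is needed in the gap below `γ`. -/
lemma exists_rational_exponent {a γ : ℝ} (ha : 1 < a) (h : a < γ) :
    ∃ u w : ℕ, 0 < w ∧ a ≤ (2 : ℝ) ^ ((u : ℝ) / w) ∧ (2 : ℝ) ^ ((u : ℝ) / w) ≤ γ := by
  have h1 : Real.logb 2 a < Real.logb 2 γ := Real.logb_lt_logb one_lt_two (by linarith) h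
  have h0 : 0 < Real.logb 2 a := Real.logb_pos one_lt_two ha
  obtain ⟨r, hr1, hr2⟩ := exists_rat_btwn h1
  have hr0 : 0 < r := by exact_mod_cast h0.trans hr1
  have hr : (r : ℝ) = (r.num.toNat : ℝ) / r.den := by
    have h2 : ((r.num.toNat : ℤ) : ℝ) = (r.num : ℝ) := by
      rw [Int.toNat_of_nonneg (Rat.num_pos.2 hr0).le]
    rw [← Int.cast_natCast, h2]
    exact_mod_cast (Rat.num_div_den r).symm
  refine ⟨r.num.toNat, r.den, r.den_pos, ?_, ?_⟩
  · rw [← hr, ← Real.logb_le_iff_le_rpow one_lt_two (by linarith)]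
    exact hr1.le
  · rw [← hr, ← Real.le_logb_iff_rpow_le one_lt_two (by linarith)]
    exact hr2.le

/-- Suitable constants for `algorithm`. -/
def GoodConstants (k : ℕ) (δ γ : ℝ) (u w c : ℕ) (c₀ : ℝ) : Prop :=
  0 < w ∧ 0 < c₀ ∧ (2 : ℝ) ^ ((u : ℝ) / w) ≤ γ ∧
    ∀ (n : ℕ) (F : Instance n), IsKInstance k F →
      failAvg F δ (c * (n + 1)) ≤ ENNReal.ofReal (1 - c₀ / ((2 : ℝ) ^ ((u : ℝ) / w)) ^ n)

/-- A random start hits a given optimal assignment with probability `2 ^ (-n)`; no gap is needed, as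
the base 2 has a rational exponent. -/
lemma exists_goodConstants_one (k : ℕ) : ∃ u w c c₀, GoodConstants k 1 2 u w c c₀ := by
  classical
  refine ⟨1, 1, 1, 1, one_pos, one_pos, by norm_num, ?_⟩
  intro n F hF
  rw [one_mul]
  refine failAvg_le_of_card n ?_
  obtain ⟨β, hβ⟩ := exists_opt F
  have : 1 ≤ (Finset.univ.filter fun α : Fin n → Bool => IsApprox 1 F α).card := by
    refine Finset.card_pos.2 ⟨β, ?_⟩
    simp [IsApprox, hβ]
  have h' : (1 : ℝ) ≤ (Finset.univ.filter fun α : Fin n → Bool => IsApprox 1 F α).card := by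
    exact_mod_cast this
  refine le_trans (le_of_eq ?_) h'
  norm_num

/-- Short clauses (base `b₀`), a small optimum (constant probability) and the walk (base `b₁`)
exhaust all instances. One rational exponent above both bases and one constant `c₀` serve all three.
-/
lemma exists_goodConstants_aux (hk : 2 ≤ k) (hδ₀ : 0 ≤ δ) (hδ₁ : δ < 1) {ξ b₀ : ℝ} (h0 : 0 < ξ)
    (h1 : ξ < 1) (hb₀ : b₀ < walkBase k δ ξ)
    (h : ∀ (n : ℕ) (F : Instance n), IsKInstance k F →
      (0 < b₀ ∧ ∀ j, failAvg F δ (j + 1) ≤ ENNReal.ofReal (1 - 1 / 2 / b₀ ^ n)) ∨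
      2 ^ n * (ξ * (longs F).card) ≤ ∑ α, (numSat F α : ℝ)) :
    ∃ u w c c₀, GoodConstants k δ (walkBase k δ ξ) u w c c₀ := by
  obtain ⟨ξ₁, b₁, c, hc, hξ₁, hb1, hb, hwalk⟩ := exists_walk hk hδ₀ hδ₁ h0 h1
  obtain ⟨u, w, hw, hle, hge⟩ := exists_rational_exponent (a := max b₀ b₁) (lt_max_of_lt_right hb1)
    (max_lt hb₀ hb)
  set b := (2 : ℝ) ^ ((u : ℝ) / w)
  have hb0' : b₀ ≤ b := (le_max_left _ _).trans hle
  have hb1' : b₁ ≤ b := (le_max_right _ _).trans hle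
  set c₀ := min (1 / 2) (ξ - δ * ξ₁)
  have hc0 : 0 < c₀ := lt_min (by norm_num) (by linarith)
  refine ⟨u, w, c, c₀, hw, hc0, hge, ?_⟩
  intro n F hF
  obtain ⟨j, hj⟩ : ∃ j, c * (n + 1) = j + 1 :=
    ⟨c * (n + 1) - 1, by have : 0 < c * (n + 1) := by positivity
                         omega⟩
  have hcomp : ∀ a : ℝ, 0 < a → a ≤ b → 1 - 1 / 2 / a ^ n ≤ 1 - c₀ / b ^ n := by
    intro a ha hab
    have h2 : c₀ / b ^ n ≤ 1 / 2 / a ^ n :=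
      div_le_div₀ (by norm_num) (min_le_left _ _) (by positivity) (pow_le_pow_left₀ ha.le hab n)
    linarith
  rcases h n F hF with ⟨hb0, h2⟩ | h2
  · rw [hj]
    exact (h2 j).trans (ENNReal.ofReal_le_ofReal (hcomp b₀ hb0 hb0'))
  · rcases lt_or_ge (opt F : ℝ) (ξ₁ * (longs F).card) with h3 | h3
    · rw [hj]
      refine (failAvg_le_of_opt_lt hδ₀ h2 h3 j).trans (ENNReal.ofReal_le_ofReal ?_)
      have h4 : c₀ / b ^ n ≤ ξ - δ * ξ₁ :=
        (div_le_self hc0.le (one_le_pow₀ (by linarith))).trans (min_le_right _ _)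
      linarith
    · exact (hwalk n F hF h3).trans (ENNReal.ofReal_le_ofReal (hcomp b₁ (by linarith) hb1'))

lemma exists_goodConstants (hk : 2 ≤ k) (hδ₀ : 0 ≤ δ) (hδ₁ : δ ≤ 1) {γ ξ θ η : ℝ}
    (h : System k δ γ ξ θ η) : ∃ u w c c₀, GoodConstants k δ γ u w c c₀ := by
  rcases hδ₁.eq_or_lt with rfl | hδ
  · have : γ = 2 := by
      rw [h.2.1]
      simp
    rw [this]
    exact exists_goodConstants_one k
  rcases hk.eq_or_lt with rfl | hk3
  · rw [system_two] at h
    obtain ⟨rfl, rfl⟩ := h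
    -- For `k = 2` the first alternative is never taken, so any `b₀` below `walkBase` will do.
    refine exists_goodConstants_aux (b₀ := walkBase 2 δ (1 / 2) - 1) le_rfl hδ₀ hδ (by norm_num)
      (by norm_num) (by linarith) fun n F hF => Or.inr ?_
    have := sum_numSat_ge_interpolation hF
    simpa [slope] using this
  · have hk3' : 3 ≤ k := hk3
    rw [system_iff hk3'] at h
    obtain ⟨⟨h1, h2⟩, rfl, rfl, h3, h4⟩ := h
    have hξ := half_le_xi hk h1.le
    have hθ := two_le_theta hk h1.le
    -- The exponent in the system is `1 - (1 - δ) / (1 - δ + θ)`; its larger denominator leaves the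
    -- gap needed for a rational exponent.
    have hb₀ : (2 : ℝ) ^ (1 - (1 - δ) / theta k η) < γ := by
      rw [h4]
      refine Real.rpow_lt_rpow_of_exponent_lt one_lt_two ?_
      rw [lt_div_iff₀ (by linarith), one_sub_mul, div_mul_eq_mul_div, sub_lt_iff_lt_add,
        ← sub_lt_iff_lt_add', add_sub_cancel_right, lt_div_iff₀ (by linarith)]
      nlinarith
    rw [h3] at hb₀ ⊢
    refine exists_goodConstants_aux hk hδ₀ hδ (by linarith) (xi_lt_one hk3' h2) hb₀ fun n F hF => ?_
    rcases le_or_gt (∑ C ∈ longs F, ((C.card : ℝ) - 2)) ((η - 2) * (longs F).card) with h5 | h5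
    · exact Or.inl ⟨by positivity, failAvg_le_of_short hk hF hδ₀ hδ₁ h1.le h5⟩
    · right
      refine le_trans ?_ (sum_numSat_ge_interpolation hF)
      refine mul_le_mul_of_nonneg_left ?_ (by positivity)
      have := mul_le_mul_of_nonneg_right h5.le (slope_nonneg hk)
      unfold xi
      linarith

end MaxNAE

/-! ### The subexponential factor and the number of trials. -/

namespace MaxNAE

/-! ### Polynomial bounds -/

/-- `f` is bounded by a polynomial. -/
def PolyBdd (f : ℕ → ℕ) : Prop := ∃ C e : ℕ, ∀ n, f n ≤ C * (n + 1) ^ e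

lemma PolyBdd.const (c : ℕ) : PolyBdd fun _ => c := ⟨c, 0, fun n => by simp⟩

lemma PolyBdd.id : PolyBdd fun n => n := ⟨1, 1, fun n => by simp⟩

lemma PolyBdd.add {f g : ℕ → ℕ} (hf : PolyBdd f) (hg : PolyBdd g) :
    PolyBdd fun n => f n + g n := by
  obtain ⟨C, e, h⟩ := hf
  obtain ⟨D, d, h'⟩ := hg
  refine ⟨C + D, e + d, fun n => ?_⟩
  have h1 : (n + 1) ^ e ≤ (n + 1) ^ (e + d) := Nat.pow_le_pow_right (by omega) (by omega)
  have h2 : (n + 1) ^ d ≤ (n + 1) ^ (e + d) := Nat.pow_le_pow_right (by omega) (by omega)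
  rw [add_mul]
  exact Nat.add_le_add ((h n).trans (Nat.mul_le_mul_left C h1))
    ((h' n).trans (Nat.mul_le_mul_left D h2))

lemma PolyBdd.mul {f g : ℕ → ℕ} (hf : PolyBdd f) (hg : PolyBdd g) :
    PolyBdd fun n => f n * g n := by
  obtain ⟨C, e, h⟩ := hf
  obtain ⟨D, d, h'⟩ := hg
  refine ⟨C * D, e + d, fun n => (Nat.mul_le_mul (h n) (h' n)).trans (le_of_eq ?_)⟩
  rw [pow_add]
  ring

lemma PolyBdd.pow {f : ℕ → ℕ} (hf : PolyBdd f) (k : ℕ) : PolyBdd fun n => f n ^ k := by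
  induction k with
  | zero => simpa using PolyBdd.const 1
  | succ k ih => simpa only [pow_succ] using ih.mul hf

lemma PolyBdd.isLittleO_logb {f : ℕ → ℕ} (hf : PolyBdd f) (h1 : ∀ n, 1 ≤ f n) :
    (fun n => Real.logb 2 (f n)) =o[atTop] fun n : ℕ => (n : ℝ) := by
  obtain ⟨C, e, h⟩ := hf
  have hC : 0 < C := by
    refine Nat.pos_of_ne_zero fun h0 => ?_
    have := (h1 0).trans (h 0)
    simp [h0] at this
  have hlog : (fun n : ℕ => Real.log ((n : ℝ) + 1)) =o[atTop] fun n : ℕ => (n : ℝ) := by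
    have h2 : Tendsto (fun n : ℕ => (n : ℝ) + 1) atTop atTop :=
      tendsto_atTop_add_const_right _ _ tendsto_natCast_atTop_atTop
    refine (Real.isLittleO_log_id_atTop.comp_tendsto h2).trans_isBigO ?_
    refine IsBigO.of_bound 2 ?_
    filter_upwards [eventually_ge_atTop 1] with n hn
    have hn' : (1 : ℝ) ≤ n := by exact_mod_cast hn
    simp only [Function.comp, _root_.id, Real.norm_eq_abs]
    rw [abs_of_nonneg (by linarith), abs_of_nonneg (by linarith)]
    linarith
  have hconst : (fun _ : ℕ => Real.log C) =o[atTop] fun n : ℕ => (n : ℝ) := by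
    refine isLittleO_const_left.2 (Or.inr ?_)
    exact tendsto_norm_atTop_atTop.comp tendsto_natCast_atTop_atTop
  refine IsBigO.trans_isLittleO ?_ (hconst.add (hlog.const_mul_left (e : ℝ)))
  refine IsBigO.of_bound (1 / Real.log 2) (Eventually.of_forall fun n => ?_)
  have h2 : (1 : ℝ) ≤ f n := by exact_mod_cast h1 n
  have h3 : (f n : ℝ) ≤ C * ((n : ℝ) + 1) ^ e := by exact_mod_cast h n
  have h4 : Real.log (f n) ≤ Real.log C + e * Real.log ((n : ℝ) + 1) := by
    rw [← Real.log_pow, ← Real.log_mul (by positivity) (by positivity)]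
    exact Real.log_le_log (by linarith) h3
  have h5 : 0 ≤ Real.log (f n) := Real.log_nonneg h2
  have hl2 : 0 < Real.log 2 := Real.log_pos one_lt_two
  rw [Real.norm_eq_abs, Real.norm_eq_abs, abs_of_nonneg (h5.trans h4),
    abs_of_nonneg (Real.logb_nonneg one_lt_two h2), Real.logb, one_div, inv_mul_eq_div]
  gcongr

/-! ### The running time -/

lemma card_le_of_isKInstance {n k : ℕ} {F : Instance n} (hF : IsKInstance k F) :
    F.card ≤ (k + 1) * (2 * n + 1) ^ k := by
  have h1 : F ⊆ (Finset.range (k + 1)).biUnion fun i => Finset.powersetCard i Finset.univ := by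
    intro C hC
    simp only [Finset.mem_biUnion, Finset.mem_range, Finset.mem_powersetCard]
    exact ⟨C.card, Nat.lt_succ_of_le (hF C hC), Finset.subset_univ _, rfl⟩
  refine (Finset.card_le_card h1).trans (Finset.card_biUnion_le.trans ?_)
  refine (Finset.sum_le_card_nsmul _ _ ((2 * n + 1) ^ k) fun i hi => ?_).trans (by simp)
  rw [Finset.card_powersetCard, Finset.card_univ, Fintype.card_prod, Fintype.card_fin,
    Fintype.card_bool]
  refine (Nat.choose_le_pow _ _).trans ?_
  calc (n * 2) ^ i ≤ (2 * n + 1) ^ i := Nat.pow_le_pow_left (by omega) _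
    _ ≤ (2 * n + 1) ^ k := Nat.pow_le_pow_right (by omega) (by simpa [Nat.lt_succ_iff] using hi)

/-- The time is affine in `M`, so the exponential number `M` splits off and a polynomial remains. -/
lemma algorithmTime_le (n k u' u w c M : ℕ) {m m' : ℕ} (h : m ≤ m') :
    algorithmTime n m k u' u w c M ≤ algorithmTime n m' k u' u w c 1 * (M + 1) := by
  have h1 : trialTime n m k (c * (n + 1)) ≤ trialTime n m' k (c * (n + 1)) := by
    unfold trialTime walkStepTime
    gcongr
  unfold algorithmTime trialsTime
  set a := roundsTime n c
  set t := trialTime n m k (c * (n + 1))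
  set t' := trialTime n m' k (c * (n + 1))
  have h2 : M * t ≤ M * t' := Nat.mul_le_mul_left M h1
  nlinarith [Nat.zero_le (M * a), Nat.zero_le (n * u), Nat.zero_le (n * u * M),
    Nat.zero_le (M * n * w), Nat.zero_le (M * n), Nat.zero_le (u' * M), Nat.zero_le t']

/-- The polynomial factor in the running time. -/
def polyFactor (k u' u w c n : ℕ) : ℕ :=
  algorithmTime n ((k + 1) * (2 * n + 1) ^ k) k u' u w c 1 * (n * 2 ^ (u' + u) + 1)

lemma one_le_polyFactor (k u' u w c n : ℕ) : 1 ≤ polyFactor k u' u w c n := by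
  unfold polyFactor algorithmTime
  exact Nat.mul_pos (by omega) (by omega)

lemma polyBdd_polyFactor (k u' u w c : ℕ) : PolyBdd (polyFactor k u' u w c) := by
  have hc := PolyBdd.const
  have hm : PolyBdd fun n => (k + 1) * (2 * n + 1) ^ k :=
    (hc _).mul ((((hc 2).mul .id).add (hc 1)).pow k)
  have hstep : PolyBdd fun n => walkStepTime n ((k + 1) * (2 * n + 1) ^ k) k :=
    (((hm.mul (hc _)).add (PolyBdd.id.mul (hc 5))).add (hc _)).add (hc 33)
  have htrial : PolyBdd fun n => trialTime n ((k + 1) * (2 * n + 1) ^ k) k (c * (n + 1)) :=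
    ((PolyBdd.id.mul (hc 6)).add
      (((hc c).mul (PolyBdd.id.add (hc 1))).mul (hstep.add (hc 1)))).add (hc 7)
  have hrounds : PolyBdd fun n => roundsTime n c := (PolyBdd.id.mul (hc _)).add (hc 4)
  have htrials : PolyBdd fun n => trialsTime n u' u w 1 :=
    ((hc _).add (PolyBdd.id.mul (hc _))).add (hc 6)
  exact (hrounds.add (htrials.add (((hc 1).mul (htrial.add (hc 3))).add (hc 1)))).mul
    ((PolyBdd.id.mul (hc _)).add (hc 1))

lemma rpow_div_pow_le {u w n r : ℕ} (hw : 0 < w) (h : n ≤ r * w) :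
    ((2 : ℝ) ^ ((u : ℝ) / w)) ^ n ≤ 2 ^ (u * r) := by
  have hw' : (0 : ℝ) < w := by exact_mod_cast hw
  have h' : (n : ℝ) ≤ r * w := by exact_mod_cast h
  rw [← Real.rpow_natCast, ← Real.rpow_mul zero_le_two, ← Real.rpow_natCast 2 (u * r)]
  refine Real.rpow_le_rpow_of_exponent_le one_le_two ?_
  rw [div_mul_eq_mul_div, div_le_iff₀ hw']
  push_cast
  have := mul_le_mul_of_nonneg_left h' (show (0 : ℝ) ≤ u by positivity)
  linarith

lemma pow_le_rpow_div_pow (u w n : ℕ) :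
    (2 : ℝ) ^ (u * (n / w)) ≤ ((2 : ℝ) ^ ((u : ℝ) / w)) ^ n := by
  rw [← Real.rpow_natCast _ n, ← Real.rpow_mul zero_le_two, ← Real.rpow_natCast 2 (u * (n / w))]
  refine Real.rpow_le_rpow_of_exponent_le one_le_two ?_
  rw [div_mul_eq_mul_div, mul_div_assoc, Nat.cast_mul]
  exact mul_le_mul_of_nonneg_left Nat.cast_div_le (by positivity)

/-- By `1 - y ≤ exp (-y)`, a batch of `2 ^ (u' + u * r)` trials fails with probability at most `exp
(-1) < 1 / 2`; `n` batches give `2 ^ (-n)`. -/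
lemma pow_trials_le {p : ENNReal} {u' u w n r : ℕ} {c₀ : ℝ} (hw : 0 < w) (hc₀ : 0 < c₀)
    (hu' : 1 ≤ c₀ * 2 ^ u') (hr : n ≤ r * w)
    (hp : p ≤ ENNReal.ofReal (1 - c₀ / ((2 : ℝ) ^ ((u : ℝ) / w)) ^ n)) :
    p ^ (n * 2 ^ (u' + u * r)) ≤ (1 / 2) ^ n := by
  set b := (2 : ℝ) ^ ((u : ℝ) / w)
  have hb : 0 < b ^ n := by positivity
  have h1 : p ≤ ENNReal.ofReal (Real.exp (-(c₀ / b ^ n))) := by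
    refine hp.trans (ENNReal.ofReal_le_ofReal ?_)
    have := Real.add_one_le_exp (-(c₀ / b ^ n))
    linarith
  have h2 : (1 : ℝ) ≤ c₀ / b ^ n * 2 ^ (u' + u * r) := by
    rw [div_mul_eq_mul_div, le_div_iff₀ hb, pow_add, ← mul_assoc]
    exact mul_le_mul hu' (rpow_div_pow_le hw hr) hb.le (by positivity)
  calc p ^ (n * 2 ^ (u' + u * r))
      ≤ ENNReal.ofReal (Real.exp (-(c₀ / b ^ n))) ^ (n * 2 ^ (u' + u * r)) := by gcongr
    _ = ENNReal.ofReal (Real.exp (-(c₀ / b ^ n * 2 ^ (u' + u * r)))) ^ n := by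
      rw [mul_comm, pow_mul, ← ENNReal.ofReal_pow (Real.exp_pos _).le, ← Real.exp_nat_mul]
      congr 3
      push_cast
      ring
    _ ≤ ENNReal.ofReal (1 / 2) ^ n := by
      gcongr
      refine (Real.exp_le_exp.2 (neg_le_neg h2)).trans ?_
      have h3 := Real.exp_one_gt_d9
      rw [Real.exp_neg, one_div]
      exact inv_anti₀ two_pos (by linarith)
    _ = (1 / 2) ^ n := by
      rw [ENNReal.ofReal_div_of_pos two_pos, ENNReal.ofReal_one, ENNReal.ofReal_ofNat]

lemma hasApproximation_of_goodConstants {k u w c : ℕ} {δ γ c₀ : ℝ}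
    (h : GoodConstants k δ γ u w c c₀) : HasApproximation k δ fun n => γ ^ n := by
  obtain ⟨hw, hc₀, hγ, hfail⟩ := h
  obtain ⟨u', hu'⟩ : ∃ u' : ℕ, 1 ≤ c₀ * 2 ^ u' := by
    obtain ⟨u', h⟩ := pow_unbounded_of_one_lt (1 / c₀) (one_lt_two (α := ℝ))
    rw [div_lt_iff₀ hc₀] at h
    exact ⟨u', by linarith⟩
  have hb1 : (1 : ℝ) ≤ (2 : ℝ) ^ ((u : ℝ) / w) := Real.one_le_rpow one_le_two (by positivity)
  refine ⟨algorithm u' u w c, Or.inl (ratioFree_algorithm u' u w c),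
    -- With this exponent `2 ^ f n` is exactly the polynomial factor.
    fun n => Real.logb 2 (polyFactor k u' u w c n),
    (polyBdd_polyFactor k u' u w c).isLittleO_logb (one_le_polyFactor k u' u w c), ?_⟩
  refine approximates_of_spec (c := fun n m => algorithmTime n m k u' u w c
    (n * 2 ^ (u' + u * (n / w + 1)))) ?_ ?_
  · intro n F hF
    have h1 : (0 : ℝ) < polyFactor k u' u w c n := by
      exact_mod_cast one_le_polyFactor k u' u w c n
    rw [Real.rpow_logb two_pos (by norm_num) h1]
    have h2 := algorithmTime_le n k u' u w c (n * 2 ^ (u' + u * (n / w + 1)))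
      (card_le_of_isKInstance hF)
    have h3 : ((n * 2 ^ (u' + u * (n / w + 1)) + 1 : ℕ) : ℝ) ≤
        (n * 2 ^ (u' + u) + 1 : ℕ) * γ ^ n := by
      have h4 : (2 : ℝ) ^ (u * (n / w)) ≤ γ ^ n :=
        (pow_le_rpow_div_pow u w n).trans (pow_le_pow_left₀ (by linarith) hγ n)
      have h5 : 1 ≤ γ ^ n := one_le_pow₀ (by linarith)
      have h6 := mul_le_mul_of_nonneg_left h4 (show (0 : ℝ) ≤ n * 2 ^ (u' + u) by positivity)
      have h7 : (n : ℝ) * 2 ^ (u' + u * (n / w + 1)) =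
          n * 2 ^ (u' + u) * 2 ^ (u * (n / w)) := by
        rw [mul_assoc, ← pow_add]
        congr 2
        ring
      push_cast
      rw [h7]
      linarith
    calc _ ≤ ((algorithmTime n ((k + 1) * (2 * n + 1) ^ k) k u' u w c 1 *
          (n * 2 ^ (u' + u * (n / w + 1)) + 1) : ℕ) : ℝ) := Nat.cast_le.2 h2
      _ = (algorithmTime n ((k + 1) * (2 * n + 1) ^ k) k u' u w c 1 : ℝ) *
          ((n * 2 ^ (u' + u * (n / w + 1)) + 1 : ℕ) : ℝ) := Nat.cast_mul _ _
      _ ≤ (algorithmTime n ((k + 1) * (2 * n + 1) ^ k) k u' u w c 1 : ℝ) *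
          ((n * 2 ^ (u' + u) + 1 : ℕ) * γ ^ n) := by gcongr
      _ = _ := by
        rw [polyFactor, Nat.cast_mul]
        ring
  · intro n F hF L hL
    exact spec_algorithm hL hF hw le_rfl fun r hr =>
      pow_trials_le hw hc₀ hu' hr (hfail n F hF)

end MaxNAE

/-! ### The main theorem. -/

theorem theorem6 (k : ℕ) (hk : 2 ≤ k) (δ : ℝ) (hδ₀ : 0 ≤ δ) (hδ₁ : δ ≤ 1) :
    (∃! γ : ℝ, ∃ ξ θ η : ℝ, MaxNAE.System k δ γ ξ θ η) ∧
    ∀ γ ξ θ η : ℝ, MaxNAE.System k δ γ ξ θ η →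
      MaxNAE.HasApproximation k δ (fun n => γ ^ n) ∧ (δ < 1 → γ < 2) := by
  refine ⟨?_, fun γ ξ θ η h => ⟨?_, fun hδ => ?_⟩⟩
  · obtain ⟨γ, hγ⟩ := MaxNAE.exists_system hk hδ₀ hδ₁
    refine ⟨γ, hγ, ?_⟩
    rintro γ' ⟨ξ', θ', η', h'⟩
    obtain ⟨ξ, θ, η, h⟩ := hγ
    exact MaxNAE.system_unique hk hδ₀ hδ₁ h' h
  · obtain ⟨u, w, c, c₀, h'⟩ := MaxNAE.exists_goodConstants hk hδ₀ hδ₁ h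
    exact MaxNAE.hasApproximation_of_goodConstants h'
  · rcases hk.eq_or_lt with rfl | hk3
    · rw [MaxNAE.system_two] at h
      rw [h.2, h.1]
      exact MaxNAE.walkBase_lt_two two_pos hδ₀ hδ (by norm_num) (by norm_num)
    · rw [MaxNAE.system_iff hk3] at h
      obtain ⟨⟨h1, h2⟩, rfl, rfl, h3, -⟩ := h
      rw [h3]
      exact MaxNAE.walkBase_lt_two (by omega) hδ₀ hδ (by linarith [MaxNAE.half_le_xi hk h1.le])
        (MaxNAE.xi_lt_one hk3 h2)
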